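/- Let $k$ be a field of characteristic zero. For a $k$-algebra $A$ put $A^e=A\otimes_k A^{\mathrm{op}}$ and let $\nu$ be a $k$-algebra automorphism of $A$. The algebra $A$ is called $\nu$-twisted Calabi–Yau of dimension $d$ (and $\nu$ its Nakayama automorphism, unique up to inner automorphisms) if $A$ has a resolution of finite length by finitely generated projective $A^e$-modules, $\mathrm{Ext}^i_{A^e}(A,A^e)=0$ for $i\neq d$, and $\mathrm{Ext}^d_{A^e}(A,A^e)\cong A^{\nu}$ as $A$-bimodules. Here $\mathrm{Ext}$ is taken with respect to the outer structure $a(m\otimes n)b=am\otimes nb$ of $A^e$, its bimodule structure is induced by the inner one, $b\cdot(m\otimes n)\cdot a=ma\otimes bn$, and $A^\nu$ is $A$ with the action $b\cdot m\cdot a=bm\nu(a)$. The algebra $A$ is called Calabi–Yau if it is $\mathrm{id}$-twisted Calabi–Yau of some dimension. **Theorem.** 1. Let $p,q\in k\setminus\{0\}$ with $2p^4-p^2q+q^2=0$, and let $D=k\langle x,y\rangle/(r_1,r_2,r_3)$, where $$\begin{aligned} r_1&=x^3y+p\,x^2yx+q\,xyx^2-p(2p^2+q)\,yx^3,\\ r_2&=x^2y^2-p(p^2+q)\,yxyx-q^2\,y^2x^2+(q-p^2)\,xy^2x+(q-p^2)\,yx^2y,\\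 r_3&=xy^3+p\,yxy^2+q\,y^2xy-p(2p^2+q)\,y^3x. \end{aligned}$$ Then $D$ is twisted Calabi–Yau of dimension $5$ with Nakayama automorphism $\nu$ given by $\nu(x)=p^{-3}q^4x$, $\nu(y)=p^3q^{-4}y$. Moreover $D$ is Calabi–Yau if and only if $p^3=q^4$ and $2p^4-p^2q+q^2=0$. 2. Let $p,q,s,g\in k\setminus\{0\}$ with $ps^3g+qsg^2+s^5+g^3=0$, $p^3s=q^3$, $ps\ne q^2$, $q^2s^2\neq g^2$ and $s^5+g^3\neq0$, and let $G=k\langle x,y\rangle/(r_1,r_2,r_3)$, where $$\begin{aligned} r_1&=x^3y+p\,x^2yx+q\,xyx^2+s\,yx^3,\\ r_2&=x^2y^2+l_2\,xyxy+l_3\,yxyx+l_4\,y^2x^2+l_5\,xy^2x+l_5\,yx^2y,\\ r_3&=xy^3+p\,yxy^2+q\,y^2xy+s\,y^3x, \end{aligned}$$ $$l_2=-\frac{s^2(qs-g)}{g(qs+g)},\quad l_3=s-\frac{pg(ps-q^2)}{q(qs+g)},\quad l_4=-\frac{g^2}{s^2},\quad l_5=\frac{ps^2+qg}{qs+g}.$$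 Then $G$ is twisted Calabi–Yau of dimension $5$ with Nakayama automorphism $\nu$ given by $\nu(x)=gx$, $\nu(y)=g^{-1}y$. Moreover $G$ is Calabi–Yau if and only if $g=1$. -/

import Mathlib

open CategoryTheory TensorProduct MulOpposite

universe u v

noncomputable section

namespace TwistedCY

section General

variable (k : Type v) (A : Type u) [CommRing k] [Ring A] [Algebra k A]

/-- The enveloping algebra `A ⊗ Aᵒᵖ`; left modules over it are the `A`-`A`-bimodules
(on which the two actions of `k` agree). -/
abbrev Env : Type u := A ⊗[k] Aᵐᵒᵖ

/-- `A` as a left module over its enveloping algebra, `(a ⊗ b) • x = a * x * b`. -/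
abbrev diagonal : ModuleCat.{u} (Env k A) :=
  letI : Module (Env k A) A := instModuleTensorProductMop k A
  ModuleCat.of (Env k A) A

/-- The left regular module of the enveloping algebra: the outer bimodule structure
`a · (m ⊗ n) · b = am ⊗ nb` on `A ⊗ A`. -/
abbrev regular : ModuleCat.{u} (Env k A) := ModuleCat.of (Env k A) (Env k A)

variable {A} in
/-- Right multiplication by `w` on the enveloping algebra, a morphism of left modules.
For `w = a ⊗ b` it is the inner action `m ⊗ n ↦ ma ⊗ bn`, with `ma` and `bn` formed in `A`. -/
def rightMul (w : Env k A) : regular k A ⟶ regular k A :=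
  ModuleCat.ofHom (LinearMap.toSpanSingleton (Env k A) (Env k A) w)

lemma diagonal_smul (a b x : A) :
    letI : Module (Env k A) A := instModuleTensorProductMop k A
    ((a ⊗ₜ[k] op b : Env k A) • x : A) = a * x * b := by
  simp [TensorProduct.Algebra.smul_def, mul_assoc]

lemma rightMul_tmul (m n a b : A) :
    (rightMul k (a ⊗ₜ[k] op b)).hom (m ⊗ₜ[k] op n : Env k A) = (m * a) ⊗ₜ[k] op (b * n) := by
  simp [rightMul]

/-- `Ext^n(A, Aᵉ)` over the enveloping algebra `Aᵉ`, where `Aᵉ` carries the outer structure. -/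
abbrev ExtEnv (n : ℕ) : Type u := Abelian.Ext.{u} (diagonal k A) (regular k A) n

variable {k A} in
/-- The bimodule action `b · ξ · a` on `Ext^n(A, Aᵉ)` induced by the inner structure of `Aᵉ`:
functoriality of `Ext` in its second argument, applied to right multiplication by `a ⊗ b`. -/
def innerAct {n : ℕ} (b : A) (ξ : ExtEnv k A n) (a : A) : ExtEnv k A n :=
  ξ.comp (Abelian.Ext.mk₀ (rightMul k (a ⊗ₜ[k] op b))) (add_zero n)

/-- `A` is homologically smooth: as a module over its enveloping algebra it has a resolution of
finite length by finitely generated projective modules. -/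
def HomologicallySmooth : Prop :=
  ∃ P : ProjectiveResolution (diagonal k A),
    (∀ n, Module.Finite (Env k A) (P.complex.X n)) ∧
    ∃ N : ℕ, ∀ n, N < n → Limits.IsZero (P.complex.X n)

variable {A} in
/-- `A` is `ν`-twisted Calabi-Yau of dimension `d`: it is homologically smooth,
`Ext^i(A, Aᵉ) = 0` for `i ≠ d`, and `Ext^d(A, Aᵉ)` is isomorphic as a bimodule to `A^ν`, that is,
to `A` with the action `b · m · a = b * m * ν a`. -/
structure IsTwistedCalabiYau (ν : A ≃ₐ[k] A) (d : ℕ) : Prop where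
  smooth : HomologicallySmooth k A
  ext_eq_zero : ∀ i, i ≠ d → ∀ ξ : ExtEnv k A i, ξ = 0
  ext_top : ∃ e : ExtEnv k A d ≃+ A,
    ∀ (b : A) (ξ : ExtEnv k A d) (a : A), e (innerAct b ξ a) = b * e ξ * ν a

/-- `A` is Calabi-Yau of some dimension (in the sense of Ginzburg): it is homologically smooth and
`Ext^i(A, Aᵉ)` is `A` as a bimodule for `i = d` and `0` for `i ≠ d`. -/
def IsCalabiYau : Prop := ∃ d : ℕ, IsTwistedCalabiYau k (AlgEquiv.refl : A ≃ₐ[k] A) d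

end General

section Algebras

variable {k : Type u} [Field k]

/-- The free generator `x` of `k⟨x, y⟩`. -/
abbrev fx (k : Type u) [Field k] : FreeAlgebra k (Fin 2) := FreeAlgebra.ι k 0

/-- The free generator `y` of `k⟨x, y⟩`. -/
abbrev fy (k : Type u) [Field k] : FreeAlgebra k (Fin 2) := FreeAlgebra.ι k 1

/-- The element `x³y + p x²yx + q xyx² + s yx³`. -/
def cubicX (p q s : k) : FreeAlgebra k (Fin 2) :=
  let x := fx k; let y := fy k
  x ^ 3 * y + p • (x ^ 2 * y * x) + q • (x * y * x ^ 2) + s • (y * x ^ 3)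

/-- The element `xy³ + p yxy² + q y²xy + s y³x`. -/
def cubicY (p q s : k) : FreeAlgebra k (Fin 2) :=
  let x := fx k; let y := fy k
  x * y ^ 3 + p • (y * x * y ^ 2) + q • (y ^ 2 * x * y) + s • (y ^ 3 * x)

/-- The element `x²y² + l₂ xyxy + l₃ yxyx + l₄ y²x² + l₅ xy²x + l₅ yx²y`. -/
def mixed (l₂ l₃ l₄ l₅ : k) : FreeAlgebra k (Fin 2) :=
  let x := fx k; let y := fy k
  x ^ 2 * y ^ 2 + l₂ • (x * y * x * y) + l₃ • (y * x * y * x) + l₄ • (y ^ 2 * x ^ 2)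
    + l₅ • (x * y ^ 2 * x) + l₅ • (y * x ^ 2 * y)

/-- The defining relations of the algebra `D`. -/
inductive RelD (p q : k) : FreeAlgebra k (Fin 2) → FreeAlgebra k (Fin 2) → Prop
  | r₁ : RelD p q (cubicX p q (-(p * (2 * p ^ 2 + q)))) 0
  | r₂ : RelD p q (mixed 0 (-(p * (p ^ 2 + q))) (-q ^ 2) (q - p ^ 2)) 0
  | r₃ : RelD p q (cubicY p q (-(p * (2 * p ^ 2 + q)))) 0

/-- The defining relations of the algebra `G`. -/
inductive RelG (p q s g : k) : FreeAlgebra k (Fin 2) → FreeAlgebra k (Fin 2) → Prop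
  | r₁ : RelG p q s g (cubicX p q s) 0
  | r₂ : RelG p q s g
      (mixed (-(s ^ 2 * (q * s - g) / (g * (q * s + g))))
        (s - p * g * (p * s - q ^ 2) / (q * (q * s + g)))
        (-(g ^ 2 / s ^ 2))
        ((p * s ^ 2 + q * g) / (q * s + g))) 0
  | r₃ : RelG p q s g (cubicY p q s) 0

/-- The algebra `D = k⟨x, y⟩ / (r₁, r₂, r₃)`. -/
abbrev AlgD (p q : k) : Type u := RingQuot (RelD p q)

/-- The algebra `G = k⟨x, y⟩ / (r₁, r₂, r₃)`. -/
abbrev AlgG (p q s g : k) : Type u := RingQuot (RelG p q s g)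

/-- The image of the generator `x` in `D`. -/
def AlgD.x (p q : k) : AlgD p q := RingQuot.mkAlgHom k (RelD p q) (fx k)

/-- The image of the generator `y` in `D`. -/
def AlgD.y (p q : k) : AlgD p q := RingQuot.mkAlgHom k (RelD p q) (fy k)

/-- The image of the generator `x` in `G`. -/
def AlgG.x (p q s g : k) : AlgG p q s g := RingQuot.mkAlgHom k (RelG p q s g) (fx k)

/-- The image of the generator `y` in `G`. -/
def AlgG.y (p q s g : k) : AlgG p q s g := RingQuot.mkAlgHom k (RelG p q s g) (fy k)

end Algebras

end TwistedCY

end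

/-!
Put `t = q / p`, with `h = p² / q` for the algebra `D` and `h = g / t⁵` for the algebra `G`. In
terms of the skew commutators `a = xy - th yx`, `b = xa + t ax` and `c = ay + t ya` the two
algebras are the same kind of iterated Ore extension, `k[y][c; …][a; …][b; …][x; …]`. The torus
`kˣ × kˣ` acts by rescaling `x` and `y`, and the twist of each Ore extension is the action of an
element of this torus.

Suppose that a finite complex of finite free bimodules resolves `B`, and that its dual resolves
`B^ν`. For `A = B[x; σ, δ]`, the element `x ⊗ 1 - 1 ⊗ x` lifts to a map between two copies of the
complex induced to `A`, one of them twisted by `σ`: a diagonal matrix of elements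
`x ⊗ 1 - θ • 1 ⊗ x` corrected by a null homotopy over the enveloping algebra of `B`. The mapping
cone of the lift resolves `A`. For the dual to resolve a twist of `A`, the correction must not
involve the bottom and top generators. It can be chosen of the bidegree of `x`, which is not a
bidegree of `B`; so it vanishes there, where its entries would be elements of just this bidegree.
As `k` is infinite, the characters of the torus given by distinct bidegrees are linearly
independent. The Nakayama automorphism thereby changes by the inverse of the twist, and after five
steps it is `x ↦ t⁵h x`, `y ↦ (t⁵h)⁻¹ y`.

If `A` is also Calabi–Yau, then comparing the two descriptions of the top Ext group gives a
one-sided unit `w` with `ν(a) w = w a` for all `a`. Its image under the homomorphism onto `k[y]`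
that kills `x` is nonzero, hence `t⁵h = 1`.
-/

namespace TwistedCY

open scoped Matrix

section Exactness

variable {R R' : Type*} [Ring R] [Ring R'] {ι : Type*} [Fintype ι] [DecidableEq ι]

/-- The left ideal of those `s` for which the vector `s` in position `o` is a combination of the
rows of `D`. -/
def rowIdeal (D : Matrix ι ι R) (o : ι) : Submodule R R :=
  (LinearMap.range D.vecMulLinear).comap (LinearMap.single R (fun _ => R) o)

/-- The right ideal of those `s` for which the vector `s` in position `t` is a combination of the
columns of `D`; right ideals are encoded as submodules over the opposite ring. -/
def colIdeal (D : Matrix ι ι R) (t : ι) : Submodule Rᵐᵒᵖ R where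
  carrier := {s | ∃ u, D *ᵥ u = Pi.single t s}
  add_mem' := by
    rintro a b ⟨u, hu⟩ ⟨v, hv⟩
    exact ⟨u + v, by rw [Matrix.mulVec_add, hu, hv, Pi.single_add]⟩
  zero_mem' := ⟨0, by simp⟩
  smul_mem' := by
    rintro c a ⟨u, hu⟩
    exact ⟨c • u, by rw [Matrix.mulVec_smul, hu, ← Pi.single_smul]⟩

/-- Exactness of the complex of row vectors with differential `v ↦ v ᵥ* D`, except for homology
generated by the basis vector in position `o`. -/
def IsRowExactAt (D : Matrix ι ι R) (o : ι) : Prop :=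
  ∀ v, v ᵥ* D = 0 → ∃ u s, v = u ᵥ* D + Pi.single o s

/-- Exactness of the complex of column vectors with differential `v ↦ D *ᵥ v`, except for homology
generated by the basis vector in position `t`. -/
def IsColExactAt (D : Matrix ι ι R) (t : ι) : Prop :=
  ∀ v, D *ᵥ v = 0 → ∃ u s, v = D *ᵥ u + Pi.single t s

variable {D : Matrix ι ι R} {o t : ι} {s : R}

lemma mem_rowIdeal : s ∈ rowIdeal D o ↔ ∃ u, u ᵥ* D = Pi.single o s := Iff.rfl

lemma mem_colIdeal : s ∈ colIdeal D t ↔ ∃ u, D *ᵥ u = Pi.single t s := Iff.rfl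

lemma map_mem_rowIdeal (F : R →+* R') (hs : s ∈ rowIdeal D o) : F s ∈ rowIdeal (D.map F) o := by
  obtain ⟨u, hu⟩ := mem_rowIdeal.1 hs
  refine mem_rowIdeal.2 ⟨F ∘ u, funext fun c => ?_⟩
  rw [← F.map_vecMul, hu]
  exact Pi.apply_single (fun _ => F) (fun _ => map_zero F) o s c

lemma map_mem_colIdeal (F : R →+* R') (hs : s ∈ colIdeal D t) : F s ∈ colIdeal (D.map F) t := by
  obtain ⟨u, hu⟩ := mem_colIdeal.1 hs
  refine mem_colIdeal.2 ⟨F ∘ u, funext fun r => ?_⟩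
  rw [← F.map_mulVec, hu]
  exact Pi.apply_single (fun _ => F) (fun _ => map_zero F) t s r

lemma isRowExactAt_transpose_op :
    IsRowExactAt (Dᵀ.map op) t ↔ IsColExactAt D t := by
  have vecMul_eq (v : ι → R) : (op ∘ v) ᵥ* Dᵀ.map op = op ∘ (D *ᵥ v) := by
    ext r
    simp [Matrix.vecMul, Matrix.mulVec, dotProduct]
  have op_comp_single (s : R) : op ∘ (Pi.single t s : ι → R) = Pi.single t (op s) :=
    funext (Pi.apply_single (fun _ => (op : R → Rᵐᵒᵖ)) (fun _ => op_zero) t s)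
  constructor
  · intro h v hv
    obtain ⟨u, s, hus⟩ := h (op ∘ v) (by rw [vecMul_eq, hv]; rfl)
    refine ⟨unop ∘ u, unop s, op_injective.comp_left ?_⟩
    refine hus.trans ?_
    change _ = op ∘ (D *ᵥ (unop ∘ u)) + op ∘ Pi.single t (unop s)
    rw [← vecMul_eq, op_comp_single]
    rfl
  · intro h v hv
    obtain ⟨u, s, hus⟩ := h (unop ∘ v) (op_injective.comp_left ((vecMul_eq _).symm.trans hv))
    refine ⟨op ∘ u, op s, ?_⟩
    rw [vecMul_eq, ← op_comp_single]
    exact congrArg (op ∘ ·) hus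

end Exactness

section GradedMatrix

variable {R : Type u} [Ring R] {ι : Type}

/-- The generators of homological degree `n`. -/
abbrev Level (deg : ι → ℕ) (n : ℕ) : Type := {r : ι // deg r = n}

/-- Extension by zero of a vector supported in one homological degree. -/
noncomputable def extendByZero {deg : ι → ℕ} {n : ℕ} (v : Level deg n → R) : ι → R :=
  Function.extend Subtype.val v 0

/-- The differential from degree `n + 1` to degree `n` of a complex with total differential `D`. -/
def block (deg : ι → ℕ) (D : Matrix ι ι R) (n : ℕ) :
    Matrix (Level deg (n + 1)) (Level deg n) R :=
  D.submatrix Subtype.val Subtype.val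

/-- `D` is the total differential of a complex of finite free modules, with one generator in degree
`deg r` for each index `r`. The rows of `D` are the differentials of the generators. -/
structure IsDifferential [Fintype ι] (deg : ι → ℕ) (D : Matrix ι ι R) : Prop where
  degree_eq : ∀ r c, D r c ≠ 0 → deg r = deg c + 1
  mul_self : D * D = 0

variable {deg : ι → ℕ} {n : ℕ} {D : Matrix ι ι R}

@[simp] lemma extendByZero_coe (v : Level deg n → R) (r : Level deg n) :
    extendByZero v r = v r :=
  Subtype.val_injective.extend_apply v 0 r

lemma extendByZero_of_ne (v : Level deg n → R) {r : ι} (hr : deg r ≠ n) :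
    extendByZero v r = 0 :=
  Function.extend_apply' v (0 : ι → R) r fun ⟨r', h⟩ => hr (h ▸ r'.2)

@[simp] lemma extendByZero_zero : extendByZero (0 : Level deg n → R) = 0 :=
  Function.extend_const (Subtype.val : Level deg n → ι) (0 : R)

lemma extendByZero_eq_single [DecidableEq ι] {o : ι} (ho : ∀ r, deg r = n ↔ r = o)
    (v : Level deg n → R) : extendByZero v = Pi.single o (v ⟨o, (ho o).2 rfl⟩) := by
  funext r
  by_cases hr : r = o
  · subst hr
    rw [Pi.single_eq_same]
    exact extendByZero_coe v ⟨r, _⟩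
  · rw [Pi.single_eq_of_ne hr, extendByZero_of_ne _ fun h => hr ((ho r).1 h)]

lemma sum_eq_sum_subtype_of_ne_zero [Fintype ι] {M : Type*} [AddCommMonoid M] {p : ι → Prop}
    [DecidablePred p] (f : ι → M) (hf : ∀ r, f r ≠ 0 → p r) :
    ∑ r, f r = ∑ r : {r // p r}, f r := by
  rw [← Finset.sum_subtype (Finset.univ.filter p) (by simp) f,
    Finset.sum_filter_of_ne fun r _ => hf r]

namespace IsDifferential

variable [Fintype ι] (hD : IsDifferential deg D)
include hD

lemma vecMul_apply_level (u : ι → R) (c : Level deg n) :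
    (u ᵥ* D) c = ((fun r : Level deg (n + 1) => u r) ᵥ* block deg D n) c :=
  sum_eq_sum_subtype_of_ne_zero (fun r => u r * D r c) fun r hr => by
    rw [hD.degree_eq r c (right_ne_zero_of_mul hr), c.2]

lemma mulVec_apply_level (u : ι → R) (r : Level deg (n + 1)) :
    (D *ᵥ u) r = (block deg D n *ᵥ fun c : Level deg n => u c) r :=
  sum_eq_sum_subtype_of_ne_zero (fun c => D r c * u c) fun c hc => by
    have := hD.degree_eq r c (left_ne_zero_of_mul hc)
    have := r.2
    omega

lemma mulVec_apply_of_degree_eq_zero (u : ι → R) {r : ι} (hr : deg r = 0) : (D *ᵥ u) r = 0 :=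
  Finset.sum_eq_zero fun c _ => by
    by_contra hc
    have := hD.degree_eq r c (left_ne_zero_of_mul hc)
    omega

lemma extendByZero_vecMul (v : Level deg (n + 1) → R) :
    extendByZero v ᵥ* D = extendByZero (v ᵥ* block deg D n) := by
  funext c
  by_cases hc : deg c = n
  · refine (hD.vecMul_apply_level (extendByZero v) ⟨c, hc⟩).trans ?_
    simpa only [extendByZero_coe] using (extendByZero_coe (v ᵥ* block deg D n) ⟨c, hc⟩).symm
  · rw [extendByZero_of_ne _ hc]
    refine Finset.sum_eq_zero fun r _ => ?_
    by_contra h0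
    have := hD.degree_eq r c (right_ne_zero_of_mul h0)
    exact left_ne_zero_of_mul h0 (extendByZero_of_ne v (by omega))

lemma mulVec_extendByZero (v : Level deg n → R) :
    D *ᵥ extendByZero v = extendByZero (block deg D n *ᵥ v) := by
  funext r
  by_cases hr : deg r = n + 1
  · refine (hD.mulVec_apply_level (extendByZero v) ⟨r, hr⟩).trans ?_
    simpa only [extendByZero_coe] using (extendByZero_coe (block deg D n *ᵥ v) ⟨r, hr⟩).symm
  · rw [extendByZero_of_ne _ hr]
    refine Finset.sum_eq_zero fun c _ => ?_
    by_contra h0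
    have := hD.degree_eq r c (left_ne_zero_of_mul h0)
    exact right_ne_zero_of_mul h0 (extendByZero_of_ne v (by omega))

lemma block_mul_block (n : ℕ) : block deg D (n + 1) * block deg D n = 0 := by
  ext r c
  have entry_eq_zero : (D * D) r c = 0 := by rw [hD.mul_self]; rfl
  rwa [Matrix.mul_apply, sum_eq_sum_subtype_of_ne_zero (p := fun j => deg j = n + 1)]
    at entry_eq_zero
  intro j hj
  rw [hD.degree_eq j c (right_ne_zero_of_mul hj), c.2]

/-- The complex of finite free left modules with total differential `D`. -/
noncomputable abbrev chainComplex : ChainComplex (ModuleCat.{u} R) ℕ :=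
  ChainComplex.of (fun n => ModuleCat.of R (Level deg n → R))
    (fun n => ModuleCat.ofHom (Matrix.vecMulLinear (block deg D n)))
    (fun n => by
      ext v : 2
      simp [Matrix.vecMul_vecMul, hD.block_mul_block])

lemma chainComplex_d_apply (n : ℕ) (v : Level deg (n + 1) → R) :
    (hD.chainComplex.d (n + 1) n).hom v = v ᵥ* block deg D n := by
  simp [chainComplex]

lemma mul_apply_congr {M M' : Matrix ι ι R} {n : ℕ} (hM : ∀ r, deg r < n → M r = M' r) {r : ι}
    (hr : deg r ≤ n) : (D * M) r = (D * M') r := by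
  ext c
  rw [Matrix.mul_apply, Matrix.mul_apply]
  refine Finset.sum_congr rfl fun j _ => ?_
  by_cases hrj : D r j = 0
  · simp [hrj]
  · rw [hM j (by have := hD.degree_eq r j hrj; omega)]

end IsDifferential

end GradedMatrix

section DualityComplex

variable {R : Type u} [Ring R] {ι : Type} [Fintype ι] [DecidableEq ι]

/-- A finite complex of finite free left modules with one generator `o` in degree `0` and one
generator `t` in the top degree `d`, such that both the complex and its dual have homology only at
their ends. -/
structure IsDualityComplex (d : ℕ) (deg : ι → ℕ) (o t : ι) (D : Matrix ι ι R) : Prop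
    extends IsDifferential deg D where
  degree_eq_zero_iff : ∀ r, deg r = 0 ↔ r = o
  degree_le : ∀ r, deg r ≤ d
  degree_eq_top_iff : ∀ r, deg r = d ↔ r = t
  rowExact : IsRowExactAt D o
  colExact : IsColExactAt D t

namespace IsDualityComplex

variable {d : ℕ} {deg : ι → ℕ} {o t : ι} {D : Matrix ι ι R}

section

variable (H : IsDualityComplex d deg o t D)
include H

lemma degree_bot : deg o = 0 := (H.degree_eq_zero_iff o).2 rfl

lemma degree_top : deg t = d := (H.degree_eq_top_iff t).2 rfl

lemma isEmpty_level {n : ℕ} (hn : d < n) : IsEmpty (Level deg n) :=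
  ⟨fun r => (H.degree_le r).not_gt (r.2.symm ▸ hn)⟩

lemma exists_vecMul_block_eq {n : ℕ} {v : Level deg (n + 1) → R} (hv : v ᵥ* block deg D n = 0) :
    ∃ u, u ᵥ* block deg D (n + 1) = v := by
  obtain ⟨u, s, hus⟩ := H.rowExact (extendByZero v) (by
    rw [H.extendByZero_vecMul, hv, extendByZero_zero])
  refine ⟨fun r => u r, funext fun c => ?_⟩
  have hc : (c : ι) ≠ o := fun h => by simpa [h, H.degree_bot] using c.2
  simpa [← H.vecMul_apply_level, hc] using (congrFun hus c).symm

lemma exists_vecMul_block_zero_eq_iff {v : Level deg 0 → R} :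
    (∃ u, u ᵥ* block deg D 0 = v) ↔ v ⟨o, H.degree_bot⟩ ∈ rowIdeal D o := by
  rw [mem_rowIdeal, ← extendByZero_eq_single H.degree_eq_zero_iff v]
  constructor
  · rintro ⟨u, rfl⟩
    exact ⟨extendByZero u, H.extendByZero_vecMul u⟩
  · rintro ⟨u, hu⟩
    refine ⟨fun r => u r, funext fun c => ?_⟩
    rw [← H.vecMul_apply_level, hu, extendByZero_coe]

lemma exists_block_mulVec_eq_iff {n : ℕ} {s : R} {v : Level deg (n + 1) → R}
    (hd : d = n + 1) (hv : v = fun _ => s) :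
    (∃ u, block deg D n *ᵥ u = v) ↔ s ∈ colIdeal D t := by
  subst hd hv
  rw [mem_colIdeal, ← extendByZero_eq_single (n := n + 1) H.degree_eq_top_iff fun _ => s]
  constructor
  · rintro ⟨u, hu⟩
    exact ⟨extendByZero u, by rw [H.mulVec_extendByZero, hu]⟩
  · rintro ⟨u, hu⟩
    refine ⟨fun r => u r, funext fun c => ?_⟩
    rw [← H.mulVec_apply_level, hu, extendByZero_coe]

lemma eq_mulVec_of_block_mulVec_eq_zero {n : ℕ} (hn : n ≠ d) {φ : Level deg n → R}
    (hφ : block deg D n *ᵥ φ = 0) : ∃ u : ι → R, ∀ r : Level deg n, φ r = (D *ᵥ u) r := by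
  obtain ⟨u, s, hus⟩ := H.colExact (extendByZero φ) (by
    rw [H.mulVec_extendByZero, hφ, extendByZero_zero])
  refine ⟨u, fun r => ?_⟩
  have hr : (r : ι) ≠ t := fun h => hn (by rw [← r.2, h, H.degree_top])
  simpa [hr] using congrFun hus r

lemma apply_mem_rowIdeal (r : ι) : D r o ∈ rowIdeal D o := by
  by_cases hr : D r o = 0
  · simp [hr]
  refine mem_rowIdeal.2 ⟨Pi.single r 1, funext fun c => ?_⟩
  rw [Matrix.single_one_vecMul, Matrix.row_apply]
  rcases eq_or_ne c o with rfl | hc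
  · simp
  · rw [Pi.single_eq_of_ne hc]
    by_contra hrc
    have deg_r := H.degree_eq r o hr
    have deg_r' := H.degree_eq r c hrc
    exact hc ((H.degree_eq_zero_iff c).1 (by rw [H.degree_bot] at deg_r; omega))

lemma apply_mem_colIdeal (c : ι) : D t c ∈ colIdeal D t := by
  by_cases hc : D t c = 0
  · simp [hc]
  refine mem_colIdeal.2 ⟨Pi.single c 1, funext fun r => ?_⟩
  rw [Matrix.mulVec_single_one, Matrix.col_apply]
  rcases eq_or_ne r t with rfl | hr
  · simp
  · rw [Pi.single_eq_of_ne hr]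
    by_contra hrc
    have deg_t := H.degree_eq t c hc
    have deg_r := H.degree_eq r c hrc
    exact hr ((H.degree_eq_top_iff r).1 (by rw [H.degree_top] at deg_t; omega))

lemma row_bot : D.row o = 0 := funext fun c => by
  by_contra hoc
  simpa [H.degree_bot] using H.degree_eq o c hoc

lemma col_top : D.col t = 0 := funext fun r => by
  by_contra hrt
  have deg_r := H.degree_eq r t hrt
  have deg_le := H.degree_le r
  rw [H.degree_top] at deg_r
  omega

lemma exists_vecMul_eq {v : ι → R} (hv : v ᵥ* D = 0) (hvo : v o ∈ rowIdeal D o) :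
    ∃ u, u o = 0 ∧ u ᵥ* D = v := by
  obtain ⟨u, s, hus⟩ := H.rowExact v hv
  have hs : s ∈ rowIdeal D o := by
    have s_eq : s = v o - (u ᵥ* D) o := by simp [hus]
    exact s_eq ▸ Submodule.sub_mem _ hvo
      (Submodule.sum_mem _ fun r _ => Submodule.smul_mem _ (u r) (H.apply_mem_rowIdeal r))
  obtain ⟨u', hu'⟩ := mem_rowIdeal.1 hs
  refine ⟨u + u' - Pi.single o ((u + u') o), by simp, ?_⟩
  rw [Matrix.sub_vecMul, Matrix.add_vecMul, hu', ← hus, Matrix.single_vecMul, H.row_bot, smul_zero,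
    sub_zero]

/-- Up to sign `P` is a chain map, and it is null homotopic by exactness, degree by degree. -/
lemma exists_homotopy {N P : Matrix ι ι R} (hN : IsDifferential deg N) (hP : P * D + N * P = 0)
    (hPo : ∀ r, P r o ∈ rowIdeal D o) :
    ∃ γ : Matrix ι ι R, γ.col o = 0 ∧ γ * D = N * γ - P := by
  suffices exists_below : ∀ n, ∃ γ : Matrix ι ι R, γ.col o = 0 ∧
      ∀ r, deg r < n → γ r ᵥ* D = (N * γ - P) r by
    obtain ⟨γ, hγo, hγ⟩ := exists_below (d + 1)
    exact ⟨γ, hγo, Matrix.ext fun r c => congrFun (hγ r (Nat.lt_succ_of_le (H.degree_le r))) c⟩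
  intro n
  induction n with
  | zero => exact ⟨0, rfl, fun r hr => absurd hr (Nat.not_lt_zero _)⟩
  | succ n ih =>
    obtain ⟨γ, hγo, hγ⟩ := ih
    have row_vecMul {r : ι} (hr : deg r ≤ n) : (N * γ - P) r ᵥ* D = 0 := by
      have N_mul_γ_mul : (N * (γ * D)) r = (N * (N * γ - P)) r := hN.mul_apply_congr hγ hr
      calc (N * γ - P) r ᵥ* D = ((N * γ - P) * D) r := rfl
        _ = (N * (γ * D)) r - (P * D) r := by rw [sub_mul, mul_assoc]; rfl
        _ = (N * (N * γ - P) - P * D) r := by rw [N_mul_γ_mul]; rfl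
        _ = 0 := by
          rw [mul_sub, ← mul_assoc, hN.mul_self, zero_mul, zero_sub, ← neg_add', add_comm, hP,
            neg_zero]
          rfl
    have apply_bot_mem (r : ι) : (N * γ - P) r o ∈ rowIdeal D o := by
      have N_mul_γ_bot : (N * γ) r o = 0 :=
        Finset.sum_eq_zero fun j _ => mul_eq_zero_of_right _ (congrFun hγo j)
      rw [Matrix.sub_apply, N_mul_γ_bot, zero_sub]
      exact Submodule.neg_mem _ (hPo r)
    choose u hu_bot hu using fun r : {r // deg r ≤ n} =>
      H.exists_vecMul_eq (row_vecMul r.2) (apply_bot_mem r)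
    let γ' : Matrix ι ι R := Matrix.of fun r => if hr : deg r = n then u ⟨r, hr.le⟩ else γ r
    have γ'_of_ne {r : ι} (hr : deg r ≠ n) : γ' r = γ r := dif_neg hr
    have γ'_of_eq {r : ι} (hr : deg r = n) : γ' r = u ⟨r, hr.le⟩ := dif_pos hr
    refine ⟨γ', funext fun r => ?_, fun r hr => ?_⟩
    · by_cases hr : deg r = n
      exacts [(congrFun (γ'_of_eq hr) o).trans (hu_bot _),
        (congrFun (γ'_of_ne hr) o).trans (congrFun hγo r)]
    · have N_mul_γ' : (N * γ' - P) r = (N * γ - P) r := congrArg (· - P r)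
        (hN.mul_apply_congr (fun j hj => γ'_of_ne hj.ne) (Nat.lt_succ_iff.1 hr))
      rcases Nat.lt_succ_iff_lt_or_eq.1 hr with hr | hr
      exacts [by rw [N_mul_γ', γ'_of_ne hr.ne, hγ r hr], by rw [N_mul_γ', γ'_of_eq hr, hu]]

end

section Resolution

variable (H : IsDualityComplex d deg o t D) {M : ModuleCat.{u} R} {ε : R →ₗ[R] M}
  (hε : Function.Surjective ε) (hker : LinearMap.ker ε = rowIdeal D o)

/-- The augmentation of the complex of free modules, given on the generator in degree `0`
by `ε`. -/
noncomputable def augmentation (ε : R →ₗ[R] M) : ModuleCat.of R (Level deg 0 → R) ⟶ M :=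
  ModuleCat.ofHom (ε.comp (LinearMap.proj ⟨o, H.degree_bot⟩))

include hker in
lemma d_comp_augmentation : H.chainComplex.d 1 0 ≫ H.augmentation ε = 0 := by
  refine ModuleCat.hom_ext (LinearMap.ext fun v : Level deg 1 → R => ?_)
  refine (congrArg (H.augmentation ε).hom (H.chainComplex_d_apply 0 v)).trans ?_
  have mem_ker : (v ᵥ* block deg D 0) ⟨o, H.degree_bot⟩ ∈ LinearMap.ker ε :=
    hker ▸ H.exists_vecMul_block_zero_eq_iff.1 ⟨v, rfl⟩
  exact mem_ker

/-- The morphism of complexes from the free complex to `M` given by the augmentation. -/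
noncomputable def augmentationMap :
    H.chainComplex ⟶ (ChainComplex.single₀ (ModuleCat.{u} R)).obj M :=
  (ChainComplex.toSingle₀Equiv _ _).symm ⟨H.augmentation ε, H.d_comp_augmentation hker⟩

lemma augmentationMap_f_zero_apply (v : Level deg 0 → R) :
    ((H.augmentationMap hker).f 0).hom v = ε (v ⟨o, H.degree_bot⟩) :=
  congrArg (fun φ : H.chainComplex.X 0 ⟶ M => φ.hom v)
    (ChainComplex.toSingle₀Equiv_symm_apply_f_zero (C := H.chainComplex) (H.augmentation ε)
      (H.d_comp_augmentation hker))

include hε in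
lemma quasiIsoAt_zero_augmentationMap : QuasiIsoAt (H.augmentationMap hker) 0 := by
  rw [ChainComplex.quasiIsoAt₀_iff, ShortComplex.quasiIso_iff_of_zeros']
  · constructor
    · rw [ShortComplex.moduleCat_exact_iff]
      intro (v : Level deg 0 → R) hv
      have mem_ker : v ⟨o, H.degree_bot⟩ ∈ LinearMap.ker ε :=
        (H.augmentationMap_f_zero_apply hker v).symm.trans hv
      obtain ⟨u, hu⟩ := H.exists_vecMul_block_zero_eq_iff.2 (hker ▸ mem_ker)
      exact ⟨u, (H.chainComplex_d_apply 0 u).trans hu⟩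
    · rw [ModuleCat.epi_iff_surjective]
      intro m
      obtain ⟨s, rfl⟩ := hε m
      exact ⟨(fun _ => s : Level deg 0 → R), H.augmentationMap_f_zero_apply hker _⟩
  all_goals rfl

lemma quasiIsoAt_succ_augmentationMap (n : ℕ) : QuasiIsoAt (H.augmentationMap hker) (n + 1) := by
  rw [quasiIsoAt_iff_exactAt' _ _ (ChainComplex.exactAt_succ_single_obj _ _),
    HomologicalComplex.exactAt_iff' _ (n + 1 + 1) (n + 1) n (by simp) (by simp),
    ShortComplex.moduleCat_exact_iff]
  intro (v : Level deg (n + 1) → R) hv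
  obtain ⟨u, hu⟩ := H.exists_vecMul_block_eq ((H.chainComplex_d_apply n v).symm.trans hv)
  exact ⟨u, (H.chainComplex_d_apply (n + 1) u).trans hu⟩

/-- The finite free resolution of `M ≅ R / rowIdeal D o` with total differential `D`. -/
noncomputable def resolution : ProjectiveResolution M where
  complex := H.chainComplex
  projective n := by
    change Projective (ModuleCat.of R (Level deg n → R))
    rw [← IsProjective.iff_projective]
    infer_instance
  π := H.augmentationMap hker
  quasiIso := ⟨fun n => match n with
    | 0 => H.quasiIsoAt_zero_augmentationMap hε hker
    | n + 1 => H.quasiIsoAt_succ_augmentationMap hker n⟩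

lemma finite_resolution_X (n : ℕ) : Module.Finite R ((H.resolution hε hker).complex.X n) := by
  change Module.Finite R (Level deg n → R)
  infer_instance

lemma isZero_resolution_X {n : ℕ} (hn : d < n) :
    Limits.IsZero ((H.resolution hε hker).complex.X n) := by
  have := H.isEmpty_level hn
  change Limits.IsZero (ModuleCat.of R (Level deg n → R))
  exact ModuleCat.isZero_of_subsingleton _

/-- The identification of `R`-valued functions on the generators of degree `n` with morphisms from
the `n`-th term of the resolution to `R`. -/
noncomputable def toRegular (n : ℕ) :
    (Level deg n → R) ≃+ ((H.resolution hε hker).complex.X n ⟶ ModuleCat.of R R) :=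
  ((Pi.basisFun R (Level deg n)).constr ℕ).toAddEquiv.trans
    (ModuleCat.homAddEquiv (M := ModuleCat.of R (Level deg n → R)) (N := ModuleCat.of R R)).symm

lemma toRegular_apply (n : ℕ) (φ v : Level deg n → R) :
    (H.toRegular hε hker n φ).hom v = v ⬝ᵥ φ := by
  refine ((Pi.basisFun R (Level deg n)).constr_apply_fintype ℕ φ v).trans ?_
  simp [dotProduct]

lemma d_comp_toRegular (n : ℕ) (φ : Level deg n → R) :
    (H.resolution hε hker).complex.d (n + 1) n ≫ H.toRegular hε hker n φ =
      H.toRegular hε hker (n + 1) (block deg D n *ᵥ φ) := by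
  refine ModuleCat.hom_ext (LinearMap.ext fun v : Level deg (n + 1) → R => ?_)
  refine Eq.trans ?_ (H.toRegular_apply hε hker (n + 1) _ v).symm
  refine (congrArg (H.toRegular hε hker n φ).hom (H.chainComplex_d_apply n v)).trans ?_
  exact (H.toRegular_apply hε hker n φ _).trans (Matrix.dotProduct_mulVec v (block deg D n) φ).symm

lemma toRegular_comp_toSpanSingleton (n : ℕ) (φ : Level deg n → R) (w : R) :
    H.toRegular hε hker n φ ≫ ModuleCat.ofHom (LinearMap.toSpanSingleton R R w) =
      H.toRegular hε hker n fun r => φ r * w := by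
  refine ModuleCat.hom_ext (LinearMap.ext fun v : Level deg n → R => ?_)
  refine Eq.trans ?_ (H.toRegular_apply hε hker n _ v).symm
  refine (congrArg (LinearMap.toSpanSingleton R R w) (H.toRegular_apply hε hker n φ v)).trans ?_
  simp [dotProduct, mul_assoc]

end Resolution

section Ext

variable (H : IsDualityComplex d deg o t D) {M : ModuleCat.{u} R} {ε : R →ₗ[R] M}
  (hε : Function.Surjective ε) (hker : LinearMap.ker ε = rowIdeal D o)

include H hε hker in
theorem ext_eq_zero {i : ℕ} (hi : i ≠ d) (ξ : Abelian.Ext.{u} M (ModuleCat.of R R) i) :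
    ξ = 0 := by
  obtain ⟨f, hf, rfl⟩ := (H.resolution hε hker).extMk_surjective ξ (i + 1) rfl
  obtain ⟨φ, rfl⟩ := (H.toRegular hε hker i).surjective f
  rw [d_comp_toRegular, EmbeddingLike.map_eq_zero_iff] at hf
  obtain ⟨u, hu⟩ := H.eq_mulVec_of_block_mulVec_eq_zero hi hf
  cases i with
  | zero =>
    have φ_eq_zero : φ = 0 :=
      funext fun r => (hu r).trans (H.mulVec_apply_of_degree_eq_zero u r.2)
    simp [φ_eq_zero]
  | succ p =>
    rw [(H.resolution hε hker).extMk_eq_zero_iff _ _ _ _ p rfl]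
    refine ⟨H.toRegular hε hker p fun r => u r, ?_⟩
    rw [d_comp_toRegular]
    congr 1
    funext r
    rw [hu r, H.mulVec_apply_level]

lemma d_comp_toRegular_top (s : R) :
    (H.resolution hε hker).complex.d (d + 1) d ≫ H.toRegular hε hker d (fun _ => s) = 0 := by
  have := H.isEmpty_level d.lt_succ_self
  rw [d_comp_toRegular, EmbeddingLike.map_eq_zero_iff]
  exact Subsingleton.elim _ _

/-- The class in the top `Ext` group of the cocycle sending the top generator to a ring element. -/
noncomputable def topClass : R →+ Abelian.Ext.{u} M (ModuleCat.of R R) d where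
  toFun s := (H.resolution hε hker).extMk (H.toRegular hε hker d fun _ => s) (d + 1) rfl
    (H.d_comp_toRegular_top hε hker s)
  map_zero' := by
    simp only [← Pi.zero_def, map_zero, ProjectiveResolution.extMk_zero]
  map_add' x y := by
    rw [ProjectiveResolution.add_extMk]
    congr 1
    exact (H.toRegular hε hker d).map_add (fun _ => x) (fun _ => y)

lemma topClass_surjective : Function.Surjective (H.topClass hε hker) := fun ξ => by
  obtain ⟨f, hf, rfl⟩ := (H.resolution hε hker).extMk_surjective ξ (d + 1) rfl
  obtain ⟨φ, rfl⟩ := (H.toRegular hε hker d).surjective f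
  have φ_const : (fun _ => φ ⟨t, H.degree_top⟩) = φ :=
    funext fun r => congrArg φ (Subtype.ext ((H.degree_eq_top_iff r).1 r.2).symm)
  refine ⟨φ ⟨t, H.degree_top⟩, ?_⟩
  simp only [topClass, AddMonoidHom.coe_mk, ZeroHom.coe_mk]
  congr 2

lemma topClass_eq_zero_iff (hd : d ≠ 0) (s : R) :
    H.topClass hε hker s = 0 ↔ s ∈ colIdeal D t := by
  obtain ⟨p, rfl⟩ := Nat.exists_eq_succ_of_ne_zero hd
  rw [← H.exists_block_mulVec_eq_iff rfl rfl]
  refine ((H.resolution hε hker).extMk_eq_zero_iff _ (p + 1 + 1) rfl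
    (H.d_comp_toRegular_top hε hker s) p rfl).trans
    ((H.toRegular hε hker p).surjective.exists.trans (exists_congr fun φ => ?_))
  rw [d_comp_toRegular, EmbeddingLike.apply_eq_iff_eq]

lemma topClass_comp_toSpanSingleton (s w : R) :
    (H.topClass hε hker s).comp
        (Abelian.Ext.mk₀ (ModuleCat.ofHom (LinearMap.toSpanSingleton R R w))) (add_zero d) =
      H.topClass hε hker (s * w) := by
  refine ((H.resolution hε hker).extMk_comp_mk₀ _ (d + 1) rfl
    (H.d_comp_toRegular_top hε hker s) _).trans ?_
  simp only [topClass, AddMonoidHom.coe_mk, ZeroHom.coe_mk]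
  congr 1
  exact H.toRegular_comp_toSpanSingleton hε hker d _ _

end Ext

end IsDualityComplex

end DualityComplex

section Bimodules

variable {k : Type v} {A : Type u} [CommRing k] [Ring A] [Algebra k A]

variable (k A) in
/-- The augmentation `a ⊗ b ↦ a * b` of the enveloping algebra, whose kernel is the left annihilator
of `1` in the bimodule `A`. -/
noncomputable def leftEval : Env k A →ₗ[k] A :=
  TensorProduct.lift (LinearMap.mk₂ k (fun a b => a * unop b)
    (by intros; simp [add_mul]) (by intros; simp) (by intros; simp [mul_add]) (by intros; simp))

/-- The map `a ⊗ b ↦ b * ν a` from the enveloping algebra with its inner bimodule structure onto the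
twisted bimodule `A^ν`. -/
noncomputable def rightEval (ν : A →ₐ[k] A) : Env k A →ₗ[k] A :=
  TensorProduct.lift (LinearMap.mk₂ k (fun a b => unop b * ν a)
    (by intros; simp [mul_add]) (by intros; simp) (by intros; simp [add_mul]) (by intros; simp))

@[simp] lemma leftEval_tmul (a : A) (b : Aᵐᵒᵖ) : leftEval k A (a ⊗ₜ b) = a * unop b := by
  simp [leftEval]

@[simp] lemma rightEval_tmul (ν : A →ₐ[k] A) (a : A) (b : Aᵐᵒᵖ) :
    rightEval ν (a ⊗ₜ b) = unop b * ν a := by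
  simp [rightEval]

lemma tmul_mul_leftEval (a b : A) (s : Env k A) :
    leftEval k A (a ⊗ₜ op b * s) = a * leftEval k A s * b := by
  induction s using TensorProduct.induction_on with
  | zero => simp
  | tmul m n => simp [mul_assoc]
  | add x y hx hy => simp [add_mul, mul_add, hx, hy]

lemma rightEval_mul_tmul (ν : A →ₐ[k] A) (s : Env k A) (a b : A) :
    rightEval ν (s * (a ⊗ₜ op b)) = b * rightEval ν s * ν a := by
  induction s using TensorProduct.induction_on with
  | zero => simp
  | tmul m n => simp [mul_assoc]
  | add x y hx hy => simp [add_mul, mul_add, hx, hy]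

lemma leftEval_surjective : Function.Surjective (leftEval k A) := fun a => ⟨a ⊗ₜ 1, by simp⟩

lemma rightEval_surjective (ν : A →ₐ[k] A) : Function.Surjective (rightEval ν) :=
  fun a => ⟨1 ⊗ₜ op a, by simp⟩

variable (k A) in
/-- The multiplication map of the enveloping algebra onto `A`, as a map of bimodules. -/
noncomputable def diagonalProj : regular k A ⟶ diagonal k A :=
  letI : Module (Env k A) A := instModuleTensorProductMop k A
  ModuleCat.ofHom (Y := A) (LinearMap.toSpanSingleton (Env k A) A 1)

lemma diagonalProj_apply (s : Env k A) : (diagonalProj k A).hom s = leftEval k A s := by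
  induction s using TensorProduct.induction_on with
  | zero => exact (map_zero (diagonalProj k A).hom).trans (map_zero (leftEval k A)).symm
  | tmul a b =>
    refine (diagonal_smul k A a (unop b) 1).trans ?_
    simp
  | add x y hx hy => exact (map_add (diagonalProj k A).hom x y).trans (by rw [hx, hy, map_add])

/-- A finite complex of finite free bimodules resolving `A` whose dual resolves `A^ν`, given by its
total differential `D`, a matrix over the enveloping algebra. -/
structure IsCalabiYauComplex {ι : Type} [Fintype ι] [DecidableEq ι] (ν : A →ₐ[k] A) (d : ℕ)
    (deg : ι → ℕ) (o t : ι) (D : Matrix ι ι (Env k A)) : Prop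
    extends IsDualityComplex d deg o t D where
  mem_rowIdeal_iff : ∀ s, s ∈ rowIdeal D o ↔ leftEval k A s = 0
  mem_colIdeal_iff : ∀ s, s ∈ colIdeal D t ↔ rightEval ν s = 0

namespace IsCalabiYauComplex

variable {ι : Type} [Fintype ι] [DecidableEq ι] {ν : A →ₐ[k] A} {d : ℕ} {deg : ι → ℕ} {o t : ι}
  {D : Matrix ι ι (Env k A)}

lemma diagonalProj_surjective : Function.Surjective (diagonalProj k A).hom := fun a => by
  obtain ⟨s, hs⟩ := leftEval_surjective (k := k) (A := A) a
  exact ⟨s, (diagonalProj_apply s).trans hs⟩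

attribute [local instance] instModuleTensorProductMop in
lemma ker_diagonalProj (H : IsCalabiYauComplex ν d deg o t D) :
    LinearMap.ker (diagonalProj k A).hom = rowIdeal D o := by
  ext s
  rw [H.mem_rowIdeal_iff, ← diagonalProj_apply]
  rfl

lemma homologicallySmooth (H : IsCalabiYauComplex ν d deg o t D) : HomologicallySmooth k A :=
  ⟨H.resolution diagonalProj_surjective H.ker_diagonalProj,
    H.finite_resolution_X _ _, d, fun _ => H.isZero_resolution_X _ _⟩

theorem isTwistedCalabiYau {ν : A ≃ₐ[k] A} (H : IsCalabiYauComplex (ν : A →ₐ[k] A) d deg o t D)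
    (hd : d ≠ 0) : IsTwistedCalabiYau k ν d where
  smooth := H.homologicallySmooth
  ext_eq_zero _ hi := H.toIsDualityComplex.ext_eq_zero diagonalProj_surjective H.ker_diagonalProj hi
  ext_top := by
    let cls : Env k A →+ ExtEnv k A d := H.topClass diagonalProj_surjective H.ker_diagonalProj
    have cls_surjective : Function.Surjective cls := H.topClass_surjective _ _
    let η : Env k A →+ A := (rightEval (ν : A →ₐ[k] A)).toAddMonoidHom
    have ker_cls : cls.ker = η.ker := by
      ext s
      exact (H.topClass_eq_zero_iff _ _ hd s).trans (H.mem_colIdeal_iff s)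
    let e := (QuotientAddGroup.quotientKerEquivOfSurjective cls cls_surjective).symm.trans
      ((QuotientAddGroup.quotientAddEquivOfEq ker_cls).trans
        (QuotientAddGroup.quotientKerEquivOfSurjective η (rightEval_surjective _)))
    have e_cls (s : Env k A) : e (cls s) = rightEval (ν : A →ₐ[k] A) s := by
      have symm_cls : (QuotientAddGroup.quotientKerEquivOfSurjective cls cls_surjective).symm
          (cls s) = QuotientAddGroup.mk s := by
        rw [AddEquiv.symm_apply_eq]; rfl
      simp only [e, AddEquiv.trans_apply, symm_cls]
      rfl
    refine ⟨e, fun b ξ a => ?_⟩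
    obtain ⟨s, rfl⟩ := cls_surjective ξ
    have innerAct_cls : innerAct b (cls s) a = cls (s * (a ⊗ₜ op b)) :=
      H.topClass_comp_toSpanSingleton _ _ s _
    rw [innerAct_cls, e_cls, e_cls, rightEval_mul_tmul]
    rfl

end IsCalabiYauComplex

end Bimodules

section FreeBaseChange

variable {R S I : Type*} [Ring R] [Ring S]

/-- The map `p ↦ ∑ i, e i * F (p i)`. -/
noncomputable def rightComb (F : R →+* S) (e : I → S) : (I →₀ R) →+ S :=
  Finsupp.liftAddHom fun i => (AddMonoidHom.mulLeft (e i)).comp F.toAddMonoidHom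

/-- The map `p ↦ ∑ i, F (p i) * e i`. -/
noncomputable def leftComb (F : R →+* S) (e : I → S) : (I →₀ R) →+ S :=
  Finsupp.liftAddHom fun i => (AddMonoidHom.mulRight (e i)).comp F.toAddMonoidHom

/-- `S` is a free right module over `R` along `F` with basis `e`. -/
def RightFree (F : R →+* S) (e : I → S) : Prop := Function.Bijective (rightComb F e)

/-- `S` is a free left module over `R` along `F` with basis `e`. -/
def LeftFree (F : R →+* S) (e : I → S) : Prop := Function.Bijective (leftComb F e)

variable {F : R →+* S} {e : I → S}

lemma rightComb_apply (p : I →₀ R) : rightComb F e p = p.sum fun i r => e i * F r := rfl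

lemma leftComb_apply (p : I →₀ R) : leftComb F e p = p.sum fun i r => F r * e i := rfl

@[simp] lemma rightComb_single (i : I) (r : R) :
    rightComb F e (Finsupp.single i r) = e i * F r := by
  simp [rightComb_apply]

@[simp] lemma leftComb_single (i : I) (r : R) :
    leftComb F e (Finsupp.single i r) = F r * e i := by
  simp [leftComb_apply]

lemma RightFree.comp (hF : RightFree F e) (τ : R ≃+* R) :
    RightFree (F.comp (τ : R →+* R)) e := by
  let E : (I →₀ R) ≃+ (I →₀ R) := Finsupp.mapRange.addEquiv τ.toAddEquiv
  have comb_eq : rightComb (F.comp (τ : R →+* R)) e = (rightComb F e).comp E.toAddMonoidHom :=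
    Finsupp.addHom_ext fun i r => by simp [E]
  rw [RightFree, comb_eq]
  exact (show Function.Bijective (rightComb F e) from hF).comp E.bijective

lemma LeftFree.opposite (hF : LeftFree F e) : RightFree (RingHom.op F) (op ∘ e) := by
  let E : (I →₀ Rᵐᵒᵖ) ≃+ (I →₀ R) := Finsupp.mapRange.addEquiv opAddEquiv.symm
  have comb_eq : rightComb (RingHom.op F) (op ∘ e) =
      opAddEquiv.toAddMonoidHom.comp ((leftComb F e).comp E.toAddMonoidHom) :=
    Finsupp.addHom_ext fun i r => by simp [E]
  rw [RightFree, comb_eq]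
  exact opAddEquiv.bijective.comp
    ((show Function.Bijective (leftComb F e) from hF).comp E.bijective)

lemma LeftFree.comp (hF : LeftFree F e) (τ : R ≃+* R) :
    LeftFree (F.comp (τ : R →+* R)) e := by
  let E : (I →₀ R) ≃+ (I →₀ R) := Finsupp.mapRange.addEquiv τ.toAddEquiv
  have comb_eq : leftComb (F.comp (τ : R →+* R)) e = (leftComb F e).comp E.toAddMonoidHom :=
    Finsupp.addHom_ext fun i r => by simp [E]
  rw [LeftFree, comb_eq]
  exact (show Function.Bijective (leftComb F e) from hF).comp E.bijective

lemma RightFree.opposite (hF : RightFree F e) : LeftFree (RingHom.op F) (op ∘ e) := by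
  let E : (I →₀ Rᵐᵒᵖ) ≃+ (I →₀ R) := Finsupp.mapRange.addEquiv opAddEquiv.symm
  have comb_eq : leftComb (RingHom.op F) (op ∘ e) =
      opAddEquiv.toAddMonoidHom.comp ((rightComb F e).comp E.toAddMonoidHom) :=
    Finsupp.addHom_ext fun i r => by simp [E]
  rw [LeftFree, comb_eq]
  exact opAddEquiv.bijective.comp
    ((show Function.Bijective (rightComb F e) from hF).comp E.bijective)

lemma RightFree.eq_zero_of_sum_eq_zero (hF : RightFree F e) {T : Finset I} {a : I → R}
    (h : ∑ i ∈ T, e i * F (a i) = 0) {i : I} (hi : i ∈ T) : a i = 0 := by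
  have indicator_eq_zero : Finsupp.indicator T (fun i _ => a i) = 0 := by
    refine (injective_iff_map_eq_zero (rightComb F e)).1 hF.1 _ ?_
    rw [rightComb_apply, Finsupp.sum_indicator_index _ (by simp), h]
  rw [← Finsupp.indicator_of_mem hi (fun i _ => a i), indicator_eq_zero, Finsupp.zero_apply]

lemma RightFree.exists_eq_sum {ι : Type*} [Finite ι] (hF : RightFree F e) (v : ι → S) :
    ∃ (T : Finset I) (w : I → ι → R), v = ∑ i ∈ T, e i • (F ∘ w i) := by
  classical
  have := Fintype.ofFinite ι
  choose p hp using fun r => hF.2 (v r)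
  refine ⟨Finset.univ.biUnion fun r => (p r).support, fun i r => p r i, funext fun r => ?_⟩
  rw [← hp r, rightComb_apply, Finset.sum_apply]
  exact Finsupp.sum_of_support_subset _
    (fun i hi => Finset.mem_biUnion.2 ⟨r, Finset.mem_univ r, hi⟩) _ (by simp)

variable {ι : Type*} [Fintype ι] [DecidableEq ι] {D : Matrix ι ι R} {o t : ι}

lemma RightFree.isRowExactAt_map (hF : RightFree F e) (hD : IsRowExactAt D o) :
    IsRowExactAt (D.map F) o := by
  intro v hv
  obtain ⟨T, w, rfl⟩ := hF.exists_eq_sum v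
  have smul_comp_vecMul (i : I) (w : ι → R) :
      (e i • (F ∘ w)) ᵥ* D.map F = e i • (F ∘ (w ᵥ* D)) := by
    rw [Matrix.smul_vecMul]
    exact congrArg (e i • ·) (funext fun c => (F.map_vecMul D w c).symm)
  have smul_comp_single (i : I) (s : R) :
      e i • (F ∘ (Pi.single o s : ι → R)) = Pi.single o (e i * F s) := by
    funext c
    exact Pi.apply_single (fun _ x => e i * F x) (by simp) o s c
  have vecMul_eq_zero (i : I) (hi : i ∈ T) : w i ᵥ* D = 0 := by
    funext c
    refine hF.eq_zero_of_sum_eq_zero (a := fun i => (w i ᵥ* D) c) ?_ hi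
    simpa [Matrix.sum_vecMul, smul_comp_vecMul] using congrFun hv c
  choose! u s hus using fun i hi => hD (w i) (vecMul_eq_zero i hi)
  refine ⟨∑ i ∈ T, e i • (F ∘ u i), ∑ i ∈ T, e i * F (s i), ?_⟩
  have single_sum := map_sum (AddMonoidHom.single (fun _ : ι => S) o) (fun i => e i * F (s i)) T
  simp only [AddMonoidHom.single_apply] at single_sum
  rw [Matrix.sum_vecMul, single_sum, ← Finset.sum_add_distrib]
  refine Finset.sum_congr rfl fun i hi => ?_
  rw [smul_comp_vecMul, ← smul_comp_single, ← smul_add, hus i hi]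
  congr 1
  funext c
  simp

lemma LeftFree.isColExactAt_map (hF : LeftFree F e) (hD : IsColExactAt D t) :
    IsColExactAt (D.map F) t :=
  isRowExactAt_transpose_op.1 (hF.opposite.isRowExactAt_map (isRowExactAt_transpose_op.2 hD))

end FreeBaseChange

section FreeTensor

variable {k : Type*} [CommRing k] {A B A' B' : Type*} [Ring A] [Ring B] [Ring A'] [Ring B']
  [Algebra k A] [Algebra k B] [Algebra k A'] [Algebra k B'] {I I' : Type*}
  {f : B →ₐ[k] A} {e : I → A} {f' : B' →ₐ[k] A'} {e' : I' → A'}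

/-- `rightComb` as a linear map. -/
noncomputable def rightCombₗ (f : B →ₐ[k] A) (e : I → A) : (I →₀ B) →ₗ[k] A where
  __ := rightComb (f : B →+* A) e
  map_smul' c p := by
    simp [rightComb_apply, Finsupp.sum_smul_index', Finsupp.smul_sum]

/-- `leftComb` as a linear map. -/
noncomputable def leftCombₗ (f : B →ₐ[k] A) (e : I → A) : (I →₀ B) →ₗ[k] A where
  __ := leftComb (f : B →+* A) e
  map_smul' c p := by
    simp [leftComb_apply, Finsupp.sum_smul_index', Finsupp.smul_sum]

@[simp] lemma rightCombₗ_single (i : I) (b : B) :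
    rightCombₗ f e (Finsupp.single i b) = e i * f b :=
  rightComb_single i b

@[simp] lemma leftCombₗ_single (i : I) (b : B) :
    leftCombₗ f e (Finsupp.single i b) = f b * e i :=
  leftComb_single i b

lemma RightFree.tensor (h : RightFree (f : B →+* A) e) (h' : RightFree (f' : B' →+* A') e') :
    RightFree (Algebra.TensorProduct.map f f' : B ⊗[k] B' →+* A ⊗[k] A')
      (fun i : I × I' => e i.1 ⊗ₜ[k] e' i.2) := by
  classical
  replace h : Function.Bijective (rightCombₗ f e) := h
  replace h' : Function.Bijective (rightCombₗ f' e') := h'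
  let E := (finsuppTensorFinsupp k k B B' I I').symm.trans (TensorProduct.congr
    (LinearEquiv.ofBijective (rightCombₗ f e) h) (LinearEquiv.ofBijective (rightCombₗ f' e') h'))
  have comb_eq : rightCombₗ (Algebra.TensorProduct.map f f')
      (fun i : I × I' => e i.1 ⊗ₜ[k] e' i.2) = E.toLinearMap := by
    refine Finsupp.lhom_ext' fun i => TensorProduct.ext' fun b b' => ?_
    simp [E]
  change Function.Bijective (rightCombₗ _ _)
  rw [comb_eq]
  exact E.bijective

lemma LeftFree.tensor (h : LeftFree (f : B →+* A) e) (h' : LeftFree (f' : B' →+* A') e') :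
    LeftFree (Algebra.TensorProduct.map f f' : B ⊗[k] B' →+* A ⊗[k] A')
      (fun i : I × I' => e i.1 ⊗ₜ[k] e' i.2) := by
  classical
  replace h : Function.Bijective (leftCombₗ f e) := h
  replace h' : Function.Bijective (leftCombₗ f' e') := h'
  let E := (finsuppTensorFinsupp k k B B' I I').symm.trans (TensorProduct.congr
    (LinearEquiv.ofBijective (leftCombₗ f e) h) (LinearEquiv.ofBijective (leftCombₗ f' e') h'))
  have comb_eq : leftCombₗ (Algebra.TensorProduct.map f f')
      (fun i : I × I' => e i.1 ⊗ₜ[k] e' i.2) = E.toLinearMap := by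
    refine Finsupp.lhom_ext' fun i => TensorProduct.ext' fun b b' => ?_
    simp [E]
  change Function.Bijective (leftCombₗ _ _)
  rw [comb_eq]
  exact E.bijective

end FreeTensor

section Ore

variable {k : Type*} [CommRing k] {A B : Type*} [Ring A] [Ring B] [Algebra k A] [Algebra k B]

/-- `A` is the Ore extension `B[x; σ, δ]`. -/
structure IsOre (f : B →ₐ[k] A) (x : A) (σ : B ≃ₐ[k] B) (δ : B →ₗ[k] B) : Prop where
  comm : ∀ b, x * f b = f (σ b) * x + f (δ b)
  free : LeftFree (f : B →+* A) (fun i : ℕ => x ^ i)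

namespace IsOre

variable {f : B →ₐ[k] A} {x : A} {σ : B ≃ₐ[k] B} {δ : B →ₗ[k] B} (H : IsOre f x σ δ)

include H

lemma bijective : Function.Bijective (leftCombₗ f fun i : ℕ => x ^ i) := H.free

/-- The coefficients of an element of an Ore extension, written on the left of the powers of the
variable. -/
noncomputable def coef : A ≃ₗ[k] (ℕ →₀ B) := (LinearEquiv.ofBijective _ H.bijective).symm

@[simp] lemma coef_mul_pow (b : B) (i : ℕ) : H.coef (f b * x ^ i) = Finsupp.single i b := by
  rw [coef, LinearEquiv.symm_apply_eq, LinearEquiv.ofBijective_apply, leftCombₗ_single]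

lemma induction {P : A → Prop} (zero : P 0) (add : ∀ a b, P a → P b → P (a + b))
    (monomial : ∀ b i, P (f b * x ^ i)) (a : A) : P a := by
  obtain ⟨p, rfl⟩ := H.bijective.2 a
  induction p using Finsupp.induction_linear with
  | zero => simpa using zero
  | add p q hp hq => rw [map_add]; exact add _ _ hp hq
  | single i b => rw [leftCombₗ_single]; exact monomial b i

lemma subalgebra_eq_top (P : Subalgebra k A) (hf : ∀ b, f b ∈ P) (hx : x ∈ P) : P = ⊤ :=
  eq_top_iff.2 fun a _ => H.induction P.zero_mem (fun _ _ => P.add_mem)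
    (fun b i => P.mul_mem (hf b) (P.pow_mem hx i)) a

@[simp] lemma coef_coe (b : B) : H.coef (f b) = Finsupp.single 0 b := by
  simpa using H.coef_mul_pow b 0

lemma injective : Function.Injective f := fun b c h =>
  Finsupp.single_injective 0 (by rw [← H.coef_coe, h, H.coef_coe])

lemma comm_mul_pow (b : B) (i : ℕ) :
    x * (f b * x ^ i) = f (σ b) * x ^ (i + 1) + f (δ b) * x ^ i := by
  rw [← mul_assoc, H.comm, add_mul, mul_assoc, ← pow_succ']

lemma coef_mul_left_succ (a : A) (j : ℕ) :
    H.coef (x * a) (j + 1) = σ (H.coef a j) + δ (H.coef a (j + 1)) := by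
  induction a using H.induction with
  | zero => simp
  | add a b ha hb => simp only [mul_add, map_add, Finsupp.add_apply, ha, hb]; abel
  | monomial b i =>
    rw [H.comm_mul_pow]
    simp only [map_add, coef_mul_pow, Finsupp.add_apply, Finsupp.single_apply]
    split_ifs <;> first | omega | simp

lemma leibniz (b c : B) : δ (b * c) = σ b * δ c + δ b * c := by
  have comm_mul : x * f (b * c) = f (σ (b * c)) * x + f (σ b * δ c + δ b * c) := by
    rw [map_mul, ← mul_assoc, H.comm, add_mul, mul_assoc, H.comm, mul_add]
    simp only [map_mul, map_add, mul_assoc, add_assoc]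
  rw [H.comm] at comm_mul
  exact H.injective (add_left_cancel comm_mul)

lemma coef_pow_mul_of_lt (b : B) {n j : ℕ} (hj : n < j) : H.coef (x ^ n * f b) j = 0 := by
  induction n generalizing j with
  | zero => simp [hj.ne]
  | succ n ih =>
    obtain ⟨j, rfl⟩ := Nat.exists_eq_succ_of_ne_zero (by omega : j ≠ 0)
    rw [pow_succ', mul_assoc, Nat.succ_eq_add_one, H.coef_mul_left_succ, ih (by omega),
      ih (by omega), map_zero, map_zero, add_zero]

lemma coef_pow_mul_self (b : B) (n : ℕ) : H.coef (x ^ n * f b) n = (σ ^ n) b := by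
  induction n with
  | zero => simp
  | succ n ih =>
    rw [pow_succ', mul_assoc, H.coef_mul_left_succ, ih, H.coef_pow_mul_of_lt b n.lt_succ_self,
      map_zero, add_zero, pow_succ', AlgEquiv.mul_apply]

lemma rightComb_injective : Function.Injective (rightCombₗ f fun i : ℕ => x ^ i) := by
  refine (injective_iff_map_eq_zero _).2 fun p hp => ?_
  by_contra p_ne_zero
  let n := p.support.max' (Finsupp.support_nonempty_iff.2 p_ne_zero)
  have hn : n ∈ p.support := Finset.max'_mem _ _
  have top_coef : H.coef (rightCombₗ f (fun i : ℕ => x ^ i) p) n = (σ ^ n) (p n) := by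
    change H.coef (∑ i ∈ p.support, x ^ i * f (p i)) n = _
    rw [map_sum, Finsupp.finsetSum_apply, Finset.sum_eq_single_of_mem n hn,
      H.coef_pow_mul_self]
    exact fun i hi hin => H.coef_pow_mul_of_lt _ (lt_of_le_of_ne (Finset.le_max' _ _ hi) hin)
  rw [hp, map_zero, Finsupp.zero_apply] at top_coef
  exact Finsupp.mem_support_iff.1 hn ((map_eq_zero_iff _ (σ ^ n).injective).1 top_coef.symm)

lemma mul_pow_mul_mem_range_rightComb (b c : B) (i : ℕ) :
    f b * (x ^ i * f c) ∈ LinearMap.range (rightCombₗ f fun i : ℕ => x ^ i) := by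
  set M := LinearMap.range (rightCombₗ f fun i : ℕ => x ^ i)
  have pow_mul_mem (i : ℕ) (c : B) : x ^ i * f c ∈ M := ⟨Finsupp.single i c, rightCombₗ_single i c⟩
  have mul_mem (a : A) (ha : a ∈ M) : x * a ∈ M := by
    obtain ⟨p, rfl⟩ := ha
    induction p using Finsupp.induction_linear with
    | zero => simp
    | add p q hp hq => rw [map_add, mul_add]; exact M.add_mem hp hq
    | single i b => simpa [← mul_assoc, ← pow_succ'] using pow_mul_mem (i + 1) b
  induction i generalizing b with
  | zero => simpa using pow_mul_mem 0 (b * c)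
  | succ i ih =>
    have comm_symm : f b * x = x * f (σ.symm b) - f (δ (σ.symm b)) := by
      rw [H.comm, AlgEquiv.apply_symm_apply, add_sub_cancel_right]
    rw [pow_succ', mul_assoc, ← mul_assoc, comm_symm, sub_mul, mul_assoc]
    exact M.sub_mem (mul_mem _ (ih _)) (ih _)

lemma rightFree : RightFree (f : B →+* A) (fun i : ℕ => x ^ i) := by
  refine ⟨H.rightComb_injective, fun a => ?_⟩
  change a ∈ LinearMap.range (rightCombₗ f fun i : ℕ => x ^ i)
  induction a using H.induction with
  | zero => exact Submodule.zero_mem _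
  | add a b ha hb => exact Submodule.add_mem _ ha hb
  | monomial b i => simpa using H.mul_pow_mul_mem_range_rightComb b 1 i

end IsOre

/-- The operator of left multiplication by the variable on `B[x; σ, δ]`. -/
noncomputable def oreShift (σ : B ≃ₐ[k] B) (δ : B →ₗ[k] B) : Module.End k (ℕ →₀ B) :=
  Finsupp.lsum k fun i => (Finsupp.lsingle (i + 1)).comp σ.toLinearMap + (Finsupp.lsingle i).comp δ

variable {σ : B ≃ₐ[k] B} {δ : B →ₗ[k] B}

lemma oreShift_single (i : ℕ) (b : B) :
    oreShift σ δ (Finsupp.single i b) = Finsupp.single (i + 1) (σ b) + Finsupp.single i (δ b) := by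
  simp [oreShift]

lemma oreShift_mul_lsmul (hδ : ∀ b c, δ (b * c) = σ b * δ c + δ b * c) (b : B) :
    oreShift σ δ * Algebra.lsmul k k (ℕ →₀ B) b =
      Algebra.lsmul k k (ℕ →₀ B) (σ b) * oreShift σ δ + Algebra.lsmul k k (ℕ →₀ B) (δ b) := by
  refine Finsupp.lhom_ext fun i c => ?_
  simp only [Module.End.mul_apply, LinearMap.add_apply, Algebra.lsmul_coe, Finsupp.smul_single,
    smul_eq_mul, oreShift_single, hδ, map_mul, Finsupp.single_add, smul_add, add_assoc]

lemma oreShift_pow_single (hδ : δ 1 = 0) (i : ℕ) :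
    (oreShift σ δ ^ i) (Finsupp.single 0 1) = Finsupp.single i 1 := by
  induction i with
  | zero => simp
  | succ i ih => simp [pow_succ', ih, oreShift_single, hδ]

variable {f : B →ₐ[k] A} {x : A}

lemma leftComb_injective_of_model (hδ : δ 1 = 0) (φ : A →ₐ[k] Module.End k (ℕ →₀ B))
    (hφ : ∀ b, φ (f b) = Algebra.lsmul k k (ℕ →₀ B) b) (hx : φ x = oreShift σ δ) :
    Function.Injective (leftCombₗ f fun i : ℕ => x ^ i) := by
  refine Function.LeftInverse.injective (g := fun a => φ a (Finsupp.single 0 1)) fun p => ?_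
  induction p using Finsupp.induction_linear with
  | zero => simp
  | add p q hp hq =>
    dsimp only at hp hq ⊢
    rw [map_add, map_add, LinearMap.add_apply, hp, hq]
  | single i b => simp [hφ, hx, oreShift_pow_single hδ]

lemma leftComb_surjective_of_adjoin_eq_top (comm : ∀ b, x * f b = f (σ b) * x + f (δ b))
    (gen : Algebra.adjoin k (insert x (Set.range f)) = ⊤) :
    Function.Surjective (leftCombₗ f fun i : ℕ => x ^ i) := by
  let M := LinearMap.range (leftCombₗ f fun i : ℕ => x ^ i)
  have mul_pow_mem (c : B) (i : ℕ) : f c * x ^ i ∈ M := ⟨Finsupp.single i c, leftCombₗ_single i c⟩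
  have mul_mem_of_monomials {a : A} (ha : ∀ c i, a * (f c * x ^ i) ∈ M) : ∀ m ∈ M, a * m ∈ M := by
    rintro m ⟨p, rfl⟩
    induction p using Finsupp.induction_linear with
    | zero => simp
    | add p q hp hq => rw [map_add, mul_add]; exact M.add_mem hp hq
    | single i b => rw [leftCombₗ_single]; exact ha b i
  have mul_mem (a : A) : ∀ m ∈ M, a * m ∈ M := by
    have ha : a ∈ Algebra.adjoin k (insert x (Set.range f)) := gen ▸ Algebra.mem_top
    induction ha using Algebra.adjoin_induction with
    | mem a ha =>
      refine mul_mem_of_monomials fun c i => ?_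
      rcases ha with rfl | ⟨b, rfl⟩
      · rw [← mul_assoc, comm, add_mul, mul_assoc, ← pow_succ']
        exact M.add_mem (mul_pow_mem _ _) (mul_pow_mem _ _)
      · rw [← mul_assoc, ← map_mul]
        exact mul_pow_mem _ _
    | algebraMap r => exact fun m hm => Algebra.smul_def r m ▸ M.smul_mem r hm
    | add a b _ _ ha hb => exact fun m hm => add_mul a b m ▸ M.add_mem (ha m hm) (hb m hm)
    | mul a b _ _ ha hb => exact fun m hm => mul_assoc a b m ▸ ha _ (hb m hm)
  exact fun a => by simpa [M] using mul_mem a 1 (by simpa using mul_pow_mem 1 0)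

theorem isOre_of_model (hδ : ∀ b c, δ (b * c) = σ b * δ c + δ b * c)
    (comm : ∀ b, x * f b = f (σ b) * x + f (δ b))
    (gen : Algebra.adjoin k (insert x (Set.range f)) = ⊤)
    (φ : A →ₐ[k] Module.End k (ℕ →₀ B)) (hφ : ∀ b, φ (f b) = Algebra.lsmul k k (ℕ →₀ B) b)
    (hx : φ x = oreShift σ δ) : IsOre f x σ δ :=
  ⟨comm, leftComb_injective_of_model (by simpa using hδ 1 1) φ hφ hx,
    leftComb_surjective_of_adjoin_eq_top comm gen⟩

lemma exists_skewDerivation (σ : B ≃ₐ[k] B) (s : Set B) (hs : Algebra.adjoin k s = ⊤)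
    (θ : B →ₐ[k] Matrix (Fin 2) (Fin 2) B)
    (hθ : ∀ b ∈ s, θ b 0 0 = σ b ∧ θ b 1 0 = 0 ∧ θ b 1 1 = b) :
    ∃ δ : B →ₗ[k] B, (∀ b, δ b = θ b 0 1) ∧ ∀ b c, δ (b * c) = σ b * δ c + δ b * c := by
  have triangular (b : B) : θ b 0 0 = σ b ∧ θ b 1 0 = 0 ∧ θ b 1 1 = b := by
    have hb : b ∈ Algebra.adjoin k s := hs ▸ Algebra.mem_top
    induction hb using Algebra.adjoin_induction with
    | mem b hb => exact hθ b hb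
    | algebraMap r => simp [Matrix.algebraMap_matrix_apply]
    | add b c _ _ hb hc => simp [hb, hc]
    | mul b c _ _ hb hc => simp [Matrix.mul_apply, Fin.sum_univ_two, hb, hc]
  refine ⟨{ toFun := fun b => θ b 0 1, map_add' := by simp, map_smul' := by simp },
    fun b => rfl, fun b c => ?_⟩
  simp [Matrix.mul_apply, Fin.sum_univ_two, triangular]

end Ore

section Torus

variable {k A : Type*} [Field k] [Ring A] [Algebra k A]

/-- The character of the torus `kˣ × kˣ` given by a bidegree. -/
def weight (g : ℤ × ℤ) (p : kˣ × kˣ) : kˣ := p.1 ^ g.1 * p.2 ^ g.2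

@[simp] lemma weight_zero (p : kˣ × kˣ) : weight 0 p = 1 := by simp [weight]

lemma weight_add (g h : ℤ × ℤ) (p : kˣ × kˣ) : weight (g + h) p = weight g p * weight h p := by
  simp only [weight, Prod.fst_add, Prod.snd_add, zpow_add]
  exact mul_mul_mul_comm _ _ _ _

lemma weight_inv (g : ℤ × ℤ) (p : kˣ × kˣ) : weight g p⁻¹ = (weight g p)⁻¹ := by
  simp [weight, mul_comm]

lemma weight_sub (g h : ℤ × ℤ) (p : kˣ × kˣ) : weight (g - h) p = weight g p * (weight h p)⁻¹ := by
  rw [eq_mul_inv_iff_mul_eq, ← weight_add, sub_add_cancel]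

lemma exists_zpow_ne_one [Infinite k] {n : ℤ} (hn : n ≠ 0) : ∃ z : kˣ, z ^ n ≠ 1 := by
  by_contra! zpow_eq_one
  have X_pow_eq_X : (Polynomial.X ^ (n.natAbs + 1) : Polynomial k) = Polynomial.X := by
    refine Polynomial.funext fun z => ?_
    rcases eq_or_ne z 0 with rfl | hz
    · simp
    · have pow_eq_one : z ^ n.natAbs = 1 :=
        congrArg Units.val (pow_natAbs_eq_one.2 (zpow_eq_one (Units.mk0 z hz)))
      simp [pow_succ, pow_eq_one]
  exact hn (by simpa using congrArg Polynomial.natDegree X_pow_eq_X)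

/-- A bidegree as a multiplicative character of the torus with values in `k`. -/
def weightHom (g : ℤ × ℤ) : kˣ × kˣ →* k where
  toFun p := weight g p
  map_one' := by simp [weight]
  map_mul' p q := by simp [weight, mul_zpow, mul_mul_mul_comm]

lemma weightHom_injective [Infinite k] :
    Function.Injective (weightHom : ℤ × ℤ → (kˣ × kˣ →* k)) := by
  have eq_of_zpow_eq {m n : ℤ} (h : ∀ z : kˣ, z ^ m = z ^ n) : m = n := by
    by_contra hmn
    obtain ⟨z, hz⟩ := exists_zpow_ne_one (k := k) (sub_ne_zero.2 hmn)
    exact hz (by rw [zpow_sub, h z, mul_inv_cancel])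
  intro g h hgh
  have weight_eq (p : kˣ × kˣ) : weight g p = weight h p :=
    Units.ext (DFunLike.congr_fun hgh p)
  exact Prod.ext (eq_of_zpow_eq fun z => by simpa [weight] using weight_eq (z, 1))
    (eq_of_zpow_eq fun z => by simpa [weight] using weight_eq (1, z))

/-- The elements of bidegree `g` under the action of the torus. -/
def homog (T : kˣ × kˣ → (A →ₐ[k] A)) (g : ℤ × ℤ) : Submodule k A where
  carrier := {a | ∀ p, T p a = (weight g p : k) • a}
  add_mem' ha hb p := by rw [map_add, ha p, hb p, smul_add]
  zero_mem' p := by simp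
  smul_mem' c a ha p := by rw [map_smul, ha p, smul_comm]

variable {T : kˣ × kˣ → (A →ₐ[k] A)} {S : AddSubmonoid (ℤ × ℤ)}

lemma one_mem_homog : (1 : A) ∈ homog T 0 := fun p => by simp

lemma mul_mem_homog {g h : ℤ × ℤ} {a b : A} (ha : a ∈ homog T g) (hb : b ∈ homog T h) :
    a * b ∈ homog T (g + h) := fun p => by
  rw [map_mul, ha p, hb p, weight_add, smul_mul_smul_comm, Units.val_mul]

lemma iSupIndep_homog [Infinite k] : iSupIndep (homog T) := by
  refine (iSupIndep_iff_finsetSum_eq_zero_imp_eq_zero _).2 fun s a ha sum_eq g hg => ?_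
  refine (Module.forall_dual_apply_eq_zero_iff k (a g)).1 fun ℓ => ?_
  refine linearIndependent_iff'.1
    ((linearIndependent_monoidHom (kˣ × kˣ) k).comp _ weightHom_injective)
    s (fun g => ℓ (a g)) (funext fun p => ?_) g hg
  have sum_smul_eq : ∑ g ∈ s, (weight g p : k) • a g = 0 := by
    rw [← map_zero (T p), ← sum_eq, map_sum]
    exact Finset.sum_congr rfl fun g hg => (ha g hg p).symm
  simpa [weightHom, mul_comm] using congrArg ℓ sum_smul_eq

lemma homog_le_iSup {g : ℤ × ℤ} (hg : g ∈ S) : homog T g ≤ ⨆ g ∈ S, homog T g :=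
  le_iSup₂_of_le g hg le_rfl

lemma eq_zero_of_mem_homog [Infinite k] (hS : ⨆ g ∈ S, homog T g = ⊤)
    {g : ℤ × ℤ} (hg : g ∉ S) {a : A} (ha : a ∈ homog T g) : a = 0 := by
  have iSup_ne_eq_top : (⨆ j, ⨆ (_ : j ≠ g), homog T j) = ⊤ :=
    eq_top_iff.2 (hS.ge.trans (iSup₂_le fun j hj =>
      le_iSup₂_of_le j (fun hjg => hg (hjg ▸ hj)) le_rfl))
  have homog_disjoint := iSupIndep_homog (T := T) g
  rw [iSup_ne_eq_top, disjoint_top] at homog_disjoint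
  simpa [homog_disjoint] using ha

lemma homog_induction (hS : ⨆ g ∈ S, homog T g = ⊤) {P : A → Prop}
    (zero : P 0) (add : ∀ a b, P a → P b → P (a + b)) (homogeneous : ∀ g ∈ S, ∀ a ∈ homog T g, P a)
    (a : A) : P a := by
  have ha : a ∈ ⨆ g ∈ S, homog T g := hS ▸ Submodule.mem_top
  rw [iSup_subtype'] at ha
  exact Submodule.iSup_induction (fun g : S => homog T g) (motive := P) ha
    (fun g a ha => homogeneous g g.2 a ha) zero add

lemma iSup_homog_eq_top_of_adjoin {s : Set A} (hs : Algebra.adjoin k s = ⊤)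
    (h : ∀ a ∈ s, ∃ g ∈ S, a ∈ homog T g) : ⨆ g ∈ S, homog T g = ⊤ := by
  set M := ⨆ g ∈ S, homog T g with hM
  have mul_le : M * M ≤ M := by
    simp only [hM, Submodule.iSup_mul, Submodule.mul_iSup, iSup_le_iff, Submodule.mul_le]
    exact fun i hi j hj a ha b hb =>
      homog_le_iSup (S.add_mem hj hi) (mul_mem_homog ha hb)
  let M' : Subalgebra k A := M.toSubalgebra (homog_le_iSup S.zero_mem one_mem_homog)
    fun a b ha hb => mul_le (Submodule.mul_mem_mul ha hb)
  have top_le : ⊤ ≤ M' := hs ▸ Algebra.adjoin_le fun a ha => by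
    obtain ⟨g, hg, hag⟩ := h a ha
    exact homog_le_iSup hg hag
  exact eq_top_iff.2 fun a _ => top_le Algebra.mem_top

lemma exists_projection [Infinite k] (hS : ⨆ g ∈ S, homog T g = ⊤) :
    ∃ π : ℤ × ℤ → A →+ A, (∀ g a, π g a ∈ homog T g) ∧ (∀ g, ∀ a ∈ homog T g, π g a = a) ∧
      (∀ g h a, ∀ r ∈ homog T h, π (g + h) (a * r) = π g a * r) ∧
      ∀ g h a, ∀ r ∈ homog T h, π (h + g) (r * a) = r * π g a := by
  classical
  have iSup_eq_top : ⨆ g, homog T g = ⊤ :=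
    eq_top_iff.2 (hS.ge.trans (iSup₂_le fun g _ => le_iSup _ g))
  let _ : GradedRing (homog T) :=
    { ((DirectSum.isInternal_submodule_iff_iSupIndep_and_iSup_eq_top _).2
        ⟨iSupIndep_homog, iSup_eq_top⟩).chooseDecomposition with
      one_mem := one_mem_homog
      mul_mem := fun _ _ _ _ => mul_mem_homog }
  refine ⟨fun g => GradedRing.proj (homog T) g, fun g a => SetLike.coe_mem _, fun g a ha => ?_,
    fun g h a r hr => DirectSum.coe_decompose_mul_add_of_right_mem (homog T) hr,
    fun g h a r hr => DirectSum.coe_decompose_mul_add_of_left_mem (homog T) hr⟩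
  rw [GradedRing.proj_apply, DirectSum.decompose_of_mem_same _ ha]

lemma torus_comm (hS : ⨆ g ∈ S, homog T g = ⊤) (p q : kˣ × kˣ) (a : A) :
    T p (T q a) = T q (T p a) := by
  induction a using homog_induction hS with
  | zero => simp
  | add a b ha hb => simp [ha, hb]
  | homogeneous g _ a ha => rw [ha p, ha q, map_smul, map_smul, ha p, ha q, smul_comm]

lemma torus_inv (hS : ⨆ g ∈ S, homog T g = ⊤) (p : kˣ × kˣ) (a : A) :
    T p (T p⁻¹ a) = a := by
  induction a using homog_induction hS with
  | zero => simp
  | add a b ha hb => simp [ha, hb]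
  | homogeneous g _ a ha => rw [ha p⁻¹, map_smul, ha p, weight_inv, smul_smul]; simp

/-- The automorphism given by an element of the torus. -/
noncomputable def torusEquiv (hS : ⨆ g ∈ S, homog T g = ⊤) (p : kˣ × kˣ) : A ≃ₐ[k] A :=
  AlgEquiv.ofAlgHom (T p) (T p⁻¹) (AlgHom.ext fun a => torus_inv hS p a)
    (AlgHom.ext fun a => by simpa using torus_inv hS p⁻¹ a)

variable (T) in
/-- The action of the torus on the enveloping algebra. -/
noncomputable def torusEnv (p : kˣ × kˣ) : Env k A →ₐ[k] Env k A :=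
  Algebra.TensorProduct.map (T p) (T p).op

@[simp] lemma torusEnv_tmul (p : kˣ × kˣ) (a : A) (b : Aᵐᵒᵖ) :
    torusEnv T p (a ⊗ₜ b) = T p a ⊗ₜ op (T p (unop b)) := rfl

lemma tmul_mem_homog {g h : ℤ × ℤ} {a b : A} (ha : a ∈ homog T g) (hb : b ∈ homog T h) :
    (a ⊗ₜ op b : Env k A) ∈ homog (torusEnv T) (g + h) := fun p => by
  rw [torusEnv_tmul, ha p, unop_op, hb p, weight_add, op_smul, TensorProduct.smul_tmul_smul,
    Units.val_mul]

lemma iSup_homog_torusEnv (hS : ⨆ g ∈ S, homog T g = ⊤) :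
    ⨆ g ∈ S, homog (torusEnv T) g = ⊤ := by
  refine (Submodule.eq_top_iff').2 fun r => ?_
  induction r using TensorProduct.induction_on with
  | zero => simp
  | add x y hx hy => exact Submodule.add_mem _ hx hy
  | tmul a b =>
    obtain ⟨b, rfl⟩ := op_surjective b
    induction a using homog_induction hS with
    | zero => simp
    | add a a' ha ha' =>
      rw [TensorProduct.add_tmul]
      exact Submodule.add_mem _ ha ha'
    | homogeneous g hg a ha =>
      induction b using homog_induction hS with
      | zero => simp
      | add b b' hb hb' =>
        simpa [TensorProduct.tmul_add] using Submodule.add_mem _ hb hb'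
      | homogeneous h hh b hb => exact homog_le_iSup (S.add_mem hg hh) (tmul_mem_homog ha hb)

end Torus

section Cone

/-- The homology of a mapping cone is concentrated at the new end as soon as the homology of both
ends is generated through `j` and `φ` is injective on it. -/
lemma exists_eq_cone_boundary {V E : Type*} [AddCommGroup V] {d₁ d₂ φ : V →+ V} {j : E → V}
    (h₁ : ∀ v, d₁ v = 0 → ∃ u s, v = d₁ u + j s) (h₂ : ∀ v, d₂ v = 0 → ∃ u s, v = d₂ u + j s)
    (hφ : ∀ v, d₁ (φ v) = φ (d₂ v)) (hinj : ∀ s, (∃ u, d₁ u = φ (j s)) → ∃ u, d₂ u = j s)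
    {v₁ v₂ : V} (hv₁ : d₁ v₁ + φ v₂ = 0) (hv₂ : d₂ v₂ = 0) :
    ∃ u₁ u₂ s, v₁ = d₁ u₁ + φ u₂ + j s ∧ v₂ = -d₂ u₂ := by
  obtain ⟨w, rfl⟩ : ∃ w, v₂ = d₂ w := by
    obtain ⟨w, s, rfl⟩ := h₂ v₂ hv₂
    obtain ⟨w', hw'⟩ := hinj s ⟨-(v₁ + φ w), by
      rw [map_neg, map_add, hφ, neg_eq_iff_add_eq_zero, add_assoc, ← map_add, hv₁]⟩
    exact ⟨w + w', by rw [map_add, hw']⟩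
  rw [← hφ, ← map_add] at hv₁
  obtain ⟨u, s, hus⟩ := h₁ _ hv₁
  refine ⟨u, -w, s, ?_, by rw [map_neg, neg_neg]⟩
  rw [map_neg, add_right_comm, ← hus, add_neg_cancel_right]

variable {R : Type*} [Ring R] {ι : Type*} [Fintype ι]

/-- The total differential of the mapping cone of `Φ`. -/
def coneMatrix (M N Φ : Matrix ι ι R) : Matrix (ι ⊕ ι) (ι ⊕ ι) R :=
  Matrix.fromBlocks M 0 Φ (-N)

variable {M N Φ : Matrix ι ι R}

lemma coneMatrix_mul_self (hM : M * M = 0) (hN : N * N = 0) (hΦ : Φ * M = N * Φ) :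
    coneMatrix M N Φ * coneMatrix M N Φ = 0 := by
  rw [coneMatrix, Matrix.fromBlocks_multiply]
  simp [hM, hN, hΦ]

lemma elim_vecMul_coneMatrix (v₁ v₂ : ι → R) :
    Sum.elim v₁ v₂ ᵥ* coneMatrix M N Φ = Sum.elim (v₁ ᵥ* M + v₂ ᵥ* Φ) (-(v₂ ᵥ* N)) := by
  simp [coneMatrix, Matrix.vecMul_fromBlocks, Matrix.vecMul_neg]

lemma coneMatrix_mulVec_elim (v₁ v₂ : ι → R) :
    coneMatrix M N Φ *ᵥ Sum.elim v₁ v₂ = Sum.elim (M *ᵥ v₁) (Φ *ᵥ v₁ - N *ᵥ v₂) := by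
  simp [coneMatrix, Matrix.fromBlocks_mulVec, Matrix.neg_mulVec, sub_eq_add_neg]

variable [DecidableEq ι] {o t : ι} {φ : R}

lemma single_vecMul_eq (hΦ : Φ.row o = Pi.single o φ) (s : R) :
    Pi.single o s ᵥ* Φ = Pi.single o (s * φ) := by
  rw [Matrix.single_vecMul, hΦ, ← Pi.single_smul, smul_eq_mul]

lemma mulVec_single_eq (hΦ : Φ.col t = Pi.single t φ) (s : R) :
    Φ *ᵥ Pi.single t s = Pi.single t (φ * s) := by
  rw [Matrix.mulVec_single, hΦ, ← Pi.single_smul, op_smul_eq_mul]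

lemma isRowExactAt_coneMatrix (hΦ : Φ * M = N * Φ) (hM : IsRowExactAt M o) (hN : IsRowExactAt N o)
    (ho : Φ.row o = Pi.single o φ) (hinj : ∀ s, s * φ ∈ rowIdeal M o → s ∈ rowIdeal N o) :
    IsRowExactAt (coneMatrix M N Φ) (Sum.inl o) := by
  intro v hv
  obtain ⟨v₁, v₂, rfl⟩ : ∃ v₁ v₂, v = Sum.elim v₁ v₂ := ⟨_, _, (Sum.elim_comp_inl_inr v).symm⟩
  rw [elim_vecMul_coneMatrix] at hv
  obtain ⟨u₁, u₂, s, rfl, rfl⟩ := exists_eq_cone_boundary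
    (d₁ := M.vecMulLinear.toAddMonoidHom) (d₂ := N.vecMulLinear.toAddMonoidHom)
    (φ := Φ.vecMulLinear.toAddMonoidHom) (j := Pi.single o) hM hN
    (fun v => by simp [Matrix.vecMul_vecMul, hΦ])
    (fun s ⟨u, hu⟩ => hinj s ⟨u, hu.trans (single_vecMul_eq ho s)⟩)
    (congrArg (· ∘ Sum.inl) hv) (neg_eq_zero.1 (congrArg (· ∘ Sum.inr) hv))
  refine ⟨Sum.elim u₁ u₂, s, ?_⟩
  rw [elim_vecMul_coneMatrix]
  funext i
  rcases i with i | i <;> simp [Pi.single_apply]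

lemma isColExactAt_coneMatrix (hΦ : Φ * M = N * Φ) (hM : IsColExactAt M t) (hN : IsColExactAt N t)
    (ht : Φ.col t = Pi.single t φ) (hinj : ∀ s, φ * s ∈ colIdeal N t → s ∈ colIdeal M t) :
    IsColExactAt (coneMatrix M N Φ) (Sum.inr t) := by
  intro v hv
  obtain ⟨v₁, v₂, rfl⟩ : ∃ v₁ v₂, v = Sum.elim v₁ v₂ := ⟨_, _, (Sum.elim_comp_inl_inr v).symm⟩
  rw [coneMatrix_mulVec_elim] at hv
  have N_mulVec_add : N *ᵥ (-v₂) + Φ *ᵥ v₁ = 0 := by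
    rw [Matrix.mulVec_neg, neg_add_eq_sub]
    exact congrArg (· ∘ Sum.inr) hv
  obtain ⟨u₂, u₁, s, hv₂, rfl⟩ := exists_eq_cone_boundary
    (d₁ := AddMonoidHom.mk' _ N.mulVec_add) (d₂ := AddMonoidHom.mk' _ M.mulVec_add)
    (φ := AddMonoidHom.mk' _ Φ.mulVec_add) (j := Pi.single t) hN hM
    (fun v => by simp [Matrix.mulVec_mulVec, hΦ])
    (fun s ⟨u, hu⟩ => hinj s ⟨u, hu.trans (mulVec_single_eq ht s)⟩)
    N_mulVec_add (congrArg (· ∘ Sum.inl) hv)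
  refine ⟨Sum.elim (-u₁) u₂, -s, ?_⟩
  rw [coneMatrix_mulVec_elim, ← neg_neg v₂, hv₂]
  funext i
  rcases i with i | i <;> simp [Matrix.mulVec_neg, Pi.single_apply]
  split_ifs <;> abel

end Cone

section EnvMaps

variable {k : Type v} [CommRing k] {A B : Type u} [Ring A] [Ring B] [Algebra k A] [Algebra k B]

/-- The map of enveloping algebras induced by a homomorphism. -/
noncomputable def envMap (f : B →ₐ[k] A) : Env k B →ₐ[k] Env k A :=
  Algebra.TensorProduct.map f f.op

@[simp] lemma envMap_tmul (f : B →ₐ[k] A) (a : B) (b : Bᵐᵒᵖ) :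
    envMap f (a ⊗ₜ b) = f a ⊗ₜ op (f (unop b)) := rfl

/-- The automorphism `τ ⊗ 1` of the enveloping algebra. -/
noncomputable def leftTwist (τ : B ≃ₐ[k] B) : Env k B ≃ₐ[k] Env k B :=
  Algebra.TensorProduct.congr τ AlgEquiv.refl

@[simp] lemma leftTwist_tmul (τ : B ≃ₐ[k] B) (a : B) (b : Bᵐᵒᵖ) :
    leftTwist τ (a ⊗ₜ b) = τ a ⊗ₜ b := rfl

lemma leftTwist_refl : leftTwist (AlgEquiv.refl : B ≃ₐ[k] B) = AlgEquiv.refl := by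
  ext r
  induction r using TensorProduct.induction_on with
  | zero => simp
  | add r s hr hs => simp only [map_add, hr, hs]
  | tmul a b => rfl

namespace IsOre

variable {f : B →ₐ[k] A} {x : A} {σ : B ≃ₐ[k] B} {δ : B →ₗ[k] B} (H : IsOre f x σ δ)

include H

lemma envMap_rightFree : RightFree (envMap f : Env k B →+* Env k A)
    (fun i : ℕ × ℕ => (x ^ i.1) ⊗ₜ[k] op (x ^ i.2)) := by
  have op_rightFree : RightFree (f.op : Bᵐᵒᵖ →+* Aᵐᵒᵖ) (fun i : ℕ => op (x ^ i)) := H.free.opposite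
  rw [envMap]
  convert H.rightFree.tensor op_rightFree

lemma envMap_leftFree : LeftFree (envMap f : Env k B →+* Env k A)
    (fun i : ℕ × ℕ => (x ^ i.1) ⊗ₜ[k] op (x ^ i.2)) := by
  have op_leftFree : LeftFree (f.op : Bᵐᵒᵖ →+* Aᵐᵒᵖ) (fun i : ℕ => op (x ^ i)) :=
    H.rightFree.opposite
  rw [envMap]
  convert H.free.tensor op_leftFree

lemma envMap_injective : Function.Injective (envMap f) := fun r s hrs =>
  Finsupp.single_injective (0, 0) <| H.envMap_rightFree.1 <| by simp [hrs]

/-- The coefficients in `A` of an element of the enveloping algebra, written as a combination of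
the elements `1 ⊗ x ^ i`, where an element `b` of `B` on the right is moved to the left as
`τ b`. -/
noncomputable def leftCoef (τ : B ≃ₐ[k] B) : Env k A →ₗ[k] (ℕ →₀ A) :=
  TensorProduct.lift <| LinearMap.mk₂ k (fun m n => Finsupp.mapRange.linearMap
      (LinearMap.mulLeft k m ∘ₗ f.toLinearMap ∘ₗ τ.toLinearMap) (H.coef (unop n)))
    (fun _ _ _ => Finsupp.ext fun _ => by simp [add_mul])
    (fun _ _ _ => Finsupp.ext fun _ => by simp)
    (fun _ _ _ => Finsupp.ext fun _ => by simp [mul_add])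
    (fun _ _ _ => Finsupp.ext fun _ => by simp)

/-- The coefficients in `A` of an element of the enveloping algebra, written as a combination of
the elements `x ^ i ⊗ 1`, where an element `b` of `B` on the left is moved to the right as
`μ b`. -/
noncomputable def rightCoef (μ : B →ₐ[k] B) : Env k A →ₗ[k] (ℕ →₀ A) :=
  TensorProduct.lift <| LinearMap.mk₂ k (fun m n => Finsupp.mapRange.linearMap
      (LinearMap.mulLeft k (unop n) ∘ₗ f.toLinearMap ∘ₗ μ.toLinearMap) (H.coef m))
    (fun _ _ _ => Finsupp.ext fun _ => by simp [mul_add])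
    (fun _ _ _ => Finsupp.ext fun _ => by simp)
    (fun _ _ _ => Finsupp.ext fun _ => by simp [add_mul])
    (fun _ _ _ => Finsupp.ext fun _ => by simp)

@[simp] lemma leftCoef_tmul (τ : B ≃ₐ[k] B) (i : ℕ) (m : A) (n : Aᵐᵒᵖ) :
    H.leftCoef τ (m ⊗ₜ n) i = m * f (τ (H.coef (unop n) i)) := by simp [leftCoef]

@[simp] lemma rightCoef_tmul (μ : B →ₐ[k] B) (i : ℕ) (m : A) (n : Aᵐᵒᵖ) :
    H.rightCoef μ (m ⊗ₜ n) i = unop n * f (μ (H.coef m i)) := by simp [rightCoef]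

lemma coef_coe_mul (b : B) (a : A) (i : ℕ) : H.coef (f b * a) i = b * H.coef a i := by
  induction a using H.induction with
  | zero => simp
  | add a a' ha ha' => simp [mul_add, ha, ha']
  | monomial c j =>
    rw [← mul_assoc, ← map_mul, H.coef_mul_pow, H.coef_mul_pow, Finsupp.single_apply,
      Finsupp.single_apply, mul_ite, mul_zero]

lemma leftCoef_mul_envMap (τ : B ≃ₐ[k] B) (s : Env k A) {j : Env k B}
    (hj : leftEval k B j = 0) : H.leftCoef τ (s * envMap f (leftTwist τ j)) = 0 := by
  induction s using TensorProduct.induction_on with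
  | zero => simp
  | add s t hs ht => rw [add_mul, map_add, hs, ht, add_zero]
  | tmul m n =>
    ext i
    have leftCoef_mul : H.leftCoef τ (m ⊗ₜ n * envMap f (leftTwist τ j)) i =
        m * f (τ (leftEval k B j)) * f (τ (H.coef (unop n) i)) := by
      clear hj
      induction j using TensorProduct.induction_on with
      | zero => simp
      | add j j' hj hj' => simp only [map_add, mul_add, add_mul, Finsupp.add_apply, hj, hj']
      | tmul b c => simp [H.coef_coe_mul, mul_assoc]
    simp [leftCoef_mul, hj]

lemma rightCoef_envMap_mul {τ : B ≃ₐ[k] B} {ν μ : B →ₐ[k] B} (hμ : ∀ b, μ (τ b) = ν b)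
    (s : Env k A) {j : Env k B} (hj : rightEval ν j = 0) :
    H.rightCoef μ (envMap f (leftTwist τ j) * s) = 0 := by
  induction s using TensorProduct.induction_on with
  | zero => simp
  | add s t hs ht => rw [mul_add, map_add, hs, ht, add_zero]
  | tmul m n =>
    ext i
    have rightCoef_mul : H.rightCoef μ (envMap f (leftTwist τ j) * m ⊗ₜ n) i =
        unop n * f (rightEval ν j) * f (μ (H.coef m i)) := by
      clear hj
      induction j using TensorProduct.induction_on with
      | zero => simp
      | add j j' hj hj' => simp only [map_add, mul_add, add_mul, Finsupp.add_apply, hj, hj']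
      | tmul b c => simp [H.coef_coe_mul, mul_assoc, hμ]
    simp [rightCoef_mul, hj]

lemma mem_of_leftCoef_eq_zero {τ : B ≃ₐ[k] B} {J : Submodule (Env k A) (Env k A)}
    (hJ : ∀ b, (1 ⊗ₜ op (f b) - f (τ b) ⊗ₜ 1 : Env k A) ∈ J) {r : Env k A}
    (hr : H.leftCoef τ r = 0) : r ∈ J := by
  let expand : (ℕ →₀ A) →ₗ[k] Env k A :=
    Finsupp.lsum k fun i => (TensorProduct.mk k A Aᵐᵒᵖ).flip (op (x ^ i))
  have expand_single (i : ℕ) (a : A) : expand (Finsupp.single i a) = a ⊗ₜ op (x ^ i) :=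
    Finsupp.lsum_single _ _ _ _
  suffices sub_expand_mem : r - expand (H.leftCoef τ r) ∈ J by simpa [hr] using sub_expand_mem
  clear hr
  induction r using TensorProduct.induction_on with
  | zero => simp
  | add r s hr hs => rw [map_add, map_add, add_sub_add_comm]; exact J.add_mem hr hs
  | tmul m n =>
    obtain ⟨n, rfl⟩ := op_surjective n
    induction n using H.induction with
    | zero => simp
    | add n n' hn hn' =>
      rw [MulOpposite.op_add, TensorProduct.tmul_add, map_add, map_add, add_sub_add_comm]
      exact J.add_mem hn hn'
    | monomial b i =>
      have leftCoef_monomial : H.leftCoef τ (m ⊗ₜ op (f b * x ^ i)) =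
          Finsupp.single i (m * f (τ b)) := by
        ext j
        rw [leftCoef_tmul, unop_op, H.coef_mul_pow, Finsupp.single_apply, Finsupp.single_apply]
        split_ifs <;> simp
      rw [leftCoef_monomial, expand_single]
      simpa [mul_sub] using J.smul_mem (m ⊗ₜ op (x ^ i)) (hJ b)

lemma mem_of_rightCoef_eq_zero {τ : B ≃ₐ[k] B} {ν μ : B →ₐ[k] B} (hμ : ∀ b, μ (τ b) = ν b)
    {K : Submodule (Env k A)ᵐᵒᵖ (Env k A)}
    (hK : ∀ b, (f (τ b) ⊗ₜ 1 - 1 ⊗ₜ op (f (ν b)) : Env k A) ∈ K) {r : Env k A}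
    (hr : H.rightCoef μ r = 0) : r ∈ K := by
  let expand : (ℕ →₀ A) →ₗ[k] Env k A :=
    Finsupp.lsum k fun i => TensorProduct.mk k A Aᵐᵒᵖ (x ^ i) ∘ₗ (opLinearEquiv k).toLinearMap
  have expand_single (i : ℕ) (a : A) : expand (Finsupp.single i a) = (x ^ i) ⊗ₜ op a :=
    Finsupp.lsum_single _ _ _ _
  suffices sub_expand_mem : r - expand (H.rightCoef μ r) ∈ K by simpa [hr] using sub_expand_mem
  clear hr
  induction r using TensorProduct.induction_on with
  | zero => simp
  | add r s hr hs => rw [map_add, map_add, add_sub_add_comm]; exact K.add_mem hr hs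
  | tmul m n =>
    induction m using H.induction with
    | zero => simp
    | add m m' hm hm' =>
      rw [TensorProduct.add_tmul, map_add, map_add, add_sub_add_comm]
      exact K.add_mem hm hm'
    | monomial b i =>
      have rightCoef_monomial : H.rightCoef μ ((f b * x ^ i) ⊗ₜ n) =
          Finsupp.single i (unop n * f (μ b)) := by
        ext j
        rw [rightCoef_tmul, H.coef_mul_pow, Finsupp.single_apply, Finsupp.single_apply]
        split_ifs <;> simp
      rw [rightCoef_monomial, expand_single]
      simpa [sub_mul, ← hμ] using K.smul_mem (op ((x ^ i) ⊗ₜ n)) (hK (τ.symm b))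

lemma leftCoef_succ_mul (r : Env k A) (i : ℕ) :
    H.leftCoef AlgEquiv.refl (r * (x ⊗ₜ 1 - 1 ⊗ₜ op x)) (i + 1) =
      H.leftCoef σ r (i + 1) * x - H.leftCoef σ r i := by
  induction r using TensorProduct.induction_on with
  | zero => simp
  | add r s hr hs => simp only [add_mul, map_add, Finsupp.add_apply, hr, hs]; abel
  | tmul m n =>
    simp only [mul_sub, Algebra.TensorProduct.tmul_mul_tmul, mul_one, map_sub, Finsupp.sub_apply,
      leftCoef_tmul, unop_mul, unop_op, H.coef_mul_left_succ, AlgEquiv.coe_refl, id, map_add,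
      mul_add, mul_assoc, H.comm]
    abel

lemma rightCoef_succ_mul {μ : B →ₐ[k] B} {θ : k} (hσ : ∀ b, σ (μ b) = μ (σ b))
    (hδ : ∀ b, μ (δ b) = θ • δ (μ b)) (r : Env k A) (i : ℕ) :
    H.rightCoef μ ((x ⊗ₜ 1 - θ • 1 ⊗ₜ op x) * r) (i + 1) =
      H.rightCoef (μ.comp σ) r i - θ • (H.rightCoef (μ.comp σ) r (i + 1) * x) := by
  induction r using TensorProduct.induction_on with
  | zero => simp
  | add r s hr hs =>
    simp only [mul_add, add_mul, map_add, Finsupp.add_apply, smul_add, hr, hs]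
    abel
  | tmul m n =>
    simp only [sub_mul, smul_mul_assoc, Algebra.TensorProduct.tmul_mul_tmul, one_mul, map_sub,
      map_smul, Finsupp.sub_apply, Finsupp.smul_apply, rightCoef_tmul, unop_mul, unop_op,
      H.coef_mul_left_succ, map_add, mul_add, mul_assoc, H.comm, hσ, hδ, smul_add,
      AlgHom.comp_apply, AlgEquiv.coe_toAlgHom, mul_smul_comm]
    abel

end IsOre

end EnvMaps

section ConeDuality

variable {R R' : Type*} [Ring R] [Ring R'] {ι : Type} [Fintype ι] {deg : ι → ℕ}
  {D M N Φ : Matrix ι ι R}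

lemma IsDifferential.map (hD : IsDifferential deg D) (F : R →+* R') :
    IsDifferential deg (D.map F) where
  degree_eq r c hrc := hD.degree_eq r c fun h => hrc (by rw [Matrix.map_apply, h, map_zero])
  mul_self := by rw [← Matrix.map_mul, hD.mul_self, Matrix.map_zero _ (map_zero _)]

lemma IsDifferential.cone (hM : IsDifferential deg M) (hN : IsDifferential deg N)
    (hΦ : Φ * M = N * Φ) (hdeg : ∀ r c, Φ r c ≠ 0 → deg r = deg c) :
    IsDifferential (Sum.elim deg fun r => deg r + 1) (coneMatrix M N Φ) where
  degree_eq := by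
    rintro (r | r) (c | c) hrc
    · exact hM.degree_eq r c hrc
    · exact absurd rfl hrc
    · exact congrArg (· + 1) (hdeg r c hrc)
    · exact congrArg (· + 1) (hN.degree_eq r c (neg_ne_zero.1 hrc))
  mul_self := coneMatrix_mul_self hM.mul_self hN.mul_self hΦ

variable [DecidableEq ι] {o t : ι}

lemma mem_rowIdeal_coneMatrix {s : R} (hs : s ∈ rowIdeal M o) :
    s ∈ rowIdeal (coneMatrix M N Φ) (Sum.inl o) := by
  obtain ⟨u, hu⟩ := mem_rowIdeal.1 hs
  refine mem_rowIdeal.2 ⟨Sum.elim u 0, ?_⟩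
  rw [elim_vecMul_coneMatrix, hu, Matrix.zero_vecMul, Matrix.zero_vecMul, add_zero, neg_zero,
    Sum.elim_single_zero]

lemma mem_colIdeal_coneMatrix {s : R} (hs : s ∈ colIdeal N t) :
    s ∈ colIdeal (coneMatrix M N Φ) (Sum.inr t) := by
  obtain ⟨u, hu⟩ := mem_colIdeal.1 hs
  refine mem_colIdeal.2 ⟨Sum.elim 0 (-u), ?_⟩
  rw [coneMatrix_mulVec_elim, Matrix.mulVec_neg, hu, Matrix.mulVec_zero, Matrix.mulVec_zero,
    zero_sub, neg_neg, Sum.elim_zero_single]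

namespace IsDualityComplex

variable {d : ℕ}

lemma map {I I' : Type*} {F : R →+* R'} {e : I → R'} {e' : I' → R'}
    (H : IsDualityComplex d deg o t D) (hr : RightFree F e) (hl : LeftFree F e') :
    IsDualityComplex d deg o t (D.map F) where
  toIsDifferential := H.toIsDifferential.map F
  degree_eq_zero_iff := H.degree_eq_zero_iff
  degree_le := H.degree_le
  degree_eq_top_iff := H.degree_eq_top_iff
  rowExact := hr.isRowExactAt_map H.rowExact
  colExact := hl.isColExactAt_map H.colExact

lemma cone {φ ψ : R} (hM : IsDualityComplex d deg o t M) (hN : IsDualityComplex d deg o t N)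
    (hΦ : Φ * M = N * Φ) (hdeg : ∀ r c, Φ r c ≠ 0 → deg r = deg c)
    (ho : Φ.row o = Pi.single o φ) (ht : Φ.col t = Pi.single t ψ)
    (hφ : ∀ s, s * φ ∈ rowIdeal M o → s ∈ rowIdeal N o)
    (hψ : ∀ s, ψ * s ∈ colIdeal N t → s ∈ colIdeal M t) :
    IsDualityComplex (d + 1) (Sum.elim deg fun r => deg r + 1) (Sum.inl o) (Sum.inr t)
      (coneMatrix M N Φ) where
  toIsDifferential := hM.toIsDifferential.cone hN.toIsDifferential hΦ hdeg
  degree_eq_zero_iff := by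
    rintro (r | r)
    · simpa using hM.degree_eq_zero_iff r
    · simp
  degree_le := by
    rintro (r | r)
    · exact (hM.degree_le r).trans (Nat.le_succ d)
    · exact Nat.succ_le_succ (hN.degree_le r)
  degree_eq_top_iff := by
    rintro (r | r)
    · simpa using ((hM.degree_le r).trans_lt d.lt_succ_self).ne
    · simpa using hN.degree_eq_top_iff r
  rowExact := isRowExactAt_coneMatrix hΦ hM.rowExact hN.rowExact ho hφ
  colExact := isColExactAt_coneMatrix hΦ hM.colExact hN.colExact ht hψ

end IsDualityComplex

end ConeDuality

section Bihomogeneous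

variable {k A : Type*} [Field k] [Ring A] [Algebra k A] {T : kˣ × kˣ → (A →ₐ[k] A)}
  {S : AddSubmonoid (ℤ × ℤ)} {ι : Type*} {deg : ι → ℕ} {wt : ι → ℤ × ℤ}

/-- A matrix whose entries are homogeneous for the torus and which lowers the degree of the
generators by `e` and shifts their bidegree by `g`. -/
structure IsBihomogeneous (T : kˣ × kˣ → (A →ₐ[k] A)) (deg : ι → ℕ) (wt : ι → ℤ × ℤ) (e : ℕ)
    (g : ℤ × ℤ) (M : Matrix ι ι A) : Prop where
  degree_eq : ∀ r c, M r c ≠ 0 → deg r = deg c + e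
  mem_homog : ∀ r c, M r c ∈ homog T (wt r - wt c + g)

/-- The bihomogeneous part of a matrix, for a projection `π g` onto the elements of each
bidegree `g`. -/
def bihomogPart (π : ℤ × ℤ → A →+ A) (deg : ι → ℕ) (wt : ι → ℤ × ℤ) (e : ℕ) (g : ℤ × ℤ)
    (M : Matrix ι ι A) : Matrix ι ι A :=
  Matrix.of fun r c => if deg r = deg c + e then π (wt r - wt c + g) (M r c) else 0

variable {π : ℤ × ℤ → A →+ A} {e e' : ℕ} {g g' : ℤ × ℤ} {D M P : Matrix ι ι A}

lemma bihomogPart_sub : bihomogPart π deg wt e g (M - P) =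
    bihomogPart π deg wt e g M - bihomogPart π deg wt e g P := by
  ext r c
  simp only [bihomogPart, Matrix.of_apply, Matrix.sub_apply, map_sub]
  split_ifs
  · rfl
  · exact (sub_zero 0).symm

lemma isBihomogeneous_bihomogPart (hπ : ∀ g a, π g a ∈ homog T g) :
    IsBihomogeneous T deg wt e g (bihomogPart π deg wt e g M) where
  degree_eq r c hrc := by
    by_contra h
    exact hrc (if_neg h)
  mem_homog r c := by
    rw [bihomogPart, Matrix.of_apply]
    split_ifs
    · exact hπ _ _
    · exact Submodule.zero_mem _

lemma IsBihomogeneous.bihomogPart_eq (hπ : ∀ g, ∀ a ∈ homog T g, π g a = a)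
    (hP : IsBihomogeneous T deg wt e g P) : bihomogPart π deg wt e g P = P := by
  ext r c
  rw [bihomogPart, Matrix.of_apply]
  split_ifs with hrc
  · exact hπ _ _ (hP.mem_homog r c)
  · by_contra h
    exact hrc (hP.degree_eq r c (Ne.symm h))

lemma IsBihomogeneous.row_eq_zero [Infinite k] (hS : ⨆ g ∈ S, homog T g = ⊤) (hg : g ∉ S)
    {o : ι} (ho : ∀ r, deg r = deg o ↔ r = o) (hM : IsBihomogeneous T deg wt 0 g M) : M.row o = 0 :=
  funext fun c => by
    by_contra hoc
    obtain rfl := (ho c).1 (hM.degree_eq o c hoc).symm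
    exact hoc (eq_zero_of_mem_homog hS hg (by simpa using hM.mem_homog c c))

lemma IsBihomogeneous.col_eq_zero [Infinite k] (hS : ⨆ g ∈ S, homog T g = ⊤) (hg : g ∉ S)
    {o : ι} (ho : ∀ r, deg r = deg o ↔ r = o) (hM : IsBihomogeneous T deg wt 0 g M) : M.col o = 0 :=
  funext fun r => by
    by_contra hro
    obtain rfl := (ho r).1 (hM.degree_eq r o hro)
    exact hro (eq_zero_of_mem_homog hS hg (by simpa using hM.mem_homog r r))

variable [Fintype ι]

lemma IsBihomogeneous.bihomogPart_mul
    (hπ : ∀ g h a, ∀ r ∈ homog T h, π (g + h) (a * r) = π g a * r)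
    (hD : IsBihomogeneous T deg wt e' g' D) :
    bihomogPart π deg wt (e + e') (g + g') (M * D) = bihomogPart π deg wt e g M * D := by
  ext r c
  simp only [bihomogPart, Matrix.mul_apply, Matrix.of_apply]
  refine Eq.trans (b := ∑ j, if deg r = deg c + (e + e') then
    π (wt r - wt c + (g + g')) (M r j * D j c) else 0) (by split_ifs <;> simp)
    (Finset.sum_congr rfl fun j _ => ?_)
  by_cases hj : D j c = 0
  · simp [hj]
  have deg_j := hD.degree_eq j c hj
  have deg_iff : deg r = deg c + (e + e') ↔ deg r = deg j + e := by omega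
  have wt_eq : wt r - wt c + (g + g') = wt r - wt j + g + (wt j - wt c + g') := by abel
  rw [wt_eq, hπ _ _ _ _ (hD.mem_homog j c), ite_mul, zero_mul]
  exact if_congr deg_iff rfl rfl

lemma IsBihomogeneous.mul_bihomogPart
    (hπ : ∀ g h a, ∀ r ∈ homog T h, π (h + g) (r * a) = r * π g a)
    (hD : IsBihomogeneous T deg wt e' g' D) :
    bihomogPart π deg wt (e' + e) (g' + g) (D * M) = D * bihomogPart π deg wt e g M := by
  ext r c
  simp only [bihomogPart, Matrix.mul_apply, Matrix.of_apply]
  refine Eq.trans (b := ∑ j, if deg r = deg c + (e' + e) then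
    π (wt r - wt c + (g' + g)) (D r j * M j c) else 0) (by split_ifs <;> simp)
    (Finset.sum_congr rfl fun j _ => ?_)
  by_cases hj : D r j = 0
  · simp [hj]
  have deg_r := hD.degree_eq r j hj
  have deg_iff : deg r = deg c + (e' + e) ↔ deg j = deg c + e := by omega
  have wt_eq : wt r - wt c + (g' + g) = wt r - wt j + g' + (wt j - wt c + g) := by abel
  rw [wt_eq, hπ _ _ _ _ (hD.mem_homog r j), mul_ite, mul_zero]
  exact if_congr deg_iff rfl rfl

lemma exists_isBihomogeneous_homotopy [Infinite k] (hS : ⨆ g ∈ S, homog T g = ⊤)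
    {N γ : Matrix ι ι A} (hD : IsBihomogeneous T deg wt 1 0 D)
    (hN : IsBihomogeneous T deg wt 1 0 N) (hP : IsBihomogeneous T deg wt 1 g P)
    (hγ : γ * D = N * γ - P) :
    ∃ γ', IsBihomogeneous T deg wt 0 g γ' ∧ γ' * D = N * γ' - P := by
  obtain ⟨π, π_mem, π_of_mem, π_mul, mul_π⟩ := exists_projection hS
  refine ⟨bihomogPart π deg wt 0 g γ, isBihomogeneous_bihomogPart π_mem, ?_⟩
  calc bihomogPart π deg wt 0 g γ * D
      = bihomogPart π deg wt (0 + 1) (g + 0) (γ * D) := (hD.bihomogPart_mul π_mul).symm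
    _ = bihomogPart π deg wt (1 + 0) (0 + g) (N * γ) - bihomogPart π deg wt 1 g P := by
      rw [hγ, bihomogPart_sub]
      simp only [add_zero, zero_add]
    _ = N * bihomogPart π deg wt 0 g γ - P := by
      rw [hN.mul_bihomogPart mul_π, hP.bihomogPart_eq π_of_mem]

end Bihomogeneous

section TorusOre

variable {k : Type v} [Field k] {A B : Type u} [Ring A] [Ring B] [Algebra k A] [Algebra k B]

/-- The map `δ ⊗ 1` of the enveloping algebra. -/
noncomputable def leftDer (δ : B →ₗ[k] B) : Env k B →ₗ[k] Env k B :=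
  TensorProduct.map δ LinearMap.id

/-- The map `1 ⊗ δ` of the enveloping algebra. -/
noncomputable def rightDer (δ : B →ₗ[k] B) : Env k B →ₗ[k] Env k B :=
  TensorProduct.map LinearMap.id
    ((opLinearEquiv k).toLinearMap ∘ₗ δ ∘ₗ (opLinearEquiv k).symm.toLinearMap)

@[simp] lemma leftDer_tmul (δ : B →ₗ[k] B) (a : B) (b : Bᵐᵒᵖ) :
    leftDer δ (a ⊗ₜ b) = δ a ⊗ₜ b := rfl

@[simp] lemma rightDer_tmul (δ : B →ₗ[k] B) (a : B) (b : Bᵐᵒᵖ) :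
    rightDer δ (a ⊗ₜ b) = a ⊗ₜ op (δ (unop b)) := rfl

lemma mem_homog_of_torus_map {k V W : Type*} [Field k] [Ring V] [Ring W] [Algebra k V]
    [Algebra k W] {T : kˣ × kˣ → (V →ₐ[k] V)} {T' : kˣ × kˣ → (W →ₐ[k] W)} {φ : V →ₗ[k] W}
    {g h : ℤ × ℤ} (hφ : ∀ p r, T' p (φ r) = (weight g p : k) • φ (T p r)) {r : V}
    (hr : r ∈ homog T h) : φ r ∈ homog T' (h + g) := fun p => by
  rw [hφ, hr p, map_smul, smul_smul, weight_add, Units.val_mul, mul_comm]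

/-- An Ore extension equivariant for actions of the torus, whose twist is the action of an element
`u` of the torus and whose new generator is homogeneous of bidegree `g`. -/
structure IsTorusOre (TA : kˣ × kˣ → (A →ₐ[k] A)) (TB : kˣ × kˣ → (B →ₐ[k] B)) (f : B →ₐ[k] A)
    (x : A) (σ : B ≃ₐ[k] B) (δ : B →ₗ[k] B) (u : kˣ × kˣ) (g : ℤ × ℤ) : Prop
    extends IsOre f x σ δ where
  sigma_eq : ∀ b, σ b = TB u b
  torus_coe : ∀ p b, TA p (f b) = f (TB p b)
  mem_homog : x ∈ homog TA g

namespace IsTorusOre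

variable {TA : kˣ × kˣ → (A →ₐ[k] A)} {TB : kˣ × kˣ → (B →ₐ[k] B)} {f : B →ₐ[k] A} {x : A}
  {σ : B ≃ₐ[k] B} {δ : B →ₗ[k] B} {u : kˣ × kˣ} {g : ℤ × ℤ} (H : IsTorusOre TA TB f x σ δ u g)
  {S : AddSubmonoid (ℤ × ℤ)}

include H

lemma left_mul_envMap (r : Env k B) : (x ⊗ₜ 1) * envMap f r =
    envMap f (leftTwist σ r) * (x ⊗ₜ 1) + envMap f (leftDer δ r) := by
  induction r using TensorProduct.induction_on with
  | zero => simp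
  | add r s hr hs => simp only [map_add, mul_add, add_mul, hr, hs]; abel
  | tmul a b => simp [H.comm, TensorProduct.add_tmul]

lemma envMap_leftTwist_mul (r : Env k B) : envMap f (leftTwist σ r) * (1 ⊗ₜ op x) =
    (1 ⊗ₜ op x) * envMap f (torusEnv TB u r) + envMap f (rightDer δ (leftTwist σ r)) := by
  induction r using TensorProduct.induction_on with
  | zero => simp
  | add r s hr hs => simp only [map_add, mul_add, add_mul, hr, hs]; abel
  | tmul a b =>
    simp [← op_mul, H.comm, H.sigma_eq, TensorProduct.tmul_add]

lemma leftEval_leftDer_add (r : Env k B) : leftEval k B (leftDer δ r) +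
    leftEval k B (rightDer δ (leftTwist σ r)) = δ (leftEval k B r) := by
  induction r using TensorProduct.induction_on with
  | zero => simp
  | add r s hr hs => simp only [map_add, ← hr, ← hs]; abel
  | tmul a b => simp [H.leibniz, add_comm]

lemma torus_sigma (hS : ⨆ g ∈ S, homog TB g = ⊤) (p : kˣ × kˣ) (b : B) :
    TB p (σ b) = σ (TB p b) := by
  rw [H.sigma_eq, H.sigma_eq, torus_comm hS]

lemma torus_delta (hS : ⨆ g ∈ S, homog TB g = ⊤) (p : kˣ × kˣ) (b : B) :
    TB p (δ b) = (weight g p : k) • δ (TB p b) := by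
  apply H.injective
  have torus_comm_rel := congrArg (TA p) (H.comm b)
  rw [map_mul, map_add, map_mul, H.mem_homog p, H.torus_coe, H.torus_coe, H.torus_coe,
    H.torus_sigma hS, smul_mul_assoc, H.comm, smul_add, mul_smul_comm] at torus_comm_rel
  rw [map_smul]
  exact (add_left_cancel torus_comm_rel).symm

lemma leftTwist_mem_homog (hS : ⨆ g ∈ S, homog TB g = ⊤) {h : ℤ × ℤ} {r : Env k B}
    (hr : r ∈ homog (torusEnv TB) h) : leftTwist σ r ∈ homog (torusEnv TB) h := by
  rw [← add_zero h]
  refine mem_homog_of_torus_map (φ := (leftTwist σ).toLinearMap) (fun p r => ?_) hr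
  induction r using TensorProduct.induction_on with
  | zero => simp
  | add r s hr hs => simp only [map_add, smul_add, hr, hs]
  | tmul a b => simp [H.torus_sigma hS]

lemma leftDer_mem_homog (hS : ⨆ g ∈ S, homog TB g = ⊤) {h : ℤ × ℤ} {r : Env k B}
    (hr : r ∈ homog (torusEnv TB) h) : leftDer δ r ∈ homog (torusEnv TB) (h + g) := by
  refine mem_homog_of_torus_map (fun p r => ?_) hr
  induction r using TensorProduct.induction_on with
  | zero => simp
  | add r s hr hs => simp only [map_add, hr, hs, smul_add]
  | tmul a b => simp [H.torus_delta hS, TensorProduct.smul_tmul']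

lemma rightDer_mem_homog (hS : ⨆ g ∈ S, homog TB g = ⊤) {h : ℤ × ℤ} {r : Env k B}
    (hr : r ∈ homog (torusEnv TB) h) : rightDer δ r ∈ homog (torusEnv TB) (h + g) := by
  refine mem_homog_of_torus_map (fun p r => ?_) hr
  induction r using TensorProduct.induction_on with
  | zero => simp
  | add r s hr hs => simp only [map_add, hr, hs, smul_add]
  | tmul a b => simp [H.torus_delta hS]

lemma envMap_mem_homog {h : ℤ × ℤ} {r : Env k B} (hr : r ∈ homog (torusEnv TB) h) :
    envMap f r ∈ homog (torusEnv TA) h := by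
  rw [← add_zero h]
  refine mem_homog_of_torus_map (φ := (envMap f).toLinearMap) (fun p r => ?_) hr
  induction r using TensorProduct.induction_on with
  | zero => simp
  | add r s hr hs => simp only [map_add, smul_add, hr, hs]
  | tmul a b => simp [H.torus_coe]

end IsTorusOre

end TorusOre

section Connecting

variable {k : Type v} [Field k] {A B : Type u} [Ring A] [Ring B] [Algebra k A] [Algebra k B]
variable {ι : Type} [Fintype ι] [DecidableEq ι]

/-- A Calabi–Yau complex with differential of bidegree `0` for an action of the torus, whose bottom
and top generators have bidegrees `0` and `w`. -/
structure IsGradedCalabiYauComplex (T : kˣ × kˣ → (B →ₐ[k] B)) (ν : B →ₐ[k] B) (d : ℕ) (w : ℤ × ℤ)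
    (deg : ι → ℕ) (wt : ι → ℤ × ℤ) (o t : ι) (D : Matrix ι ι (Env k B)) : Prop
    extends IsCalabiYauComplex ν d deg o t D where
  mem_homog : ∀ r c, D r c ∈ homog (torusEnv T) (wt r - wt c)
  wt_bot : wt o = 0
  wt_top : wt t = w

/-- The failure of the diagonal matrix `x ⊗ 1 - θ • 1 ⊗ x` to commute with `D`, as a matrix over the
enveloping algebra of the coefficient algebra. -/
noncomputable def oreCocycle (σ : B ≃ₐ[k] B) (δ : B →ₗ[k] B) (u : kˣ × kˣ) (wt : ι → ℤ × ℤ)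
    (D : Matrix ι ι (Env k B)) : Matrix ι ι (Env k B) :=
  Matrix.of fun r c =>
    leftDer δ (D r c) + (weight (wt c) u : k) • rightDer δ (leftTwist σ (D r c))

/-- The diagonal matrix with entries `x ⊗ 1 - θ • 1 ⊗ x`, where `θ` is the scalar by which `u` acts
on the generator. -/
noncomputable def oreDiagonal (x : A) (u : kˣ × kˣ) (wt : ι → ℤ × ℤ) : Matrix ι ι (Env k A) :=
  Matrix.diagonal fun r => x ⊗ₜ 1 - (weight (wt r) u : k) • 1 ⊗ₜ op x

namespace IsTorusOre

variable {TA : kˣ × kˣ → (A →ₐ[k] A)} {TB : kˣ × kˣ → (B →ₐ[k] B)} {f : B →ₐ[k] A} {x : A}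
  {σ : B ≃ₐ[k] B} {δ : B →ₗ[k] B} {u : kˣ × kˣ} {g : ℤ × ℤ} (H : IsTorusOre TA TB f x σ δ u g)
  {S : AddSubmonoid (ℤ × ℤ)}
  {ν : B →ₐ[k] B} {d : ℕ} {w : ℤ × ℤ} {deg : ι → ℕ} {wt : ι → ℤ × ℤ} {o t : ι}
  {D : Matrix ι ι (Env k B)} (G : IsGradedCalabiYauComplex TB ν d w deg wt o t D)

include H G

lemma oreDiagonal_mul : oreDiagonal x u wt * D.map (envMap f) =
    (D.map (leftTwist σ)).map (envMap f) * oreDiagonal x u wt +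
      (oreCocycle σ δ u wt D).map (envMap f) := by
  ext r c
  rw [oreDiagonal, Matrix.diagonal_mul, Matrix.add_apply, Matrix.mul_diagonal]
  simp only [Matrix.map_apply, oreCocycle, Matrix.of_apply, sub_mul, mul_sub, smul_mul_assoc,
    mul_smul_comm, H.left_mul_envMap, H.envMap_leftTwist_mul, map_add, map_smul, smul_add]
  rw [G.mem_homog r c u, map_smul, mul_smul_comm, smul_smul, weight_sub, Units.val_mul,
    mul_left_comm, Units.mul_inv, mul_one]
  abel

lemma oreCocycle_mul :
    oreCocycle σ δ u wt D * D + D.map (leftTwist σ) * oreCocycle σ δ u wt D = 0 := by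
  apply Matrix.map_injective H.envMap_injective
  have envMap_sq : D.map (envMap f) * D.map (envMap f) = 0 :=
    (G.toIsDifferential.map (envMap f : Env k B →+* Env k A)).mul_self
  have leftTwist_sq : (D.map (leftTwist σ)).map (envMap f) * (D.map (leftTwist σ)).map (envMap f)
      = 0 :=
    ((G.toIsDifferential.map (leftTwist σ : Env k B →+* Env k B)).map
      (envMap f : Env k B →+* Env k A)).mul_self
  beta_reduce
  rw [Matrix.map_add _ (map_add _), Matrix.map_mul, Matrix.map_mul, Matrix.map_zero _ (map_zero _),
    ← sub_eq_of_eq_add' (H.oreDiagonal_mul G), sub_mul, mul_sub, mul_assoc, envMap_sq, mul_zero,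
    ← mul_assoc, ← mul_assoc, leftTwist_sq, zero_mul]
  abel

lemma isBihomogeneous_leftTwist (hS : ⨆ g ∈ S, homog TB g = ⊤) :
    IsBihomogeneous (torusEnv TB) deg wt 1 0 (D.map (leftTwist σ)) where
  degree_eq := (G.toIsDifferential.map (leftTwist σ : Env k B →+* Env k B)).degree_eq
  mem_homog r c := by
    rw [add_zero]
    exact H.leftTwist_mem_homog hS (G.mem_homog r c)

lemma isBihomogeneous_oreCocycle (hS : ⨆ g ∈ S, homog TB g = ⊤) :
    IsBihomogeneous (torusEnv TB) deg wt 1 g (oreCocycle σ δ u wt D) where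
  degree_eq r c hrc := G.degree_eq r c fun h => hrc (by simp [oreCocycle, h])
  mem_homog r c := Submodule.add_mem _ (H.leftDer_mem_homog hS (G.mem_homog r c))
    (Submodule.smul_mem _ _ (H.rightDer_mem_homog hS (H.leftTwist_mem_homog hS (G.mem_homog r c))))

lemma oreCocycle_mem_rowIdeal (r : ι) : oreCocycle σ δ u wt D r o ∈ rowIdeal D o := by
  rw [G.mem_rowIdeal_iff, oreCocycle, Matrix.of_apply, G.wt_bot, weight_zero, Units.val_one,
    one_smul, map_add, H.leftEval_leftDer_add, (G.mem_rowIdeal_iff _).1 (G.apply_mem_rowIdeal r),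
    map_zero]

theorem exists_connecting [Infinite k] (hS : ⨆ g ∈ S, homog TB g = ⊤) :
    ∃ γ, IsBihomogeneous (torusEnv TB) deg wt 0 g γ ∧
      (oreDiagonal x u wt + γ.map (envMap f)) * D.map (envMap f) =
        (D.map (leftTwist σ)).map (envMap f) * (oreDiagonal x u wt + γ.map (envMap f)) := by
  have hD : IsBihomogeneous (torusEnv TB) deg wt 1 0 D :=
    ⟨G.degree_eq, fun r c => by simpa using G.mem_homog r c⟩
  obtain ⟨γ₀, -, hγ₀⟩ := G.exists_homotopy
    (G.toIsDifferential.map (leftTwist σ : Env k B →+* Env k B)) (H.oreCocycle_mul G)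
    (H.oreCocycle_mem_rowIdeal G)
  obtain ⟨γ, γ_bihom, hγ⟩ := exists_isBihomogeneous_homotopy (iSup_homog_torusEnv hS) hD
    (H.isBihomogeneous_leftTwist G hS) (H.isBihomogeneous_oreCocycle G hS) hγ₀
  refine ⟨γ, γ_bihom, ?_⟩
  rw [add_mul, mul_add, H.oreDiagonal_mul G, ← Matrix.map_mul, hγ, Matrix.map_sub _ (map_sub _),
    Matrix.map_mul]
  abel

end IsTorusOre

end Connecting

section Ideals

variable {k : Type v} [CommRing k] {A B : Type u} [Ring A] [Ring B] [Algebra k A] [Algebra k B]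

lemma leftEval_mul_eq_zero (s : Env k A) {r : Env k A} (hr : leftEval k A r = 0) :
    leftEval k A (s * r) = 0 := by
  induction s using TensorProduct.induction_on with
  | zero => simp
  | add s t hs ht => rw [add_mul, map_add, hs, ht, add_zero]
  | tmul a b => rw [← op_unop b, tmul_mul_leftEval, hr, mul_zero, zero_mul]

lemma rightEval_mul_eq_zero {ν : A →ₐ[k] A} {r : Env k A} (hr : rightEval ν r = 0) (s : Env k A) :
    rightEval ν (r * s) = 0 := by
  induction s using TensorProduct.induction_on with
  | zero => simp
  | add s t hs ht => rw [mul_add, map_add, hs, ht, add_zero]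
  | tmul a b => rw [← op_unop b, rightEval_mul_tmul, hr, mul_zero, zero_mul]

/-- The elements of `A` acting alike from the left and from the right on the class of `1` in the
quotient of the enveloping algebra by a left ideal. -/
def leftCenter (J : Submodule (Env k A) (Env k A)) : Subalgebra k A where
  carrier := {a | (a ⊗ₜ 1 - 1 ⊗ₜ op a : Env k A) ∈ J}
  mul_mem' {a b} ha hb := by
    have h := J.add_mem (J.smul_mem (a ⊗ₜ 1) hb) (J.smul_mem (1 ⊗ₜ op b) ha)
    simpa [mul_sub] using h
  add_mem' {a b} ha hb := by
    have h := J.add_mem ha hb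
    simpa [TensorProduct.add_tmul, TensorProduct.tmul_add, sub_add_sub_comm] using h
  algebraMap_mem' c := by
    simp [Algebra.algebraMap_eq_smul_one, TensorProduct.smul_tmul]

lemma mem_of_leftEval_eq_zero {J : Submodule (Env k A) (Env k A)} (hJ : leftCenter J = ⊤)
    {s : Env k A} (hs : leftEval k A s = 0) : s ∈ J := by
  suffices s - 1 ⊗ₜ op (leftEval k A s) ∈ J by simpa [hs] using this
  clear hs
  induction s using TensorProduct.induction_on with
  | zero => simp
  | add s t hs ht =>
    rw [map_add, MulOpposite.op_add, TensorProduct.tmul_add, add_sub_add_comm]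
    exact J.add_mem hs ht
  | tmul a b =>
    have ha : a ∈ leftCenter J := hJ ▸ Algebra.mem_top
    have h := J.smul_mem (1 ⊗ₜ b) ha
    simpa [mul_sub] using h

/-- The elements `a` of `A` such that the left action of `a` and the right action of `ν a` agree on
the class of `1` in the quotient of the enveloping algebra by a right ideal. -/
def rightCenter (ν : A →ₐ[k] A) (K : Submodule (Env k A)ᵐᵒᵖ (Env k A)) : Subalgebra k A where
  carrier := {a | (a ⊗ₜ 1 - 1 ⊗ₜ op (ν a) : Env k A) ∈ K}
  mul_mem' {a b} ha hb := by
    have h := K.add_mem (K.smul_mem (op (b ⊗ₜ 1)) ha) (K.smul_mem (op (1 ⊗ₜ op (ν a))) hb)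
    simpa [sub_mul] using h
  add_mem' {a b} ha hb := by
    have h := K.add_mem ha hb
    simpa [TensorProduct.add_tmul, TensorProduct.tmul_add, sub_add_sub_comm] using h
  algebraMap_mem' c := by
    simp [Algebra.algebraMap_eq_smul_one, TensorProduct.smul_tmul]

lemma mem_of_rightEval_eq_zero {ν : A →ₐ[k] A} {K : Submodule (Env k A)ᵐᵒᵖ (Env k A)}
    (hK : rightCenter ν K = ⊤) {s : Env k A} (hs : rightEval ν s = 0) : s ∈ K := by
  suffices s - 1 ⊗ₜ op (rightEval ν s) ∈ K by simpa [hs] using this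
  clear hs
  induction s using TensorProduct.induction_on with
  | zero => simp
  | add s t hs ht =>
    rw [map_add, MulOpposite.op_add, TensorProduct.tmul_add, add_sub_add_comm]
    exact K.add_mem hs ht
  | tmul a b =>
    have ha : a ∈ rightCenter ν K := hK ▸ Algebra.mem_top
    have h := K.smul_mem (op (1 ⊗ₜ b)) ha
    simpa [sub_mul] using h

variable {ι : Type} [Fintype ι] [DecidableEq ι] {o t : ι}

lemma mem_rowIdeal_iff_leftEval_eq_zero {D : Matrix ι ι (Env k A)}
    (hD : ∀ r, leftEval k A (D r o) = 0) (hcenter : leftCenter (rowIdeal D o) = ⊤) (s : Env k A) :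
    s ∈ rowIdeal D o ↔ leftEval k A s = 0 := by
  refine ⟨fun hs => ?_, mem_of_leftEval_eq_zero hcenter⟩
  obtain ⟨v, hv⟩ := mem_rowIdeal.1 hs
  rw [← Pi.single_eq_same (M := fun _ => Env k A) o s, ← hv, Matrix.vecMul, dotProduct, map_sum]
  exact Finset.sum_eq_zero fun r _ => leftEval_mul_eq_zero _ (hD r)

lemma mem_colIdeal_iff_rightEval_eq_zero {D : Matrix ι ι (Env k A)} {ν : A →ₐ[k] A}
    (hD : ∀ c, rightEval ν (D t c) = 0) (hcenter : rightCenter ν (colIdeal D t) = ⊤)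
    (s : Env k A) : s ∈ colIdeal D t ↔ rightEval ν s = 0 := by
  refine ⟨fun hs => ?_, mem_of_rightEval_eq_zero hcenter⟩
  obtain ⟨v, hv⟩ := mem_colIdeal.1 hs
  rw [← Pi.single_eq_same (M := fun _ => Env k A) t s, ← hv, Matrix.mulVec, dotProduct, map_sum]
  exact Finset.sum_eq_zero fun c _ => rightEval_mul_eq_zero (hD c) _

lemma eq_zero_of_forall_eq_succ_mul {a : ℕ →₀ A} {y : A} (ha : ∀ i, a i = a (i + 1) * y) :
    a = 0 := by
  have eq_mul_pow (i m : ℕ) : a i = a (i + m) * y ^ m := by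
    induction m with
    | zero => simp
    | succ m ih => rw [ih, ha (i + m), mul_assoc, ← pow_succ', add_assoc]
  ext i
  rw [eq_mul_pow i (a.support.sup id + 1), Finsupp.notMem_support_iff.1 fun h =>
    absurd (Finset.le_sup (f := id) h) (by simp only [id]; omega), zero_mul, Finsupp.zero_apply]

namespace IsCalabiYauComplex

variable {ν : B →ₐ[k] B} {d : ℕ} {deg : ι → ℕ} {D : Matrix ι ι (Env k B)}

lemma leftEval_apply_bot (G : IsCalabiYauComplex ν d deg o t D) (r : ι) :
    leftEval k B (D r o) = 0 := (G.mem_rowIdeal_iff _).1 (G.apply_mem_rowIdeal r)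

lemma rightEval_apply_top (G : IsCalabiYauComplex ν d deg o t D) (c : ι) :
    rightEval ν (D t c) = 0 := (G.mem_colIdeal_iff _).1 (G.apply_mem_colIdeal c)

lemma envMap_mem_rowIdeal (G : IsCalabiYauComplex ν d deg o t D) (f : B →ₐ[k] A) (τ : B ≃ₐ[k] B)
    {j : Env k B} (hj : leftEval k B j = 0) :
    envMap f (leftTwist τ j) ∈ rowIdeal ((D.map (leftTwist τ)).map (envMap f)) o :=
  map_mem_rowIdeal (envMap f : Env k B →+* Env k A)
    (map_mem_rowIdeal (leftTwist τ : Env k B →+* Env k B) ((G.mem_rowIdeal_iff j).2 hj))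

lemma envMap_mem_colIdeal (G : IsCalabiYauComplex ν d deg o t D) (f : B →ₐ[k] A) (τ : B ≃ₐ[k] B)
    {j : Env k B} (hj : rightEval ν j = 0) :
    envMap f (leftTwist τ j) ∈ colIdeal ((D.map (leftTwist τ)).map (envMap f)) t :=
  map_mem_colIdeal (envMap f : Env k B →+* Env k A)
    (map_mem_colIdeal (leftTwist τ : Env k B →+* Env k B) ((G.mem_colIdeal_iff j).2 hj))

end IsCalabiYauComplex

namespace IsOre

variable {f : B →ₐ[k] A} {x : A} {σ : B ≃ₐ[k] B} {δ : B →ₗ[k] B} (H : IsOre f x σ δ)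
  {ν : B →ₐ[k] B} {d : ℕ} {deg : ι → ℕ} {D : Matrix ι ι (Env k B)}

include H

lemma mem_rowIdeal_iff (G : IsCalabiYauComplex ν d deg o t D) (τ : B ≃ₐ[k] B) (r : Env k A) :
    r ∈ rowIdeal ((D.map (leftTwist τ)).map (envMap f)) o ↔ H.leftCoef τ r = 0 := by
  refine ⟨fun hr => ?_, H.mem_of_leftCoef_eq_zero fun b => ?_⟩
  · obtain ⟨v, hv⟩ := mem_rowIdeal.1 hr
    rw [← Pi.single_eq_same (M := fun _ => Env k A) o r, ← hv, Matrix.vecMul, dotProduct, map_sum]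
    exact Finset.sum_eq_zero fun c _ => H.leftCoef_mul_envMap τ _ (G.leftEval_apply_bot c)
  · have mem_rowIdeal := G.envMap_mem_rowIdeal f τ (j := 1 ⊗ₜ op b - b ⊗ₜ 1) (by simp)
    simpa using mem_rowIdeal

lemma mem_colIdeal_iff (G : IsCalabiYauComplex ν d deg o t D) {τ : B ≃ₐ[k] B} {μ : B →ₐ[k] B}
    (hμ : ∀ b, μ (τ b) = ν b) (r : Env k A) :
    r ∈ colIdeal ((D.map (leftTwist τ)).map (envMap f)) t ↔ H.rightCoef μ r = 0 := by
  refine ⟨fun hr => ?_, H.mem_of_rightCoef_eq_zero hμ fun b => ?_⟩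
  · obtain ⟨v, hv⟩ := mem_colIdeal.1 hr
    rw [← Pi.single_eq_same (M := fun _ => Env k A) t r, ← hv, Matrix.mulVec, dotProduct, map_sum]
    exact Finset.sum_eq_zero fun c _ => H.rightCoef_envMap_mul hμ _ (G.rightEval_apply_top c)
  · have mem_colIdeal := G.envMap_mem_colIdeal f τ (j := b ⊗ₜ 1 - 1 ⊗ₜ op (ν b)) (by simp)
    simpa using mem_colIdeal

lemma mem_rowIdeal_of_mul_mem (G : IsCalabiYauComplex ν d deg o t D) (s : Env k A)
    (hs : s * (x ⊗ₜ 1 - 1 ⊗ₜ op x) ∈ rowIdeal (D.map (envMap f)) o) :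
    s ∈ rowIdeal ((D.map (leftTwist σ)).map (envMap f)) o := by
  have coef_eq_zero := H.mem_rowIdeal_iff G AlgEquiv.refl (s * (x ⊗ₜ 1 - 1 ⊗ₜ op x))
  rw [leftTwist_refl] at coef_eq_zero
  refine (H.mem_rowIdeal_iff G σ s).2 (eq_zero_of_forall_eq_succ_mul (y := x) fun i => ?_)
  have succ_mul := H.leftCoef_succ_mul s i
  rw [coef_eq_zero.1 hs] at succ_mul
  exact (sub_eq_zero.1 succ_mul.symm).symm

lemma mem_colIdeal_of_mul_mem (G : IsCalabiYauComplex ν d deg o t D) {μ : B →ₐ[k] B} {θ : k}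
    (hμ : ∀ b, μ (σ b) = ν b) (hσ : ∀ b, σ (μ b) = μ (σ b)) (hδ : ∀ b, μ (δ b) = θ • δ (μ b))
    (s : Env k A)
    (hs : (x ⊗ₜ 1 - θ • 1 ⊗ₜ op x) * s ∈ colIdeal ((D.map (leftTwist σ)).map (envMap f)) t) :
    s ∈ colIdeal (D.map (envMap f)) t := by
  have hμσ : μ.comp (σ : B →ₐ[k] B) = ν := AlgHom.ext hμ
  have mem_iff := H.mem_colIdeal_iff G (τ := AlgEquiv.refl) (μ := ν) (fun _ => rfl) s
  rw [leftTwist_refl] at mem_iff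
  refine mem_iff.2 (eq_zero_of_forall_eq_succ_mul (y := θ • x) fun i => ?_)
  have succ_mul := H.rightCoef_succ_mul hσ hδ s i
  rw [(H.mem_colIdeal_iff G hμ _).1 hs, hμσ] at succ_mul
  rw [sub_eq_zero.1 succ_mul.symm, mul_smul_comm]

end IsOre

end Ideals

section OreCone

variable {k : Type v} [CommRing k] {A B : Type u} [Ring A] [Ring B] [Algebra k A] [Algebra k B]

lemma leftEval_envMap (f : B →ₐ[k] A) (r : Env k B) :
    leftEval k A (envMap f r) = f (leftEval k B r) := by
  induction r using TensorProduct.induction_on with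
  | zero => simp
  | add r s hr hs => simp only [map_add, hr, hs]
  | tmul a b => simp

lemma rightEval_envMap {f : B →ₐ[k] A} {σ : B ≃ₐ[k] B} {ν : B →ₐ[k] B} {νA : A →ₐ[k] A}
    (hν : ∀ b, νA (f (σ b)) = f (ν b)) (r : Env k B) :
    rightEval νA (envMap f (leftTwist σ r)) = f (rightEval ν r) := by
  induction r using TensorProduct.induction_on with
  | zero => simp
  | add r s hr hs => simp only [map_add, hr, hs]
  | tmul a b => simp [hν]

namespace IsOre

variable {f : B →ₐ[k] A} {x : A} {σ : B ≃ₐ[k] B} {δ : B →ₗ[k] B} (H : IsOre f x σ δ)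
  {ν : B →ₐ[k] B} {νA : A →ₐ[k] A} {θ : k}

include H in
lemma map_symm_skewDerivation (hν : ∀ b, νA (f (σ b)) = f (ν b)) (hx : νA x = θ • x)
    (hσν : ∀ b, σ (ν b) = ν (σ b)) (b : B) : ν (σ.symm (δ b)) = θ • δ (ν (σ.symm b)) := by
  have νA_coe (b : B) : νA (f b) = f (ν (σ.symm b)) := by rw [← hν, σ.apply_symm_apply]
  apply H.injective
  have νA_comm := congrArg νA (H.comm b)
  rw [map_mul, map_add, map_mul, hx, νA_coe, νA_coe, νA_coe, smul_mul_assoc, H.comm, smul_add,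
    mul_smul_comm, hσν, σ.symm_apply_apply, σ.apply_symm_apply] at νA_comm
  rw [map_smul]
  exact (add_left_cancel νA_comm).symm

variable {ι : Type} [Fintype ι] [DecidableEq ι] {d : ℕ} {deg : ι → ℕ} {o t : ι}
  {D : Matrix ι ι (Env k B)} {Φ : Matrix ι ι (Env k A)}
  (G : IsCalabiYauComplex ν d deg o t D)

include H G

lemma leftCenter_rowIdeal_cone {N : Matrix ι ι (Env k A)}
    (hrow : Φ.row o = Pi.single o (x ⊗ₜ 1 - 1 ⊗ₜ op x)) (hN : N.row o = 0) :
    leftCenter (rowIdeal (coneMatrix (D.map (envMap f)) N Φ) (Sum.inl o)) = ⊤ := by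
  refine H.subalgebra_eq_top _ (fun b => mem_rowIdeal_coneMatrix ?_) (mem_rowIdeal.2
    ⟨Sum.elim 0 (Pi.single o 1), ?_⟩)
  · have mem_rowIdeal := map_mem_rowIdeal (envMap f : Env k B →+* Env k A)
      ((G.mem_rowIdeal_iff (b ⊗ₜ 1 - 1 ⊗ₜ op b)).2 (by simp))
    simpa using mem_rowIdeal
  · rw [elim_vecMul_coneMatrix, Matrix.single_one_vecMul, Matrix.single_one_vecMul, hrow, hN,
      Matrix.zero_vecMul, zero_add, neg_zero, Sum.elim_single_zero]

lemma rightCenter_colIdeal_cone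
    (hν : ∀ b, νA (f (σ b)) = f (ν b)) (hx : νA x = θ • x)
    (hcol : Φ.col t = Pi.single t (x ⊗ₜ 1 - θ • 1 ⊗ₜ op x)) {M : Matrix ι ι (Env k A)}
    (hM : M.col t = 0) : rightCenter νA (colIdeal
      (coneMatrix M ((D.map (leftTwist σ)).map (envMap f)) Φ) (Sum.inr t)) = ⊤ := by
  refine H.subalgebra_eq_top _ (fun b => mem_colIdeal_coneMatrix ?_) (mem_colIdeal.2
    ⟨Sum.elim (Pi.single t 1) 0, ?_⟩)
  · have mem_colIdeal := G.envMap_mem_colIdeal f σ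
      (j := σ.symm b ⊗ₜ 1 - 1 ⊗ₜ op (ν (σ.symm b))) (by simp)
    simpa [← hν] using mem_colIdeal
  · rw [coneMatrix_mulVec_elim, Matrix.mulVec_single_one, Matrix.mulVec_single_one, hcol, hM,
      Matrix.mulVec_zero, sub_zero, Sum.elim_zero_single, hx, MulOpposite.op_smul,
      TensorProduct.tmul_smul]

theorem isCalabiYauComplex_cone
    (hν : ∀ b, νA (f (σ b)) = f (ν b)) (hx : νA x = θ • x) (hσν : ∀ b, σ (ν b) = ν (σ b))
    (hΦ : Φ * D.map (envMap f) = (D.map (leftTwist σ)).map (envMap f) * Φ)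
    (hdeg : ∀ r c, Φ r c ≠ 0 → deg r = deg c)
    (hrow_bot : Φ.row o = Pi.single o (x ⊗ₜ 1 - 1 ⊗ₜ op x))
    (hcol_bot : Φ.col o = Pi.single o (x ⊗ₜ 1 - 1 ⊗ₜ op x))
    (hrow_top : Φ.row t = Pi.single t (x ⊗ₜ 1 - θ • 1 ⊗ₜ op x))
    (hcol_top : Φ.col t = Pi.single t (x ⊗ₜ 1 - θ • 1 ⊗ₜ op x)) :
    IsCalabiYauComplex νA (d + 1) (Sum.elim deg fun r => deg r + 1) (Sum.inl o) (Sum.inr t)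
      (coneMatrix (D.map (envMap f)) ((D.map (leftTwist σ)).map (envMap f)) Φ) where
  toIsDualityComplex :=
    (G.toIsDualityComplex.map H.envMap_rightFree H.envMap_leftFree).cone
      (G.toIsDualityComplex.map (H.envMap_rightFree.comp (leftTwist σ : Env k B ≃+* Env k B))
        (H.envMap_leftFree.comp (leftTwist σ : Env k B ≃+* Env k B)))
      hΦ hdeg hrow_bot hcol_top (H.mem_rowIdeal_of_mul_mem G)
      (H.mem_colIdeal_of_mul_mem G (μ := ν.comp (σ.symm : B →ₐ[k] B))
        (fun b => congrArg ν (σ.symm_apply_apply b)) (fun b => by simp [hσν])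
        (H.map_symm_skewDerivation hν hx hσν))
  mem_rowIdeal_iff := by
    refine mem_rowIdeal_iff_leftEval_eq_zero ?_ (H.leftCenter_rowIdeal_cone G hrow_bot ?_)
    · rintro (r | r)
      · exact (leftEval_envMap f _).trans (by rw [G.leftEval_apply_bot, map_zero])
      · refine (congrArg (leftEval k A) (congrFun hcol_bot r)).trans ?_
        rw [Pi.single_apply]
        split_ifs <;> simp
    · funext c
      simpa using congrArg (fun r => envMap f (leftTwist σ r)) (congrFun G.row_bot c)
  mem_colIdeal_iff := by
    refine mem_colIdeal_iff_rightEval_eq_zero ?_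
      (H.rightCenter_colIdeal_cone G hν hx hcol_top ?_)
    · rintro (c | c)
      · refine (congrArg (rightEval νA) (congrFun hrow_top c)).trans ?_
        rw [Pi.single_apply]
        split_ifs <;> simp [hx]
      · exact (map_neg _ _).trans (by
          rw [Matrix.map_apply, Matrix.map_apply, rightEval_envMap hν, G.rightEval_apply_top,
            map_zero, neg_zero])
    · funext r
      simpa using congrArg (envMap f) (congrFun G.col_top r)

end IsOre

end OreCone

section GradedStep

variable {k : Type v} [Field k] {A B : Type u} [Ring A] [Ring B] [Algebra k A] [Algebra k B]

lemma torus_mul {T : kˣ × kˣ → (B →ₐ[k] B)} {S : AddSubmonoid (ℤ × ℤ)}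
    (hS : ⨆ g ∈ S, homog T g = ⊤) (p q : kˣ × kˣ) (b : B) : T p (T q b) = T (p * q) b := by
  induction b using homog_induction hS with
  | zero => simp
  | add a b ha hb => simp only [map_add, ha, hb]
  | homogeneous g _ a ha =>
    rw [ha, map_smul, ha, ha, smul_smul]
    congr 1
    simp [weight, mul_zpow]
    ring

namespace IsTorusOre

variable {TA : kˣ × kˣ → (A →ₐ[k] A)} {TB : kˣ × kˣ → (B →ₐ[k] B)} {f : B →ₐ[k] A} {x : A}
  {σ : B ≃ₐ[k] B} {δ : B →ₗ[k] B} {u : kˣ × kˣ} {g : ℤ × ℤ}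

lemma generator_sub_mem_homog (H : IsTorusOre TA TB f x σ δ u g) (θ : k) :
    (x ⊗ₜ 1 - θ • 1 ⊗ₜ op x : Env k A) ∈ homog (torusEnv TA) g := by
  have left_mem := tmul_mem_homog H.mem_homog (one_mem_homog (T := TA))
  have right_mem := tmul_mem_homog (one_mem_homog (T := TA)) H.mem_homog
  rw [add_zero] at left_mem
  rw [zero_add] at right_mem
  exact Submodule.sub_mem _ left_mem (Submodule.smul_mem _ _ right_mem)

variable {ι : Type} [DecidableEq ι] {deg : ι → ℕ} {wt : ι → ℤ × ℤ} {γ : Matrix ι ι (Env k B)}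

lemma row_oreDiagonal_add_map {i : ι} (hγ : γ.row i = 0) :
    (oreDiagonal x u wt + γ.map (envMap f)).row i =
      Pi.single i (x ⊗ₜ 1 - (weight (wt i) u : k) • 1 ⊗ₜ op x) := funext fun c => by
  have γ_eq : γ i c = 0 := congrFun hγ c
  rw [Matrix.row_apply, Matrix.add_apply, Matrix.map_apply, γ_eq, map_zero, add_zero, oreDiagonal,
    Matrix.diagonal_apply, Pi.single_apply]
  simp only [eq_comm]

lemma col_oreDiagonal_add_map {i : ι} (hγ : γ.col i = 0) :
    (oreDiagonal x u wt + γ.map (envMap f)).col i =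
      Pi.single i (x ⊗ₜ 1 - (weight (wt i) u : k) • 1 ⊗ₜ op x) := funext fun r => by
  have γ_eq : γ r i = 0 := congrFun hγ r
  rw [Matrix.col_apply, Matrix.add_apply, Matrix.map_apply, γ_eq, map_zero, add_zero, oreDiagonal,
    Matrix.diagonal_apply, Pi.single_apply]
  split_ifs with hr
  · rw [hr]
  · rfl

variable (H : IsTorusOre TA TB f x σ δ u g)

include H

lemma isBihomogeneous_oreDiagonal_add_map (hγ : IsBihomogeneous (torusEnv TB) deg wt 0 g γ) :
    IsBihomogeneous (torusEnv TA) deg wt 0 g (oreDiagonal x u wt + γ.map (envMap f)) where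
  degree_eq r c hrc := by
    by_contra hdeg
    have hne : r ≠ c := fun h => hdeg (by rw [h, add_zero])
    have γ_eq : γ r c = 0 := by_contra fun h => hdeg (hγ.degree_eq r c h)
    simp [oreDiagonal, hne, γ_eq] at hrc
  mem_homog r c := by
    refine Submodule.add_mem _ ?_ (H.envMap_mem_homog (hγ.mem_homog r c))
    rw [oreDiagonal, Matrix.diagonal_apply]
    split_ifs with hrc
    · rw [hrc, sub_self, zero_add]
      exact H.generator_sub_mem_homog _
    · exact Submodule.zero_mem _

variable [Fintype ι] {S : AddSubmonoid (ℤ × ℤ)} {ν : B →ₐ[k] B} {d : ℕ} {w : ℤ × ℤ} {o t : ι}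
  {D : Matrix ι ι (Env k B)} (G : IsGradedCalabiYauComplex TB ν d w deg wt o t D)

include G

lemma coneMatrix_mem_homog (hS : ⨆ g ∈ S, homog TB g = ⊤) {Φ : Matrix ι ι (Env k A)}
    (hΦ : IsBihomogeneous (torusEnv TA) deg wt 0 g Φ) (r c : ι ⊕ ι) :
    coneMatrix (D.map (envMap f)) ((D.map (leftTwist σ)).map (envMap f)) Φ r c ∈
      homog (torusEnv TA)
        (Sum.elim wt (fun r => wt r + g) r - Sum.elim wt (fun r => wt r + g) c) := by
  rcases r with r | r <;> rcases c with c | c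
  · exact H.envMap_mem_homog (G.mem_homog r c)
  · exact Submodule.zero_mem _
  · exact add_sub_right_comm (wt r) g (wt c) ▸ hΦ.mem_homog r c
  · exact add_sub_add_right_eq_sub (wt r) (wt c) g ▸ Submodule.neg_mem _
      (H.envMap_mem_homog (H.leftTwist_mem_homog hS (G.mem_homog r c)))

theorem exists_isGradedCalabiYauComplex [Infinite k] (hS : ⨆ g ∈ S, homog TB g = ⊤) (hg : g ∉ S)
    {νA : A →ₐ[k] A} (hν : ∀ b, νA (f (σ b)) = f (ν b)) (hx : νA x = (weight w u : k) • x)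
    (hσν : ∀ b, σ (ν b) = ν (σ b)) :
    ∃ D', IsGradedCalabiYauComplex TA νA (d + 1) (w + g) (Sum.elim deg fun r => deg r + 1)
      (Sum.elim wt fun r => wt r + g) (Sum.inl o) (Sum.inr t) D' := by
  obtain ⟨γ, γ_bihom, hΦ⟩ := H.exists_connecting G hS
  have Φ_bihom := H.isBihomogeneous_oreDiagonal_add_map γ_bihom
  have hS' := iSup_homog_torusEnv hS
  have degree_eq_bot_iff (r : ι) : deg r = deg o ↔ r = o := by
    rw [G.degree_bot, G.degree_eq_zero_iff]
  have degree_eq_top_iff (r : ι) : deg r = deg t ↔ r = t := by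
    rw [G.degree_top, G.degree_eq_top_iff]
  have row_bot := row_oreDiagonal_add_map (f := f) (x := x) (u := u) (wt := wt)
    (γ_bihom.row_eq_zero hS' hg degree_eq_bot_iff)
  have col_bot := col_oreDiagonal_add_map (f := f) (x := x) (u := u) (wt := wt)
    (γ_bihom.col_eq_zero hS' hg degree_eq_bot_iff)
  have row_top := row_oreDiagonal_add_map (f := f) (x := x) (u := u) (wt := wt)
    (γ_bihom.row_eq_zero hS' hg degree_eq_top_iff)
  have col_top := col_oreDiagonal_add_map (f := f) (x := x) (u := u) (wt := wt)
    (γ_bihom.col_eq_zero hS' hg degree_eq_top_iff)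
  rw [G.wt_bot, weight_zero, Units.val_one, one_smul] at row_bot col_bot
  rw [G.wt_top] at row_top col_top
  exact ⟨_, H.toIsOre.isCalabiYauComplex_cone G.toIsCalabiYauComplex hν hx hσν hΦ
    Φ_bihom.degree_eq row_bot col_bot row_top col_top, H.coneMatrix_mem_homog G hS Φ_bihom,
    G.wt_bot, congrArg (· + g) G.wt_top⟩

end IsTorusOre

/-- The existence of a bigraded Calabi–Yau complex with top generator of degree `d` and
bidegree `w`. -/
def HasGradedCalabiYauComplex (T : kˣ × kˣ → (B →ₐ[k] B)) (ν : B →ₐ[k] B) (d : ℕ) (w : ℤ × ℤ) :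
    Prop :=
  ∃ (ι : Type) (_ : Fintype ι) (_ : DecidableEq ι) (deg : ι → ℕ) (wt : ι → ℤ × ℤ) (o t : ι)
    (D : Matrix ι ι (Env k B)), IsGradedCalabiYauComplex T ν d w deg wt o t D

theorem HasGradedCalabiYauComplex.step [Infinite k] {TA : kˣ × kˣ → (A →ₐ[k] A)}
    {TB : kˣ × kˣ → (B →ₐ[k] B)} {f : B →ₐ[k] A} {x : A} {σ : B ≃ₐ[k] B} {δ : B →ₗ[k] B}
    {u n : kˣ × kˣ} {g w : ℤ × ℤ} {d : ℕ} {S : AddSubmonoid (ℤ × ℤ)}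
    (G : HasGradedCalabiYauComplex TB (TB n) d w) (H : IsTorusOre TA TB f x σ δ u g)
    (hS : ⨆ g ∈ S, homog TB g = ⊤) (hg : g ∉ S) (hn : weight g (n * u⁻¹) = weight w u) :
    HasGradedCalabiYauComplex TA (TA (n * u⁻¹)) (d + 1) (w + g) := by
  obtain ⟨ι, _, _, deg, wt, o, t, D, G⟩ := G
  obtain ⟨D', G'⟩ := H.exists_isGradedCalabiYauComplex G hS hg (νA := TA (n * u⁻¹))
    (fun b => by rw [H.torus_coe, H.sigma_eq, torus_mul hS, inv_mul_cancel_right])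
    (by rw [H.mem_homog, hn]) (fun b => (H.torus_sigma hS n b).symm)
  exact ⟨ι ⊕ ι, inferInstance, inferInstance, _, _, _, _, D', G'⟩

lemma leftEval_self_eq_zero_iff {s : Env k k} : leftEval k k s = 0 ↔ s = 0 :=
  ⟨mem_of_leftEval_eq_zero (J := ⊥) (Subsingleton.elim _ _), fun h => by rw [h, map_zero]⟩

lemma rightEval_self_eq_zero_iff {s : Env k k} : rightEval (AlgHom.id k k) s = 0 ↔ s = 0 :=
  ⟨mem_of_rightEval_eq_zero (K := ⊥) (Subsingleton.elim _ _), fun h => by rw [h, map_zero]⟩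

lemma isCalabiYauComplex_zero :
    IsCalabiYauComplex (AlgHom.id k k) 0 (fun _ => 0) () () (0 : Matrix Unit Unit (Env k k)) where
  degree_eq _ _ h := absurd rfl h
  mul_self := by simp
  degree_eq_zero_iff := by simp
  degree_le := by simp
  degree_eq_top_iff := by simp
  rowExact v _ := ⟨0, v (), funext fun _ => by simp⟩
  colExact v _ := ⟨0, v (), funext fun _ => by simp⟩
  mem_rowIdeal_iff s := by
    rw [leftEval_self_eq_zero_iff, mem_rowIdeal]
    exact ⟨fun ⟨u, hu⟩ => by simpa using (congrFun hu ()).symm, fun h => ⟨0, by simp [h]⟩⟩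
  mem_colIdeal_iff s := by
    rw [rightEval_self_eq_zero_iff, mem_colIdeal]
    exact ⟨fun ⟨u, hu⟩ => by simpa using (congrFun hu ()).symm, fun h => ⟨0, by simp [h]⟩⟩

lemma hasGradedCalabiYauComplex_base :
    HasGradedCalabiYauComplex (fun _ => AlgHom.id k k) (AlgHom.id k k) 0 0 :=
  ⟨Unit, inferInstance, inferInstance, fun _ => 0, fun _ => 0, (), (), 0, isCalabiYauComplex_zero,
    fun _ _ => Submodule.zero_mem _, rfl, rfl⟩

end GradedStep

section OreExistence

variable {k : Type*} [CommRing k] {A B : Type*} [Ring A] [Ring B] [Algebra k A] [Algebra k B]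

lemma mul_map_eq_of_adjoin_eq_top {C : Type*} [Ring C] [Algebra k C] {σ : B →ₐ[k] B}
    {δ : B →ₗ[k] B} (hδ : ∀ b c, δ (b * c) = σ b * δ c + δ b * c) {s : Set B}
    (hs : Algebra.adjoin k s = ⊤) {φ : B →ₐ[k] C} {c : C}
    (hc : ∀ b ∈ s, c * φ b = φ (σ b) * c + φ (δ b)) (b : B) :
    c * φ b = φ (σ b) * c + φ (δ b) := by
  have hb : b ∈ Algebra.adjoin k s := hs ▸ Algebra.mem_top
  induction hb using Algebra.adjoin_induction with
  | mem b hb => exact hc b hb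
  | algebraMap r =>
    have δ_one : δ 1 = 0 := by simpa using hδ 1 1
    simp [Algebra.algebraMap_eq_smul_one, δ_one]
  | add a b _ _ ha hb => simp only [map_add, mul_add, add_mul, ha, hb]; abel
  | mul a b _ _ ha hb =>
    rw [map_mul, ← mul_assoc, ha, add_mul, mul_assoc, hb, hδ, map_add, map_mul, map_mul,
      map_mul, map_mul, mul_add, mul_assoc, add_assoc]

namespace IsOre

variable {C : Type*} [Ring C] [Algebra k C] {f : B →ₐ[k] A} {x : A} {σ : B ≃ₐ[k] B}
  {δ : B →ₗ[k] B} (H : IsOre f x σ δ)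

include H

/-- The linear map from an Ore extension to `C` which is `φ` on the coefficients and sends the
variable to `c`. -/
noncomputable def liftₗ (φ : B →ₐ[k] C) (c : C) : A →ₗ[k] C :=
  leftCombₗ φ (fun i : ℕ => c ^ i) ∘ₗ H.coef.toLinearMap

variable {φ : B →ₐ[k] C} {c : C}

@[simp] lemma liftₗ_mul_pow (b : B) (i : ℕ) : H.liftₗ φ c (f b * x ^ i) = φ b * c ^ i := by
  simp [liftₗ, leftCombₗ_single]

lemma liftₗ_coe_mul (b : B) (a : A) : H.liftₗ φ c (f b * a) = φ b * H.liftₗ φ c a := by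
  induction a using H.induction with
  | zero => simp
  | add a a' ha ha' => simp only [mul_add, map_add, ha, ha']
  | monomial d i => rw [← mul_assoc, ← map_mul, liftₗ_mul_pow, liftₗ_mul_pow, map_mul, mul_assoc]

lemma liftₗ_pow_mul (hc : ∀ b, c * φ b = φ (σ b) * c + φ (δ b)) (i : ℕ) (a : A) :
    H.liftₗ φ c (x ^ i * a) = c ^ i * H.liftₗ φ c a := by
  have mul_left (a : A) : H.liftₗ φ c (x * a) = c * H.liftₗ φ c a := by
    induction a using H.induction with
    | zero => simp
    | add a a' ha ha' => simp only [mul_add, map_add, ha, ha']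
    | monomial d i =>
      rw [H.comm_mul_pow, map_add, liftₗ_mul_pow, liftₗ_mul_pow, liftₗ_mul_pow, ← mul_assoc, hc,
        add_mul, mul_assoc, pow_succ']
  induction i with
  | zero => simp
  | succ i ih => rw [pow_succ', mul_assoc, mul_left, ih, pow_succ', mul_assoc]

theorem exists_lift {s : Set B} (hs : Algebra.adjoin k s = ⊤) (φ : B →ₐ[k] C) (c : C)
    (hc : ∀ b ∈ s, c * φ b = φ (σ b) * c + φ (δ b)) :
    ∃ ψ : A →ₐ[k] C, (∀ b, ψ (f b) = φ b) ∧ ψ x = c := by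
  have comm := mul_map_eq_of_adjoin_eq_top (σ := (σ : B →ₐ[k] B)) H.leibniz hs hc
  have liftₗ_one : H.liftₗ φ c 1 = 1 := by simpa using H.liftₗ_mul_pow (φ := φ) (c := c) 1 0
  refine ⟨AlgHom.ofLinearMap (H.liftₗ φ c) liftₗ_one fun a a' => ?_,
    fun b => by simpa using H.liftₗ_mul_pow (φ := φ) (c := c) b 0,
    by simpa using H.liftₗ_mul_pow (φ := φ) (c := c) 1 1⟩
  induction a using H.induction with
  | zero => simp
  | add a b ha hb => simp only [add_mul, map_add, ha, hb]
  | monomial b i =>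
    rw [mul_assoc, H.liftₗ_coe_mul, H.liftₗ_pow_mul comm, liftₗ_mul_pow, mul_assoc]

lemma adjoin_eq_top {s : Set B} (hs : Algebra.adjoin k s = ⊤) :
    Algebra.adjoin k (insert x (f '' s)) = ⊤ := by
  refine H.subalgebra_eq_top _ (fun b => ?_) (Algebra.subset_adjoin (Set.mem_insert _ _))
  have hb : f b ∈ (Algebra.adjoin k s).map f := ⟨b, by rw [hs]; trivial, rfl⟩
  rw [AlgHom.map_adjoin] at hb
  exact Algebra.adjoin_mono (Set.subset_insert _ _) hb

lemma comp_equiv (e : A ≃ₐ[k] C) : IsOre ((e : A →ₐ[k] C).comp f) (e x) σ δ where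
  comm b := by simpa using congrArg e (H.comm b)
  free := by
    have leftComb_comp : leftCombₗ ((e : A →ₐ[k] C).comp f) (fun i : ℕ => e x ^ i) =
        (e : A →ₐ[k] C).toLinearMap ∘ₗ leftCombₗ f (fun i : ℕ => x ^ i) :=
      Finsupp.lhom_ext fun i b => by simp [leftCombₗ_single]
    change Function.Bijective (leftCombₗ _ _)
    rw [leftComb_comp]
    exact e.bijective.comp H.bijective

end IsOre

lemma exists_isOre {k : Type v} {B : Type u} [CommRing k] [Ring B] [Algebra k B] {σ : B ≃ₐ[k] B}
    {δ : B →ₗ[k] B} (hδ : ∀ b c, δ (b * c) = σ b * δ c + δ b * c) :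
    ∃ (A : Type u) (_ : Ring A) (_ : Algebra k A) (f : B →ₐ[k] A) (x : A), IsOre f x σ δ := by
  let E : Subalgebra k (Module.End k (ℕ →₀ B)) := Algebra.adjoin k
    (insert (oreShift σ δ) (Set.range (Algebra.lsmul k k (ℕ →₀ B) : B →ₐ[k] _)))
  let _ : Ring E := @Subalgebra.toRing k (Module.End k (ℕ →₀ B)) _ _ _ E
  let f : B →ₐ[k] E := (Algebra.lsmul k k (ℕ →₀ B)).codRestrict E
    fun b => Algebra.subset_adjoin (Set.mem_insert_of_mem _ ⟨b, rfl⟩)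
  let x : E := ⟨oreShift σ δ, Algebra.subset_adjoin (Set.mem_insert _ _)⟩
  refine ⟨E, ‹_›, E.algebra, f, x, isOre_of_model hδ
    (fun b => Subtype.ext (oreShift_mul_lsmul hδ b)) ?_ E.val (fun _ => rfl) rfl⟩
  apply Subalgebra.map_injective (f := E.val) Subtype.val_injective
  rw [AlgHom.map_adjoin, Set.image_insert_eq, ← Set.range_comp, Algebra.map_top, E.range_val]
  rfl

lemma IsOre.exists_torus {k : Type v} {A B : Type u} [Field k] [Ring A] [Ring B] [Algebra k A]
    [Algebra k B] {T : kˣ × kˣ → (B →ₐ[k] B)} {S : AddSubmonoid (ℤ × ℤ)} {f : B →ₐ[k] A} {x : A}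
    {σ : B ≃ₐ[k] B} {δ : B →ₗ[k] B} (H : IsOre f x σ δ) (hS : ⨆ g ∈ S, homog T g = ⊤)
    {u : kˣ × kˣ} {g : ℤ × ℤ} (hσ : ∀ b, σ b = T u b) {s : Set B} (hs : Algebra.adjoin k s = ⊤)
    (hδ : ∀ b ∈ s, ∃ h, b ∈ homog T h ∧ δ b ∈ homog T (h + g)) :
    ∃ TA : kˣ × kˣ → (A →ₐ[k] A), IsTorusOre TA T f x σ δ u g := by
  have exists_lift (p : kˣ × kˣ) :
      ∃ ψ : A →ₐ[k] A, (∀ b, ψ (f b) = f (T p b)) ∧ ψ x = (weight g p : k) • x := by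
    refine H.exists_lift hs (f.comp (T p)) ((weight g p : k) • x) fun b hb => ?_
    obtain ⟨h, hb, hδb⟩ := hδ b hb
    simp only [AlgHom.comp_apply]
    rw [hδb p, hσ, torus_comm hS, ← hσ, hb, map_smul, map_smul, map_smul, map_smul,
      smul_mul_smul_comm, H.comm, smul_mul_smul_comm, smul_add, weight_add, Units.val_mul,
      mul_comm (weight g p : k)]
  choose TA torus_coe mem_homog using exists_lift
  exact ⟨TA, H, hσ, torus_coe, mem_homog⟩

end OreExistence

section Presentation

variable {k : Type u} [CommRing k] {A B : Type u} [Ring A] [Ring B] [Algebra k A] [Algebra k B]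
  {I : Type} {R : Set (FreeAlgebra k I)}

lemma map_freeAlgebra_lift (φ : A →ₐ[k] B) (v : I → A) (q : FreeAlgebra k I) :
    φ (FreeAlgebra.lift k v q) = FreeAlgebra.lift k (fun i => φ (v i)) q :=
  DFunLike.congr_fun (show φ.comp (FreeAlgebra.lift k v) = _ by ext; simp) q

/-- The elements `v` of an algebra satisfy the relations `r = 0` for `r` in `R`. -/
def Satisfies (R : Set (FreeAlgebra k I)) (v : I → A) : Prop :=
  ∀ r ∈ R, FreeAlgebra.lift k v r = 0

lemma Satisfies.map {v : I → A} (hv : Satisfies R v) (φ : A →ₐ[k] B) :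
    Satisfies R fun i => φ (v i) := fun r hr => by
  rw [← map_freeAlgebra_lift, hv r hr, map_zero]

/-- The algebra `A` is presented by the generators `z` and the relations `R`. -/
structure IsPresentedBy (R : Set (FreeAlgebra k I)) (z : I → A) : Prop where
  satisfies : Satisfies R z
  adjoin_eq_top : Algebra.adjoin k (Set.range z) = ⊤
  exists_lift : ∀ (C : Type u) [Ring C] [Algebra k C] (v : I → C), Satisfies R v →
    ∃ φ : A →ₐ[k] C, ∀ i, φ (z i) = v i

lemma IsPresentedBy.exists_equiv {z : I → A} {v : I → B} (P : IsPresentedBy R z)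
    (Q : IsPresentedBy R v) : ∃ e : A ≃ₐ[k] B, ∀ i, e (z i) = v i := by
  obtain ⟨φ, hφ⟩ := P.exists_lift B v Q.satisfies
  obtain ⟨ψ, hψ⟩ := Q.exists_lift A z P.satisfies
  have comp_eq_id : φ.comp ψ = AlgHom.id k B :=
    AlgHom.ext_of_adjoin_eq_top Q.adjoin_eq_top (by rintro _ ⟨i, rfl⟩; simp [hφ, hψ])
  have comp_eq_id' : ψ.comp φ = AlgHom.id k A :=
    AlgHom.ext_of_adjoin_eq_top P.adjoin_eq_top (by rintro _ ⟨i, rfl⟩; simp [hφ, hψ])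
  exact ⟨AlgEquiv.ofAlgHom φ ψ comp_eq_id comp_eq_id', hφ⟩

lemma isPresentedBy_ringQuot {r : FreeAlgebra k I → FreeAlgebra k I → Prop}
    (hr : ∀ a b, r a b → b = 0) :
    IsPresentedBy {a | r a 0} fun i => RingQuot.mkAlgHom k r (FreeAlgebra.ι k i) where
  satisfies a ha := by
    have lift_ι : FreeAlgebra.lift k (FreeAlgebra.ι k) = AlgHom.id k (FreeAlgebra k I) := by
      ext; simp
    rw [← map_freeAlgebra_lift, lift_ι, AlgHom.id_apply, RingQuot.mkAlgHom_rel k ha, map_zero]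
  adjoin_eq_top := by
    rw [Set.range_comp' (RingQuot.mkAlgHom k r), ← AlgHom.map_adjoin,
      FreeAlgebra.adjoin_range_ι, Algebra.map_top, AlgHom.range_eq_top]
    exact RingQuot.mkAlgHom_surjective k r
  exists_lift C _ _ v hv := by
    refine ⟨RingQuot.liftAlgHom k ⟨FreeAlgebra.lift k v, fun a b hab => ?_⟩, fun i => ?_⟩
    · obtain rfl := hr a b hab
      rw [hv a hab, map_zero]
    · rw [RingQuot.liftAlgHom_mkAlgHom_apply, FreeAlgebra.lift_ι_apply]

lemma exists_isPresentedBy (R : Set (FreeAlgebra k I)) :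
    ∃ (A : Type u) (_ : Ring A) (_ : Algebra k A) (z : I → A), IsPresentedBy R z :=
  ⟨_, _, _, _, by
    simpa using isPresentedBy_ringQuot (r := fun a b => a ∈ R ∧ b = 0) (fun _ _ h => h.2)⟩

variable {m : ℕ} {R : Set (FreeAlgebra k (Fin m))} {χ : Fin m → k}
  {q : Fin m → FreeAlgebra k (Fin m)}

/-- The relations `R` between the last `m` generators together with the relations
`z₀ zᵢ = χᵢ zᵢ z₀ + qᵢ` for an additional first generator `z₀`, which present an Ore extension. -/
def oreRelations (R : Set (FreeAlgebra k (Fin m))) (χ : Fin m → k)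
    (q : Fin m → FreeAlgebra k (Fin m)) : Set (FreeAlgebra k (Fin (m + 1))) :=
  let z := FreeAlgebra.ι k (X := Fin (m + 1))
  FreeAlgebra.lift k (Fin.tail z) '' R ∪ Set.range fun i =>
    z 0 * z i.succ - (χ i • (z i.succ * z 0) + FreeAlgebra.lift k (Fin.tail z) (q i))

lemma satisfies_oreRelations {v : Fin (m + 1) → A} :
    Satisfies (oreRelations R χ q) v ↔ Satisfies R (Fin.tail v) ∧
      ∀ i, v 0 * v i.succ = χ i • (v i.succ * v 0) + FreeAlgebra.lift k (Fin.tail v) (q i) := by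
  have lift_tail (p : FreeAlgebra k (Fin m)) : FreeAlgebra.lift k v
      (FreeAlgebra.lift k (Fin.tail (FreeAlgebra.ι k)) p) = FreeAlgebra.lift k (Fin.tail v) p := by
    rw [map_freeAlgebra_lift]
    simp only [Fin.tail, FreeAlgebra.lift_ι_apply]
    rfl
  simp only [Satisfies, oreRelations, Set.union_def, Set.mem_ofPred_eq, or_imp, forall_and,
    Set.forall_mem_image, Set.forall_mem_range, lift_tail, map_sub, map_add, map_mul, map_smul,
    FreeAlgebra.lift_ι_apply, sub_eq_zero]

theorem IsOre.isPresentedBy {f : B →ₐ[k] A} {x : A} {σ : B ≃ₐ[k] B} {δ : B →ₗ[k] B}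
    (H : IsOre f x σ δ) {z : Fin m → B} (P : IsPresentedBy R z) (hσ : ∀ i, σ (z i) = χ i • z i)
    (hδ : ∀ i, δ (z i) = FreeAlgebra.lift k z (q i)) :
    IsPresentedBy (oreRelations R χ q) (Fin.cons x fun i => f (z i) : Fin (m + 1) → A) where
  satisfies := satisfies_oreRelations.2 ⟨P.satisfies.map f, fun i => by
    rw [Fin.cons_zero, Fin.cons_succ, H.comm, hσ, hδ, map_smul, smul_mul_assoc,
      map_freeAlgebra_lift, Fin.tail_cons]⟩
  adjoin_eq_top := by
    rw [Fin.range_cons, Set.range_comp' f z]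
    exact H.adjoin_eq_top P.adjoin_eq_top
  exists_lift C _ _ v hv := by
    obtain ⟨tail_satisfies, comm⟩ := satisfies_oreRelations.1 hv
    obtain ⟨φ, hφ⟩ := P.exists_lift C _ tail_satisfies
    obtain ⟨ψ, hψ, hψx⟩ := H.exists_lift P.adjoin_eq_top φ (v 0) (by
      rintro _ ⟨i, rfl⟩
      rw [hσ, hδ, map_smul, map_freeAlgebra_lift, funext hφ, hφ, smul_mul_assoc]
      exact comm i)
    exact ⟨ψ, Fin.cases hψx fun i => (hψ (z i)).trans (hφ i)⟩

/-- Upper triangular matrices of size two. -/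
def upper (a b d : A) : Matrix (Fin 2) (Fin 2) A := !![a, b; 0, d]

lemma IsPresentedBy.exists_isOre {z : Fin m → B} (P : IsPresentedBy R z) {σ : B ≃ₐ[k] B}
    (hσ : ∀ i, σ (z i) = χ i • z i)
    (hθ : Satisfies R fun i => upper (χ i • z i) (FreeAlgebra.lift k z (q i)) (z i)) :
    ∃ (A : Type u) (_ : Ring A) (_ : Algebra k A) (f : B →ₐ[k] A) (x : A) (δ : B →ₗ[k] B),
      IsOre f x σ δ ∧ ∀ i, δ (z i) = FreeAlgebra.lift k z (q i) := by
  obtain ⟨θ, hθ⟩ := P.exists_lift _ _ hθ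
  obtain ⟨δ, hδ, leibniz⟩ := exists_skewDerivation σ _ P.adjoin_eq_top θ
    (by rintro _ ⟨i, rfl⟩; simp [hθ, hσ, upper])
  obtain ⟨A, _, _, f, x, H⟩ := TwistedCY.exists_isOre leibniz
  exact ⟨A, _, _, f, x, δ, H, fun i => by simp [hδ, hθ, upper]⟩

theorem IsPresentedBy.exists_isOre_of_oreRelations {z : Fin m → B} (P : IsPresentedBy R z)
    {v : Fin (m + 1) → A} (Q : IsPresentedBy (oreRelations R χ q) v) {σ : B ≃ₐ[k] B}
    (hσ : ∀ i, σ (z i) = χ i • z i)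
    (hθ : Satisfies R fun i => upper (χ i • z i) (FreeAlgebra.lift k z (q i)) (z i)) :
    ∃ (f : B →ₐ[k] A) (δ : B →ₗ[k] B), IsOre f (v 0) σ δ ∧
      (∀ i, δ (z i) = FreeAlgebra.lift k z (q i)) ∧ ∀ i, f (z i) = v i.succ := by
  obtain ⟨A', _, _, f, x, δ, H, hδ⟩ := P.exists_isOre hσ hθ
  obtain ⟨e, he⟩ := (H.isPresentedBy P hσ hδ).exists_equiv Q
  have e_x : e x = v 0 := he 0
  exact ⟨(e : A' →ₐ[k] A).comp f, δ, e_x ▸ H.comp_equiv e, hδ, fun i => he i.succ⟩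

end Presentation

section GradedPresentation

variable {k : Type u} [Field k] {A B : Type u} [Ring A] [Ring B] [Algebra k A] [Algebra k B]
  {m : ℕ} {R : Set (FreeAlgebra k (Fin m))}

/-- An algebra presented by generators `z` and relations `R`, with an action `T` of the torus for
which the generators are homogeneous of bidegrees in `S`, and with a bigraded Calabi–Yau complex of
length `d` whose twist is the action of the element `n` of the torus. -/
structure IsPresentedCalabiYau (R : Set (FreeAlgebra k (Fin m))) (deg : Fin m → ℤ × ℤ)
    (S : AddSubmonoid (ℤ × ℤ)) (T : kˣ × kˣ → (B →ₐ[k] B)) (n : kˣ × kˣ) (w : ℤ × ℤ) (d : ℕ)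
    (z : Fin m → B) : Prop extends IsPresentedBy R z where
  mem_homog : ∀ i, z i ∈ homog T (deg i)
  deg_mem : ∀ i, deg i ∈ S
  complex : HasGradedCalabiYauComplex T (T n) d w

namespace IsPresentedCalabiYau

variable {deg : Fin m → ℤ × ℤ} {S : AddSubmonoid (ℤ × ℤ)} {T : kˣ × kˣ → (B →ₐ[k] B)}
  {n : kˣ × kˣ} {w : ℤ × ℤ} {d : ℕ} {z : Fin m → B} (G : IsPresentedCalabiYau R deg S T n w d z)

include G

lemma iSup_homog_eq_top : ⨆ g ∈ S, homog T g = ⊤ :=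
  iSup_homog_eq_top_of_adjoin G.adjoin_eq_top
    (by rintro _ ⟨i, rfl⟩; exact ⟨_, G.deg_mem i, G.mem_homog i⟩)

theorem step [Infinite k] {χ : Fin m → k} {q : Fin m → FreeAlgebra k (Fin m)}
    {v : Fin (m + 1) → A} (Q : IsPresentedBy (oreRelations R χ q) v)
    (hθ : Satisfies R fun i => upper (χ i • z i) (FreeAlgebra.lift k z (q i)) (z i))
    {u n' : kˣ × kˣ} (hχ : ∀ i, (weight (deg i) u : k) = χ i) {g w' : ℤ × ℤ} (hg : g ∉ S)
    (hq : ∀ i, FreeAlgebra.lift k z (q i) ∈ homog T (deg i + g)) {S' : AddSubmonoid (ℤ × ℤ)}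
    (hS : ∀ i, deg i ∈ S') (hgS : g ∈ S') (hn : n' * u = n) (hw : w + g = w')
    (hweight : weight g n' = weight w u) :
    ∃ TA, IsPresentedCalabiYau (oreRelations R χ q) (Fin.cons g deg) S' TA n' w' (d + 1) v := by
  obtain rfl := eq_mul_inv_of_mul_eq hn
  subst hw
  have hσ (i : Fin m) : torusEquiv G.iSup_homog_eq_top u (z i) = χ i • z i :=
    (G.mem_homog i u).trans (by rw [hχ])
  obtain ⟨f, δ, H, hδ, hf⟩ := G.exists_isOre_of_oreRelations Q hσ hθ
  obtain ⟨TA, HT⟩ := H.exists_torus G.iSup_homog_eq_top (fun _ => rfl) G.adjoin_eq_top (g := g)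
    (by rintro _ ⟨i, rfl⟩; exact ⟨_, G.mem_homog i, by rw [hδ]; exact hq i⟩)
  refine ⟨TA, Q, Fin.cases HT.mem_homog fun i p => ?_, Fin.cases hgS hS,
    G.complex.step HT G.iSup_homog_eq_top hg hweight⟩
  rw [Fin.cons_succ, ← hf, HT.torus_coe, G.mem_homog i, map_smul]

end IsPresentedCalabiYau

lemma isPresentedCalabiYau_base :
    IsPresentedCalabiYau (∅ : Set (FreeAlgebra k (Fin 0))) ![] ⊥ (fun _ => AlgHom.id k k) 1 0 0
      ![] where
  satisfies _ hr := hr.elim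
  adjoin_eq_top := eq_top_iff.2 fun a _ => Subalgebra.algebraMap_mem _ a
  exists_lift C _ _ _ _ := ⟨Algebra.ofId k C, fun i => i.elim0⟩
  mem_homog i := i.elim0
  deg_mem i := i.elim0
  complex := hasGradedCalabiYauComplex_base

end GradedPresentation

section Tower

variable {k : Type u} [Field k]

/-- The relations of the polynomial algebra on `y`. -/
def relY (k : Type u) [Field k] : Set (FreeAlgebra k (Fin 1)) := oreRelations ∅ ![] ![]

/-- The relations on `c, y` of the quantum plane with parameter `t / h`. -/
def relCY (t h : kˣ) : Set (FreeAlgebra k (Fin 2)) := oreRelations (relY k) ![(t / h : k)] ![0]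

/-- The relations on `a, c, y` which extend `relCY` by the commutation relations of `a`. -/
def relACY (t h : kˣ) : Set (FreeAlgebra k (Fin 3)) :=
  oreRelations (relCY t h) ![(t / h : k), -t] ![0, FreeAlgebra.ι k 0]

/-- The relations on `b, a, c, y` which extend `relACY` by the commutation relations of `b`. -/
def relBACY (t h : kˣ) (r : k) : Set (FreeAlgebra k (Fin 4)) :=
  oreRelations (relACY t h) ![(t / h : k), -t ^ 3, -t ^ 2 * h]
    ![0, -(r * (t / h + t)) • FreeAlgebra.ι k 0 ^ 3, -r • FreeAlgebra.ι k 0 ^ 2]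

/-- The relations on `x, b, a, c, y` which extend `relBACY` by the commutation relations of `x`. -/
def relXBACY (t h : kˣ) (r : k) : Set (FreeAlgebra k (Fin 5)) :=
  oreRelations (relBACY t h r) ![(t / h : k), -t, -t ^ 2 * h, t * h]
    ![0, FreeAlgebra.ι k 0, -r • FreeAlgebra.ι k 1 ^ 2, FreeAlgebra.ι k 1]

section Relations

variable {t h : kˣ} {r : k} {A : Type u} [Ring A] [Algebra k A]

lemma satisfies_relCY {v : Fin 2 → A} :
    Satisfies (relCY t h) v ↔ v 0 * v 1 = (t / h : k) • (v 1 * v 0) := by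
  rw [relCY, satisfies_oreRelations, relY, satisfies_oreRelations]
  simp [Satisfies, Fin.forall_fin_succ, Fin.tail]

lemma satisfies_relACY {v : Fin 3 → A} :
    Satisfies (relACY t h) v ↔ v 1 * v 2 = (t / h : k) • (v 2 * v 1) ∧
      v 0 * v 1 = (t / h : k) • (v 1 * v 0) ∧ v 0 * v 2 = (-t : k) • (v 2 * v 0) + v 1 := by
  rw [relACY, satisfies_oreRelations, satisfies_relCY]
  simp [Fin.forall_fin_succ, Fin.tail]

lemma satisfies_relBACY {v : Fin 4 → A} :
    Satisfies (relBACY t h r) v ↔ Satisfies (relACY t h) (Fin.tail v) ∧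
      v 0 * v 1 = (t / h : k) • (v 1 * v 0) ∧
      v 0 * v 2 = (-t ^ 3 : k) • (v 2 * v 0) + (-(r * (t / h + t))) • v 1 ^ 3 ∧
      v 0 * v 3 = (-t ^ 2 * h : k) • (v 3 * v 0) + (-r) • v 1 ^ 2 := by
  rw [relBACY, satisfies_oreRelations]
  simp [Fin.forall_fin_succ, Fin.tail]

lemma satisfies_relXBACY {v : Fin 5 → A} :
    Satisfies (relXBACY t h r) v ↔ Satisfies (relBACY t h r) (Fin.tail v) ∧
      v 0 * v 1 = (t / h : k) • (v 1 * v 0) ∧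
      v 0 * v 2 = (-t : k) • (v 2 * v 0) + v 1 ∧
      v 0 * v 3 = (-t ^ 2 * h : k) • (v 3 * v 0) + (-r) • v 2 ^ 2 ∧
      v 0 * v 4 = (t * h : k) • (v 4 * v 0) + v 2 := by
  rw [relXBACY, satisfies_oreRelations]
  simp [Fin.forall_fin_succ, Fin.tail]

end Relations

section Upper

variable {A : Type*} [Ring A] {p q s p' q' s' : A}

lemma upper_mul : upper p q s * upper p' q' s' = upper (p * p') (p * q' + q * s') (s * s') := by
  simp [upper]

lemma upper_add : upper p q s + upper p' q' s' = upper (p + p') (q + q') (s + s') := by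
  simp [upper]

lemma smul_upper {k : Type*} [SMulZeroClass k A] (c : k) :
    c • upper p q s = upper (c • p) (c • q) (c • s) := by
  simp [upper]

lemma upper_sq : upper p q s ^ 2 = upper (p ^ 2) (p * q + q * s) (s ^ 2) := by
  rw [pow_two, upper_mul, pow_two, pow_two]

lemma upper_cube :
    upper p q s ^ 3 = upper (p ^ 3) (p ^ 2 * q + (p * q + q * s) * s) (s ^ 3) := by
  rw [pow_succ, upper_sq, upper_mul, ← pow_succ, ← pow_succ]

lemma upper_inj : upper p q s = upper p' q' s' ↔ p = p' ∧ q = q' ∧ s = s' := by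
  simp [upper, and_assoc]

end Upper

section Corners

variable {t h : kˣ} {r : k} {A : Type u} [Ring A] [Algebra k A]

lemma mul_mul_of_eq {a b c : A} (h : a * b = c) (d : A) : a * (b * d) = c * d := by
  rw [← h, mul_assoc]

lemma satisfies_relCY_upper {v : Fin 2 → A} (hv : Satisfies (relCY t h) v) :
    Satisfies (relCY t h) fun i => upper (![(t / h : k), -t] i • v i)
      (FreeAlgebra.lift k v (![0, FreeAlgebra.ι k 0] i)) (v i) := by
  rw [satisfies_relCY] at hv ⊢
  simp [upper_mul, smul_upper, hv, smul_smul, mul_comm, mul_left_comm]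

lemma satisfies_relACY_upper {v : Fin 3 → A} (hv : Satisfies (relACY t h) v) (r : k) :
    Satisfies (relACY t h) fun i => upper (![(t / h : k), -t ^ 3, -t ^ 2 * h] i • v i)
      (FreeAlgebra.lift k v (![0, -(r * (t / h + t)) • FreeAlgebra.ι k 0 ^ 3,
        -r • FreeAlgebra.ι k 0 ^ 2] i)) (v i) := by
  obtain ⟨cy, ac, ay⟩ := satisfies_relACY.1 hv
  rw [satisfies_relACY]
  simp only [upper_mul, smul_upper, upper_add, upper_inj, Matrix.cons_val, map_zero, map_smul,
    map_pow, FreeAlgebra.lift_ι_apply]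
  refine ⟨⟨?_, ?_, cy⟩, ⟨?_, ?_, ac⟩, ?_, ?_, ay⟩
  all_goals
    simp only [mul_add, add_mul, smul_mul_assoc, mul_smul_comm, mul_assoc, pow_succ, pow_zero,
      one_mul, smul_add, smul_smul, cy, ac, mul_mul_of_eq ac, ay, mul_mul_of_eq ay, mul_zero,
      zero_mul]
    match_scalars <;> field_simp <;> ring

lemma satisfies_relBACY_upper (hr : r * (h * (h - 1)) = t * (h ^ 3 + 1)) {v : Fin 4 → A}
    (hv : Satisfies (relBACY t h r) v) :
    Satisfies (relBACY t h r) fun i => upper (![(t / h : k), -t, -t ^ 2 * h, t * h] i • v i)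
      (FreeAlgebra.lift k v (![0, FreeAlgebra.ι k 0, -r • FreeAlgebra.ι k 1 ^ 2,
        FreeAlgebra.ι k 1] i)) (v i) := by
  obtain ⟨hv, ba, bc, b_y⟩ := satisfies_relBACY.1 hv
  obtain ⟨cy, ac, ay⟩ := satisfies_relACY.1 hv
  rw [satisfies_relBACY, satisfies_relACY]
  simp only [Fin.tail, Fin.succ_zero_eq_one, Fin.succ_one_eq_two, Fin.reduceSucc, upper_mul,
    upper_sq, upper_cube, smul_upper, upper_add, upper_inj, Matrix.cons_val, map_zero, map_smul,
    map_pow, FreeAlgebra.lift_ι_apply] at cy ac ay ⊢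
  refine ⟨⟨⟨?_, ?_, cy⟩, ⟨?_, ?_, ac⟩, ?_, ?_, ay⟩, ⟨?_, ?_, ba⟩, ⟨?_, ?_, bc⟩, ?_, ?_, b_y⟩
  all_goals
    simp only [mul_add, add_mul, smul_mul_assoc, mul_smul_comm, mul_assoc, pow_succ, pow_zero,
      one_mul, smul_add, smul_smul, cy, ac, ay, mul_mul_of_eq ay, ba, mul_mul_of_eq ba, bc, b_y,
      mul_zero, zero_mul]
    match_scalars <;> field_simp
  all_goals first | ring1 | linear_combination hr | linear_combination -hr

end Corners

section Torus

variable {A : Type u} [Ring A] [Algebra k A]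

/-- The bidegrees on which the linear form with coefficients `a` and `b` is nonnegative. -/
def halfPlane (a b : ℤ) : AddSubmonoid (ℤ × ℤ) where
  carrier := {g | 0 ≤ a * g.1 + b * g.2}
  add_mem' {g h} hg hh := by
    simp only [Set.mem_ofPred_eq, Prod.fst_add, Prod.snd_add] at *
    linarith
  zero_mem' := by simp

@[simp] lemma mem_halfPlane {a b : ℤ} {g : ℤ × ℤ} : g ∈ halfPlane a b ↔ 0 ≤ a * g.1 + b * g.2 :=
  Iff.rfl

lemma pow_mem_homog {T : kˣ × kˣ → (A →ₐ[k] A)} {g : ℤ × ℤ} {a : A} (ha : a ∈ homog T g) (n : ℕ) :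
    a ^ n ∈ homog T (n • g) := by
  induction n with
  | zero => simpa using one_mem_homog
  | succ n ih => rw [pow_succ, succ_nsmul]; exact mul_mem_homog ih ha

variable [Infinite k]

lemma exists_isPresentedCalabiYau_relY {v : Fin 1 → A} (Q : IsPresentedBy (relY k) v) :
    ∃ T, IsPresentedCalabiYau (relY k) ![(0, 1)] (halfPlane (-1) 0) T 1 (0, 1) 1 v :=
  isPresentedCalabiYau_base.step Q (u := 1) (fun _ hr => hr.elim) (fun i => i.elim0) (by simp)
    (fun i => i.elim0) (fun i => i.elim0) (by simp) (mul_one 1) (zero_add _) (by simp [weight])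

lemma exists_isPresentedCalabiYau_relCY {t h : kˣ} {v : Fin 2 → A}
    (Q : IsPresentedBy (relCY t h) v) :
    ∃ T, IsPresentedCalabiYau (relCY t h) ![(1, 2), (0, 1)] (halfPlane (-2) 1) T
      ((t / h) ^ 3, (t / h)⁻¹) (1, 3) 2 v := by
  obtain ⟨B, _, _, z, P⟩ := exists_isPresentedBy (relY k)
  obtain ⟨T, G⟩ := exists_isPresentedCalabiYau_relY P
  have relY_upper : Satisfies (relY k) fun i => upper (![(t / h : k)] i • z i)
      (FreeAlgebra.lift k z (![0] i)) (z i) := by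
    rw [relY, satisfies_oreRelations]
    simp [Satisfies]
  exact G.step Q relY_upper (u := (((t / h) ^ 3)⁻¹, t / h)) (by simp [weight]) (by simp) (by simp)
    (by simp) (by simp) (by ext <;> simp) (by simp) (by ext; simp [weight]; field_simp)

lemma exists_isPresentedCalabiYau_relACY {t h : kˣ} {v : Fin 3 → A}
    (Q : IsPresentedBy (relACY t h) v) :
    ∃ T, IsPresentedCalabiYau (relACY t h) ![(1, 1), (1, 2), (0, 1)] (halfPlane (-1) 1) T
      ((t / h) ^ 3 * (t * h), -(t / h * t)⁻¹) (2, 4) 3 v := by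
  obtain ⟨B, _, _, z, P⟩ := exists_isPresentedBy (relCY t h)
  obtain ⟨T, G⟩ := exists_isPresentedCalabiYau_relCY P
  have c_mem : z 0 ∈ homog T (1, 2) := G.mem_homog 0
  exact G.step Q (satisfies_relCY_upper P.satisfies) (u := ((t * h)⁻¹, -t))
    (by simp [weight, Fin.forall_fin_succ]; field_simp) (by simp)
    (by simpa [Fin.forall_fin_succ] using c_mem) (by simp [Fin.forall_fin_succ]) (by simp)
    (by ext <;> simp; field_simp) (by simp) (by ext; simp [weight]; field_simp)

lemma exists_isPresentedCalabiYau_relBACY {t h : kˣ} {r : k} {v : Fin 4 → A}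
    (Q : IsPresentedBy (relBACY t h r) v) :
    ∃ T, IsPresentedCalabiYau (relBACY t h r) ![(2, 1), (1, 1), (1, 2), (0, 1)]
      (halfPlane (-1) 2) T (-t ^ 5, (t ^ 4)⁻¹) (4, 5) 4 v := by
  obtain ⟨B, _, _, z, P⟩ := exists_isPresentedBy (relACY t h)
  obtain ⟨T, G⟩ := exists_isPresentedCalabiYau_relACY P
  have a_cube_mem := Submodule.smul_mem _ (-(r * (t / h + t)) : k) (pow_mem_homog (G.mem_homog 0) 3)
  have a_sq_mem := Submodule.smul_mem _ (-r) (pow_mem_homog (G.mem_homog 0) 2)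
  exact G.step Q (satisfies_relACY_upper P.satisfies r) (u := (-(t * h ^ 2)⁻¹, -(t ^ 2 * h)))
    (by simp [weight, Fin.forall_fin_succ]; field_simp; simp) (by simp)
    (by simpa [Fin.forall_fin_succ] using And.intro a_cube_mem a_sq_mem)
    (by simp [Fin.forall_fin_succ]) (by simp)
    (by ext <;> simp <;> field_simp) (by simp) (by ext; simp [weight]; field_simp)

theorem exists_isPresentedCalabiYau_relXBACY {t h : kˣ} {r : k}
    (hr : r * (h * (h - 1)) = t * (h ^ 3 + 1)) {v : Fin 5 → A}
    (Q : IsPresentedBy (relXBACY t h r) v) :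
    ∃ T, IsPresentedCalabiYau (relXBACY t h r) ![(1, 0), (2, 1), (1, 1), (1, 2), (0, 1)] ⊤ T
      (t ^ 5 * h, (t ^ 5 * h)⁻¹) (5, 5) 5 v := by
  obtain ⟨B, _, _, z, P⟩ := exists_isPresentedBy (relBACY t h r)
  obtain ⟨T, G⟩ := exists_isPresentedCalabiYau_relBACY P
  have b_mem : z 0 ∈ homog T (2, 1) := G.mem_homog 0
  have a_mem : z 1 ∈ homog T (1, 1) := G.mem_homog 1
  have a_sq_mem := Submodule.smul_mem _ (-r) (pow_mem_homog a_mem 2)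
  exact G.step Q (satisfies_relBACY_upper hr P.satisfies) (u := (-h⁻¹, t * h))
    (by simp [weight, Fin.forall_fin_succ]; field_simp; simp) (by simp)
    (by simpa [Fin.forall_fin_succ] using And.intro b_mem (And.intro a_sq_mem a_mem))
    (fun _ => trivial) trivial
    (by ext <;> simp; field_simp) (by simp) (by ext; simp [weight]; field_simp)

end Torus

end Tower

section TwoGenerators

variable {k : Type u} [Field k] {A : Type u} [Ring A] [Algebra k A]

/-- The skew commutator of `x` and `y`, which is the generator `a` of the iterated Ore extension. -/
def skewA (t h : kˣ) (x y : A) : A := x * y - (t * h : k) • (y * x)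

/-- The skew commutator of `x` and `skewA`, which is the generator `b` of the iterated Ore
extension. -/
def skewB (t h : kˣ) (x y : A) : A := x * skewA t h x y + (t : k) • (skewA t h x y * x)

/-- The skew commutator of `skewA` and `y`, which is the generator `c` of the iterated Ore
extension. -/
def skewC (t h : kˣ) (x y : A) : A := skewA t h x y * y + (t : k) • (y * skewA t h x y)

/-- The relations between `x` and `y` obtained by eliminating `a`, `b` and `c` from the iterated Ore
extension, except those which follow from the others; both algebras of the theorem are presented by
such relations. -/
def skewRelations (t h : kˣ) (r : k) : Set (FreeAlgebra k (Fin 2)) :=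
  let x := fx k
  let y := fy k
  {x * skewB t h x y - (t / h : k) • (skewB t h x y * x),
    skewB t h x y * y - ((-t ^ 2 * h : k) • (y * skewB t h x y) + (-r) • skewA t h x y ^ 2),
    skewC t h x y * y - (t / h : k) • (y * skewC t h x y)}

variable {t h : kˣ} {r : k}

lemma skewRelations_eq (t h : kˣ) (r : k) : skewRelations t h r =
    {cubicX (t * (1 - h - 1 / h) : k) (t ^ 2 * (1 - h - 1 / h)) (t ^ 3),
      mixed (t - t * h + r) (t ^ 3 * h * (1 - h) + t ^ 2 * h ^ 2 * r) (-t ^ 4 * h ^ 2)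
        (-(t * h * r)),
      cubicY (t * (1 - h - 1 / h) : k) (t ^ 2 * (1 - h - 1 / h)) (t ^ 3)} := by
  rw [skewRelations]
  congrm {?_, ?_, ?_}
  all_goals
    simp only [cubicX, mixed, cubicY, skewB, skewC, skewA, mul_add, add_mul, mul_sub, sub_mul,
      smul_mul_assoc, mul_smul_comm, mul_assoc, pow_succ, pow_zero, one_mul, smul_add, smul_sub,
      smul_smul]
    match_scalars <;> field_simp <;> ring

section Map

variable {B : Type u} [Ring B] [Algebra k B] (φ : A →ₐ[k] B) (x y : A)

lemma map_skewA : φ (skewA t h x y) = skewA t h (φ x) (φ y) := by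
  simp only [skewA, map_sub, map_smul, map_mul]

lemma map_skewB : φ (skewB t h x y) = skewB t h (φ x) (φ y) := by
  simp only [skewB, map_skewA, map_add, map_smul, map_mul]

lemma map_skewC : φ (skewC t h x y) = skewC t h (φ x) (φ y) := by
  simp only [skewC, map_skewA, map_add, map_smul, map_mul]

end Map

lemma satisfies_skewRelations {v : Fin 2 → A} : Satisfies (skewRelations t h r) v ↔
    v 0 * skewB t h (v 0) (v 1) = (t / h : k) • (skewB t h (v 0) (v 1) * v 0) ∧
    skewB t h (v 0) (v 1) * v 1 =
      (-t ^ 2 * h : k) • (v 1 * skewB t h (v 0) (v 1)) + (-r) • skewA t h (v 0) (v 1) ^ 2 ∧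
    skewC t h (v 0) (v 1) * v 1 = (t / h : k) • (v 1 * skewC t h (v 0) (v 1)) := by
  simp only [Satisfies, skewRelations, Set.mem_insert_iff, Set.mem_singleton_iff, forall_eq_or_imp,
    forall_eq, map_sub, map_add, map_smul, map_mul, map_pow, map_skewA, map_skewB, map_skewC,
    FreeAlgebra.lift_ι_apply, sub_eq_zero]

section Commutation

variable {x y : A}

lemma mul_eq_skewA : x * y = (t * h : k) • (y * x) + skewA t h x y := by
  rw [skewA, add_sub_cancel]

lemma mul_skewA : x * skewA t h x y = (-t : k) • (skewA t h x y * x) + skewB t h x y := by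
  rw [skewB, neg_smul]
  abel

lemma skewA_mul : skewA t h x y * y = (-t : k) • (y * skewA t h x y) + skewC t h x y := by
  rw [skewC, neg_smul]
  abel

lemma mul_skewC (hby : skewB t h x y * y =
      (-t ^ 2 * h : k) • (y * skewB t h x y) + (-r) • skewA t h x y ^ 2) :
    x * skewC t h x y = (-t ^ 2 * h : k) • (skewC t h x y * x) + (-r) • skewA t h x y ^ 2 := by
  have xy := mul_eq_skewA (t := t) (h := h) (x := x) (y := y)
  have xa := mul_skewA (t := t) (h := h) (x := x) (y := y)
  simp only [skewC, mul_add, add_mul, smul_mul_assoc, mul_smul_comm, mul_assoc, pow_succ, pow_zero,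
    one_mul, smul_add, smul_smul, xy, mul_mul_of_eq xy, xa, mul_mul_of_eq xa, hby]
  match_scalars <;> field_simp <;> ring

lemma add_div_ne_zero_of_eq (hr : r * (h * (h - 1)) = t * (h ^ 3 + 1))
    (hsq : (h : k) ^ 2 + 1 ≠ 0) : r + t / h ≠ 0 := by
  intro eq_zero
  field_simp at eq_zero
  have prod_eq_zero : (t : k) * (h * (h ^ 2 + 1)) = 0 := by
    linear_combination (h - 1 : k) * eq_zero - hr
  exact mul_ne_zero t.ne_zero (mul_ne_zero h.ne_zero hsq) prod_eq_zero

lemma skewA_mul_skewC (hr : r * (h * (h - 1)) = t * (h ^ 3 + 1)) (hsq : (h : k) ^ 2 + 1 ≠ 0)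
    (hxc : x * skewC t h x y =
      (-t ^ 2 * h : k) • (skewC t h x y * x) + (-r) • skewA t h x y ^ 2)
    (hcy : skewC t h x y * y = (t / h : k) • (y * skewC t h x y)) :
    skewA t h x y * skewC t h x y = (t / h : k) • (skewC t h x y * skewA t h x y) := by
  have xy := mul_eq_skewA (t := t) (h := h) (x := x) (y := y)
  have ay := skewA_mul (t := t) (h := h) (x := x) (y := y)
  have overlap : x * skewC t h x y * y = (t / h : k) • (x * y * skewC t h x y) := by
    rw [mul_assoc, hcy, mul_smul_comm, mul_assoc]
  rw [hxc, xy] at overlap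
  simp only [mul_add, add_mul, smul_mul_assoc, mul_smul_comm, mul_assoc, pow_succ, pow_zero,
    one_mul, smul_add, smul_smul, xy, hxc, ay, mul_mul_of_eq ay, mul_mul_of_eq hcy] at overlap
  apply smul_right_injective A (add_div_ne_zero_of_eq hr hsq)
  linear_combination (norm := (match_scalars <;> field_simp <;> ring))
    (-1 : k) • overlap + (t / h ^ 2 * hr) • (skewC t h x y * skewA t h x y)

lemma skewB_mul_skewA (hr : r * (h * (h - 1)) = t * (h ^ 3 + 1)) (hsq : (h : k) ^ 2 + 1 ≠ 0)
    (hby : skewB t h x y * y =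
      (-t ^ 2 * h : k) • (y * skewB t h x y) + (-r) • skewA t h x y ^ 2)
    (hxb : x * skewB t h x y = (t / h : k) • (skewB t h x y * x)) :
    skewB t h x y * skewA t h x y = (t / h : k) • (skewA t h x y * skewB t h x y) := by
  have xy := mul_eq_skewA (t := t) (h := h) (x := x) (y := y)
  have xa := mul_skewA (t := t) (h := h) (x := x) (y := y)
  have overlap : x * (skewB t h x y * y) = (t / h : k) • (skewB t h x y * (x * y)) := by
    rw [← mul_assoc, hxb, smul_mul_assoc, mul_assoc]
  rw [hby, xy] at overlap
  simp only [mul_add, add_mul, smul_mul_assoc, mul_smul_comm, mul_assoc, pow_succ, pow_zero,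
    one_mul, smul_add, smul_smul, mul_mul_of_eq xy, xa, mul_mul_of_eq xa, hxb,
    mul_mul_of_eq hby] at overlap
  apply smul_right_injective A (add_div_ne_zero_of_eq hr hsq)
  linear_combination (norm := (match_scalars <;> field_simp <;> ring))
    (-1 : k) • overlap + (t / h ^ 2 * hr) • (skewA t h x y * skewB t h x y)

lemma skewB_mul_skewC
    (hxc : x * skewC t h x y =
      (-t ^ 2 * h : k) • (skewC t h x y * x) + (-r) • skewA t h x y ^ 2)
    (hac : skewA t h x y * skewC t h x y = (t / h : k) • (skewC t h x y * skewA t h x y)) :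
    skewB t h x y * skewC t h x y =
      (-t ^ 3 : k) • (skewC t h x y * skewB t h x y) +
        (-(r * (t / h + t))) • skewA t h x y ^ 3 := by
  have xa := mul_skewA (t := t) (h := h) (x := x) (y := y)
  have overlap : x * skewA t h x y * skewC t h x y =
      (t / h : k) • (x * skewC t h x y * skewA t h x y) := by
    rw [mul_assoc, hac, mul_smul_comm, mul_assoc]
  rw [xa, hxc] at overlap
  simp only [mul_add, add_mul, smul_mul_assoc, mul_smul_comm, mul_assoc, pow_succ, pow_zero,
    one_mul, smul_add, smul_smul, xa, hxc, mul_mul_of_eq hac] at overlap ⊢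
  linear_combination (norm := (match_scalars <;> field_simp <;> ring)) overlap

end Commutation

lemma Satisfies.relXBACY {v : Fin 2 → A} (hv : Satisfies (skewRelations t h r) v)
    (hr : r * (h * (h - 1)) = t * (h ^ 3 + 1)) (hsq : (h : k) ^ 2 + 1 ≠ 0) :
    Satisfies (relXBACY t h r) ![v 0, skewB t h (v 0) (v 1), skewA t h (v 0) (v 1),
      skewC t h (v 0) (v 1), v 1] := by
  obtain ⟨xb, b_y, cy⟩ := satisfies_skewRelations.1 hv
  have xc := mul_skewC b_y
  have ac := skewA_mul_skewC hr hsq xc cy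
  exact satisfies_relXBACY.2 ⟨satisfies_relBACY.2 ⟨satisfies_relACY.2 ⟨cy, ac, skewA_mul⟩,
    skewB_mul_skewA hr hsq b_y xb, skewB_mul_skewC xc ac, b_y⟩, xb, mul_skewA, xc, mul_eq_skewA⟩

lemma satisfies_skewRelations_of_relXBACY {v : Fin 5 → A} (hv : Satisfies (relXBACY t h r) v) :
    skewA t h (v 0) (v 4) = v 2 ∧ skewB t h (v 0) (v 4) = v 1 ∧ skewC t h (v 0) (v 4) = v 3 ∧
      Satisfies (skewRelations t h r) ![v 0, v 4] := by
  obtain ⟨hv', xb, xa, -, xy⟩ := satisfies_relXBACY.1 hv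
  obtain ⟨hv'', -, -, b_y⟩ := satisfies_relBACY.1 hv'
  obtain ⟨cy, -, ay⟩ := satisfies_relACY.1 hv''
  simp only [Fin.tail, Fin.succ_zero_eq_one, Fin.succ_one_eq_two, Fin.reduceSucc] at cy ay b_y
  have skewA_eq : skewA t h (v 0) (v 4) = v 2 := by rw [skewA, xy, add_sub_cancel_left]
  have skewB_eq : skewB t h (v 0) (v 4) = v 1 := by rw [skewB, skewA_eq, xa, neg_smul]; abel
  have skewC_eq : skewC t h (v 0) (v 4) = v 3 := by rw [skewC, skewA_eq, ay, neg_smul]; abel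
  refine ⟨skewA_eq, skewB_eq, skewC_eq, satisfies_skewRelations.2 ?_⟩
  simp only [Matrix.cons_val, skewA_eq, skewB_eq, skewC_eq]
  exact ⟨xb, b_y, cy⟩

theorem IsPresentedBy.relXBACY {v : Fin 2 → A} (P : IsPresentedBy (skewRelations t h r) v)
    (hr : r * (h * (h - 1)) = t * (h ^ 3 + 1)) (hsq : (h : k) ^ 2 + 1 ≠ 0) :
    IsPresentedBy (relXBACY t h r) ![v 0, skewB t h (v 0) (v 1), skewA t h (v 0) (v 1),
      skewC t h (v 0) (v 1), v 1] where
  satisfies := P.satisfies.relXBACY hr hsq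
  adjoin_eq_top := by
    rw [eq_top_iff, ← P.adjoin_eq_top]
    refine Algebra.adjoin_mono (Set.range_subset_iff.2 ?_)
    exact Fin.forall_fin_two.2 ⟨⟨0, rfl⟩, ⟨4, rfl⟩⟩
  exists_lift C _ _ v' hv' := by
    obtain ⟨skewA_eq, skewB_eq, skewC_eq, hv⟩ := satisfies_skewRelations_of_relXBACY hv'
    obtain ⟨φ, hφ⟩ := P.exists_lift C _ hv
    have φ_x : φ (v 0) = v' 0 := hφ 0
    have φ_y : φ (v 1) = v' 4 := hφ 1
    refine ⟨φ, fun i => ?_⟩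
    fin_cases i <;> simp [map_skewA, map_skewB, map_skewC, φ_x, φ_y, skewA_eq, skewB_eq, skewC_eq]

theorem exists_isTwistedCalabiYau_of_skewRelations [Infinite k] {v : Fin 2 → A}
    (P : IsPresentedBy (skewRelations t h r) v) (hr : r * (h * (h - 1)) = t * (h ^ 3 + 1))
    (hsq : (h : k) ^ 2 + 1 ≠ 0) :
    ∃ ν : A ≃ₐ[k] A, ν (v 0) = (t ^ 5 * h : k) • v 0 ∧ ν (v 1) = (t ^ 5 * h : k)⁻¹ • v 1 ∧
      IsTwistedCalabiYau k ν 5 := by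
  obtain ⟨T, G⟩ := exists_isPresentedCalabiYau_relXBACY hr (P.relXBACY hr hsq)
  obtain ⟨ι, _, _, deg, wt, o, t', D, K⟩ := G.complex
  let ν := torusEquiv G.iSup_homog_eq_top (t ^ 5 * h, (t ^ 5 * h)⁻¹)
  have complex : IsCalabiYauComplex (ν : A →ₐ[k] A) 5 deg o t' D := K.toIsCalabiYauComplex
  exact ⟨ν, (G.mem_homog 0 _).trans (by simp [weight]), (G.mem_homog 4 _).trans (by simp [weight]),
    complex.isTwistedCalabiYau (by norm_num)⟩

end TwoGenerators

section CalabiYau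

variable {k : Type u} [Field k] {A : Type u} [Ring A] [Algebra k A]

lemma IsTwistedCalabiYau.dim_eq [Nontrivial A] {ν ν' : A ≃ₐ[k] A} {d d' : ℕ}
    (H : IsTwistedCalabiYau k ν d) (H' : IsTwistedCalabiYau k ν' d') : d = d' := by
  by_contra hd
  obtain ⟨e, -⟩ := H.ext_top
  refine one_ne_zero (α := A) ?_
  rw [← e.apply_symm_apply 1, H'.ext_eq_zero d hd (e.symm 1), map_zero]

lemma IsTwistedCalabiYau.exists_mul_eq_mul {ν ν' : A ≃ₐ[k] A} {d : ℕ}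
    (H : IsTwistedCalabiYau k ν d) (H' : IsTwistedCalabiYau k ν' d) :
    ∃ w m : A, m * w = 1 ∧ ∀ a, ν a * w = w * ν' a := by
  obtain ⟨e, he⟩ := H.ext_top
  obtain ⟨e', he'⟩ := H'.ext_top
  have bilinear (b m a : A) : e' (e.symm (b * m * ν a)) = b * e' (e.symm m) * ν' a := by
    rw [← he', ← e.symm_apply_apply (innerAct b (e.symm m) a), he, e.apply_symm_apply]
  refine ⟨e' (e.symm 1), e (e'.symm 1), ?_, fun a => ?_⟩
  · simpa using (bilinear (e (e'.symm 1)) 1 1).symm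
  · simpa using (bilinear (ν a) 1 1).symm.trans ((congrArg _ (by simp)).trans (bilinear 1 1 a))

lemma eq_one_of_isCalabiYau {ν : A ≃ₐ[k] A} {d : ℕ} (H : IsTwistedCalabiYau k ν d)
    (H' : IsCalabiYau k A) {y : A} {c : k} (hy : ν y = c • y) {B : Type*} [CommRing B] [IsDomain B]
    [Algebra k B] (ε : A →ₐ[k] B) (hε : ε y ≠ 0) : c = 1 := by
  have : Nontrivial A := ε.toRingHom.domain_nontrivial
  obtain ⟨d', H'⟩ := H'
  obtain rfl := H.dim_eq H'
  obtain ⟨w, m, mul_eq_one, intertwines⟩ := H.exists_mul_eq_mul H'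
  have ε_w_ne_zero : ε w ≠ 0 := fun h =>
    one_ne_zero (α := B) (by rw [← map_one ε, ← mul_eq_one, map_mul, h, mul_zero])
  have smul_eq : c • (ε y * ε w) = ε y * ε w := by
    rw [← smul_mul_assoc, ← map_smul, ← hy, ← map_mul, intertwines, AlgEquiv.coe_refl, id, map_mul,
      mul_comm]
  have smul_eq_zero : (c - 1) • (ε y * ε w) = 0 := by rw [sub_smul, smul_eq, one_smul, sub_self]
  exact sub_eq_zero.1 ((smul_eq_zero_iff_left (mul_ne_zero hε ε_w_ne_zero)).1 smul_eq_zero)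

lemma isCalabiYau_of_forall_eq {ν : A ≃ₐ[k] A} {d : ℕ} (H : IsTwistedCalabiYau k ν d) {s : Set A}
    (hs : Algebra.adjoin k s = ⊤) (hν : ∀ a ∈ s, ν a = a) : IsCalabiYau k A := by
  have ν_eq_id : (ν : A →ₐ[k] A) = AlgHom.id k A := AlgHom.ext_of_adjoin_eq_top hs hν
  obtain rfl : ν = AlgEquiv.refl := AlgEquiv.ext fun a => DFunLike.congr_fun ν_eq_id a
  exact ⟨d, H⟩

end CalabiYau

section Main

variable {k : Type u} [Field k]

theorem isCalabiYau_iff_of_skewRelations {A : Type u} [Ring A] [Algebra k A] {t h : kˣ} {r : k}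
    {v : Fin 2 → A} (P : IsPresentedBy (skewRelations t h r) v) {ν : A ≃ₐ[k] A} {d : ℕ}
    (H : IsTwistedCalabiYau k ν d) {c : k} (hx : ν (v 0) = c • v 0) (hy : ν (v 1) = c⁻¹ • v 1) :
    IsCalabiYau k A ↔ c = 1 := by
  refine ⟨fun H' => ?_, fun hc => isCalabiYau_of_forall_eq H P.adjoin_eq_top ?_⟩
  · obtain ⟨ε, hε⟩ := P.exists_lift (Polynomial k) ![0, Polynomial.X]
      (satisfies_skewRelations.2 (by simp [skewA, skewB, skewC]))
    have ε_y : ε (v 1) = Polynomial.X := hε 1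
    exact inv_eq_one.1 (eq_one_of_isCalabiYau H H' hy ε (ε_y ▸ Polynomial.X_ne_zero))
  · rintro _ ⟨i, rfl⟩
    fin_cases i <;> simp [hx, hy, hc]

theorem ringQuot_isTwistedCalabiYau [Infinite k] {t h : kˣ} {r : k}
    (hr : r * (h * (h - 1)) = t * (h ^ 3 + 1)) (hsq : (h : k) ^ 2 + 1 ≠ 0)
    {R : FreeAlgebra k (Fin 2) → FreeAlgebra k (Fin 2) → Prop} (hR : ∀ a b, R a b → b = 0)
    (hR_eq : {a | R a 0} = skewRelations t h r) :
    (∃ ν : RingQuot R ≃ₐ[k] RingQuot R,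
      ν (RingQuot.mkAlgHom k R (fx k)) = (t ^ 5 * h : k) • RingQuot.mkAlgHom k R (fx k) ∧
      ν (RingQuot.mkAlgHom k R (fy k)) = (t ^ 5 * h : k)⁻¹ • RingQuot.mkAlgHom k R (fy k) ∧
      IsTwistedCalabiYau k ν 5) ∧ (IsCalabiYau k (RingQuot R) ↔ (t ^ 5 * h : k) = 1) := by
  have P := hR_eq ▸ isPresentedBy_ringQuot hR
  obtain ⟨ν, ν_x, ν_y, H⟩ := exists_isTwistedCalabiYau_of_skewRelations P hr hsq
  exact ⟨⟨ν, ν_x, ν_y, H⟩, isCalabiYau_iff_of_skewRelations P H ν_x ν_y⟩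

lemma setOf_relD (p q : k) : {a | RelD p q a 0} = {cubicX p q (-(p * (2 * p ^ 2 + q))),
    mixed 0 (-(p * (p ^ 2 + q))) (-q ^ 2) (q - p ^ 2), cubicY p q (-(p * (2 * p ^ 2 + q)))} := by
  ext a
  refine ⟨fun ha => ?_, ?_⟩
  · cases (ha : RelD p q a 0) <;> simp
  · rintro (rfl | rfl | rfl)
    exacts [.r₁, .r₂, .r₃]

lemma setOf_relG (p q s g : k) : {a | RelG p q s g a 0} = {cubicX p q s,
    mixed (-(s ^ 2 * (q * s - g) / (g * (q * s + g))))
      (s - p * g * (p * s - q ^ 2) / (q * (q * s + g))) (-(g ^ 2 / s ^ 2))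
      ((p * s ^ 2 + q * g) / (q * s + g)), cubicY p q s} := by
  ext a
  refine ⟨fun ha => ?_, ?_⟩
  · cases (ha : RelG p q s g a 0) <;> simp
  · rintro (rfl | rfl | rfl)
    exacts [.r₁, .r₂, .r₃]

end Main

section Parameters

variable {k : Type u} [Field k]

lemma setOf_relD_eq_skewRelations {p q : k} (hp : p ≠ 0) (hq : q ≠ 0)
    (hpq : 2 * p ^ 4 - p ^ 2 * q + q ^ 2 = 0) :
    {a | RelD p q a 0} = skewRelations (Units.mk0 (q / p) (div_ne_zero hq hp))
      (Units.mk0 (p ^ 2 / q) (div_ne_zero (pow_ne_zero 2 hp) hq)) (q / p * (p ^ 2 / q - 1)) := by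
  have cubic₁ : p = q / p * (1 - p ^ 2 / q - 1 / (p ^ 2 / q)) := by
    field_simp
    linear_combination hpq
  have cubic₂ : q = (q / p) ^ 2 * (1 - p ^ 2 / q - 1 / (p ^ 2 / q)) := by
    field_simp
    linear_combination hpq
  have cubic₃ : -(p * (2 * p ^ 2 + q)) = (q / p) ^ 3 := by
    field_simp
    linear_combination -(p ^ 2 + q) * hpq
  have mixed₂ : 0 = q / p - q / p * (p ^ 2 / q) + q / p * (p ^ 2 / q - 1) := by ring
  have mixed₃ : -(p * (p ^ 2 + q)) = (q / p) ^ 3 * (p ^ 2 / q) * (1 - p ^ 2 / q) +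
      (q / p) ^ 2 * (p ^ 2 / q) ^ 2 * (q / p * (p ^ 2 / q - 1)) := by
    field_simp
    linear_combination -hpq
  have mixed₄ : -q ^ 2 = -(q / p) ^ 4 * (p ^ 2 / q) ^ 2 := by field_simp
  have mixed₅ : q - p ^ 2 = -(q / p * (p ^ 2 / q) * (q / p * (p ^ 2 / q - 1))) := by
    field_simp
    ring
  rw [setOf_relD, skewRelations_eq]
  simp only [Units.val_mk0]
  rw [← mixed₂, ← mixed₃, ← mixed₄, ← mixed₅, ← cubic₁, ← cubic₂, ← cubic₃]

lemma sq_sq_div_add_one_ne_zero {p q : k} (two_ne : (2 : k) ≠ 0) (hp : p ≠ 0)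
    (hq : q ≠ 0) (hpq : 2 * p ^ 4 - p ^ 2 * q + q ^ 2 = 0) : (p ^ 2 / q) ^ 2 + 1 ≠ 0 := by
  intro eq_zero
  field_simp at eq_zero
  have prod_eq_zero : p ^ 2 * (p ^ 2 - q) = 0 := by linear_combination hpq - eq_zero
  obtain rfl : p ^ 2 = q :=
    sub_eq_zero.1 ((mul_eq_zero_iff_left (pow_ne_zero 2 hp)).1 prod_eq_zero)
  exact mul_ne_zero two_ne (pow_ne_zero 4 hp) (by linear_combination hpq)

theorem algD_isTwistedCalabiYau [Infinite k] {p q : k} (two_ne : (2 : k) ≠ 0) (hp : p ≠ 0)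
    (hq : q ≠ 0) (hpq : 2 * p ^ 4 - p ^ 2 * q + q ^ 2 = 0) :
    (∃ ν : AlgD p q ≃ₐ[k] AlgD p q,
      ν (AlgD.x p q) = (p⁻¹ ^ 3 * q ^ 4) • AlgD.x p q ∧
      ν (AlgD.y p q) = (p ^ 3 * q⁻¹ ^ 4) • AlgD.y p q ∧ IsTwistedCalabiYau k ν 5) ∧
    (IsCalabiYau k (AlgD p q) ↔ p⁻¹ ^ 3 * q ^ 4 = 1) := by
  have scalar_eq : p⁻¹ ^ 3 * q ^ 4 = (q / p) ^ 5 * (p ^ 2 / q) := by field_simp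
  have inv_scalar_eq : p ^ 3 * q⁻¹ ^ 4 = ((q / p) ^ 5 * (p ^ 2 / q))⁻¹ := by field_simp
  have skew_param : q / p * (p ^ 2 / q - 1) * (p ^ 2 / q * (p ^ 2 / q - 1)) =
      q / p * ((p ^ 2 / q) ^ 3 + 1) := by
    field_simp
    linear_combination -q * hpq
  rw [scalar_eq, inv_scalar_eq]
  exact ringQuot_isTwistedCalabiYau skew_param (sq_sq_div_add_one_ne_zero two_ne hp hq hpq)
    (fun a b hab => by cases hab <;> rfl) (setOf_relD_eq_skewRelations hp hq hpq)

lemma exists_skew_parameters {p q s g : k} (hp : p ≠ 0) (hq : q ≠ 0) (hg : g ≠ 0)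
    (sum_eq : p * s ^ 3 * g + q * s * g ^ 2 + s ^ 5 + g ^ 3 = 0) (cube_eq : p ^ 3 * s = q ^ 3)
    (ps_ne : p * s ≠ q ^ 2) (qs_ne : q ^ 2 * s ^ 2 ≠ g ^ 2) (sg_ne : s ^ 5 + g ^ 3 ≠ 0) :
    ∃ t h : kˣ, q = t * p ∧ s = t ^ 3 ∧ g = t ^ 5 * h ∧ p * h = t * (h - h ^ 2 - 1) ∧
      (h : k) - 1 ≠ 0 ∧ (h : k) ^ 2 + 1 ≠ 0 := by
  obtain ⟨t, ht⟩ : ∃ t : kˣ, (t : k) = q / p := ⟨Units.mk0 _ (div_ne_zero hq hp), rfl⟩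
  obtain ⟨h, hh⟩ : ∃ h : kˣ, (h : k) = g / t ^ 5 :=
    ⟨Units.mk0 _ (div_ne_zero hg (pow_ne_zero 5 t.ne_zero)), rfl⟩
  obtain rfl : q = t * p := by rw [ht, div_mul_cancel₀ _ hp]
  obtain rfl : g = t ^ 5 * h := by rw [hh]; field_simp
  obtain rfl : s = t ^ 3 := mul_left_cancel₀ (pow_ne_zero 3 hp) (by linear_combination cube_eq)
  have h_add_one_ne_zero : (h : k) + 1 ≠ 0 := fun e =>
    sg_ne (by linear_combination t ^ 15 * (h ^ 2 - h + 1) * e)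
  have p_mul_h : p * h = t * (h - h ^ 2 - 1) := by
    apply mul_left_cancel₀ (mul_ne_zero (pow_ne_zero 14 t.ne_zero) h_add_one_ne_zero)
    linear_combination sum_eq
  refine ⟨t, h, rfl, rfl, rfl, p_mul_h, fun h_sub_one_eq => qs_ne ?_,
    fun sq_add_one_eq => ps_ne ?_⟩
  · have h_eq : (h : k) = 1 := sub_eq_zero.1 h_sub_one_eq
    have p_eq : p = -t := by linear_combination p_mul_h - (p + t * h) * h_eq
    rw [p_eq, h_eq]
    ring
  · obtain rfl : p = t :=
      mul_right_cancel₀ h.ne_zero (by linear_combination p_mul_h - t * sq_add_one_eq)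
    ring

lemma setOf_relG_eq_skewRelations {p : k} {t h : kˣ} (hph : p * h = t * (h - h ^ 2 - 1))
    (h_sub_one : (h : k) - 1 ≠ 0) :
    {a | RelG p (t * p) (t ^ 3) (t ^ 5 * h) a 0} =
      skewRelations t h (t * (h ^ 3 + 1) / (h * (h - 1))) := by
  have cubic₁ : p = t * (1 - h - 1 / h) := by
    field_simp
    linear_combination hph
  have denominator_eq : t * p * t ^ 3 + t ^ 5 * h = (t ^ 5 * (h - 1) / h : k) := by
    rw [cubic₁]
    field_simp
    ring
  rw [setOf_relG, skewRelations_eq, denominator_eq, cubic₁]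
  congrm {cubicX _ ?_ _, mixed ?_ ?_ ?_ ?_, cubicY _ ?_ _} <;> field_simp <;> ring

theorem algG_isTwistedCalabiYau [Infinite k] {p q s g : k} (hp : p ≠ 0) (hq : q ≠ 0) (hg : g ≠ 0)
    (sum_eq : p * s ^ 3 * g + q * s * g ^ 2 + s ^ 5 + g ^ 3 = 0) (cube_eq : p ^ 3 * s = q ^ 3)
    (ps_ne : p * s ≠ q ^ 2) (qs_ne : q ^ 2 * s ^ 2 ≠ g ^ 2) (sg_ne : s ^ 5 + g ^ 3 ≠ 0) :
    (∃ ν : AlgG p q s g ≃ₐ[k] AlgG p q s g,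
      ν (AlgG.x p q s g) = g • AlgG.x p q s g ∧
      ν (AlgG.y p q s g) = g⁻¹ • AlgG.y p q s g ∧ IsTwistedCalabiYau k ν 5) ∧
    (IsCalabiYau k (AlgG p q s g) ↔ g = 1) := by
  obtain ⟨t, h, rfl, rfl, rfl, hph, h_sub_one, h_sq_add_one⟩ :=
    exists_skew_parameters hp hq hg sum_eq cube_eq ps_ne qs_ne sg_ne
  exact ringQuot_isTwistedCalabiYau
    (div_mul_cancel₀ _ (mul_ne_zero h.ne_zero h_sub_one)) h_sq_add_one
    (fun a b hab => by cases hab <;> rfl) (setOf_relG_eq_skewRelations hph h_sub_one)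

end Parameters

end TwistedCY

theorem mainTheorem6_general {k : Type u} [Field k] [Infinite k] :
    ((2 : k) ≠ 0 → ∀ p q : k, p ≠ 0 → q ≠ 0 → 2 * p ^ 4 - p ^ 2 * q + q ^ 2 = 0 →
      (∃ ν : TwistedCY.AlgD p q ≃ₐ[k] TwistedCY.AlgD p q,
        ν (TwistedCY.AlgD.x p q) = (p⁻¹ ^ 3 * q ^ 4) • TwistedCY.AlgD.x p q ∧
        ν (TwistedCY.AlgD.y p q) = (p ^ 3 * q⁻¹ ^ 4) • TwistedCY.AlgD.y p q ∧
        TwistedCY.IsTwistedCalabiYau k ν 5) ∧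
      (TwistedCY.IsCalabiYau k (TwistedCY.AlgD p q) ↔
        p ^ 3 = q ^ 4 ∧ 2 * p ^ 4 - p ^ 2 * q + q ^ 2 = 0)) ∧
    (∀ p q s g : k, p ≠ 0 → q ≠ 0 → g ≠ 0 →
      p * s ^ 3 * g + q * s * g ^ 2 + s ^ 5 + g ^ 3 = 0 → p ^ 3 * s = q ^ 3 →
      p * s ≠ q ^ 2 → q ^ 2 * s ^ 2 ≠ g ^ 2 → s ^ 5 + g ^ 3 ≠ 0 →
      (∃ ν : TwistedCY.AlgG p q s g ≃ₐ[k] TwistedCY.AlgG p q s g,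
        ν (TwistedCY.AlgG.x p q s g) = g • TwistedCY.AlgG.x p q s g ∧
        ν (TwistedCY.AlgG.y p q s g) = g⁻¹ • TwistedCY.AlgG.y p q s g ∧
        TwistedCY.IsTwistedCalabiYau k ν 5) ∧
      (TwistedCY.IsCalabiYau k (TwistedCY.AlgG p q s g) ↔ g = 1)) := by
  refine ⟨fun two_ne p q hp hq hpq => ?_, fun p q s g hp hq hg sum_eq cube_eq ps_ne qs_ne sg_ne =>
    TwistedCY.algG_isTwistedCalabiYau hp hq hg sum_eq cube_eq ps_ne qs_ne sg_ne⟩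
  obtain ⟨twisted, iff_scalar⟩ := TwistedCY.algD_isTwistedCalabiYau two_ne hp hq hpq
  refine ⟨twisted, iff_scalar.trans ?_⟩
  rw [and_iff_left hpq, inv_pow, inv_mul_eq_one₀ (pow_ne_zero 3 hp)]

theorem mainTheorem6 {k : Type u} [Field k] [CharZero k] :
    (∀ p q : k, p ≠ 0 → q ≠ 0 → 2 * p ^ 4 - p ^ 2 * q + q ^ 2 = 0 →
      (∃ ν : TwistedCY.AlgD p q ≃ₐ[k] TwistedCY.AlgD p q,
        ν (TwistedCY.AlgD.x p q) = (p⁻¹ ^ 3 * q ^ 4) • TwistedCY.AlgD.x p q ∧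
        ν (TwistedCY.AlgD.y p q) = (p ^ 3 * q⁻¹ ^ 4) • TwistedCY.AlgD.y p q ∧
        TwistedCY.IsTwistedCalabiYau k ν 5) ∧
      (TwistedCY.IsCalabiYau k (TwistedCY.AlgD p q) ↔
        p ^ 3 = q ^ 4 ∧ 2 * p ^ 4 - p ^ 2 * q + q ^ 2 = 0)) ∧
    (∀ p q s g : k, p ≠ 0 → q ≠ 0 → s ≠ 0 → g ≠ 0 →
      p * s ^ 3 * g + q * s * g ^ 2 + s ^ 5 + g ^ 3 = 0 → p ^ 3 * s = q ^ 3 →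
      p * s ≠ q ^ 2 → q ^ 2 * s ^ 2 ≠ g ^ 2 → s ^ 5 + g ^ 3 ≠ 0 →
      (∃ ν : TwistedCY.AlgG p q s g ≃ₐ[k] TwistedCY.AlgG p q s g,
        ν (TwistedCY.AlgG.x p q s g) = g • TwistedCY.AlgG.x p q s g ∧
        ν (TwistedCY.AlgG.y p q s g) = g⁻¹ • TwistedCY.AlgG.y p q s g ∧
        TwistedCY.IsTwistedCalabiYau k ν 5) ∧
      (TwistedCY.IsCalabiYau k (TwistedCY.AlgG p q s g) ↔ g = 1)) :=
  ⟨mainTheorem6_general.1 two_ne_zero, fun p q s g hp hq _ =>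
    mainTheorem6_general.2 p q s g hp hq⟩
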